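/- **Setting.** Let $\alpha_+,\alpha_-,\alpha_+',\alpha_-'\in\mathbb R$ and put $$\kappa=(\alpha_--\alpha_+',\ \alpha_--\alpha_+',\ \alpha_-+\alpha_+',\ \alpha_-+\alpha_+',\ \alpha_+-\alpha_+',\ \alpha_++\alpha_+',\ \alpha_++\alpha_+',\ \alpha_++\alpha_+',\ \alpha_++\alpha_+'),$$ $\lambda_j=-\mathrm i\,\kappa_j$ and $B=\mathrm{diag}(\lambda_1^2,\dots,\lambda_9^2)=-\mathrm{diag}(\kappa_1^2,\dots,\kappa_9^2)$. Let $M_B$ be the 11-dimensional Cahen–Wallach space, i.e. $\mathbb R^{11}$ with coordinates $(x^+,x^-,x^1,\dots,x^9)$ and the Lorentzian metric $$g_B=2\,dx^+dx^--\textstyle\sum_{i,j} B_{ij}x^ix^j\,(dx^-)^2+\sum_i (dx^i)^2 .$$ Let $V=\mathbb R^9$, $W=\mathbb R^{1,1}\oplus V$ with null basis $e_\pm$ of $\mathbb R^{1,1}$, $\langle e_+,e_-\rangle=1$. $M_B$ is called indecomposable if $W$ has no proper non-zero subspace that is invariant under all maps $w\mapsto\langle e_+,w\rangle Bv-\langle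 Bv,w\rangle e_+$ ($v\in V$) and on which $\langle\cdot,\cdot\rangle$ is non-degenerate (equivalently, $\det B\ne0$). Assume that $M_B$ is indecomposable. *Spinors.* With the Pauli matrices $\sigma_k$ and the matrices $L_1,\dots,L_7$ of left multiplication by the imaginary octonion units, let $\gamma_a=\sigma_1\otimes L_a$ ($a\le7$), $\gamma_8=-\mathrm i\sigma_2\otimes1$, $\gamma_9=-\mathrm i\sigma_3\otimes1$ on $S(V)=\mathbb C^{16}$, so that $\gamma_i\gamma_j+\gamma_j\gamma_i=-2\delta_{ij}$, and $C_V=\sigma_3\otimes1$. On $S(W)=\mathbb C^2\otimes S(V)=S^-\oplus S^+$ (first and second component, each a copy of $S(V)$) let $\gamma_+=\sqrt2\begin{pmatrix}0&1\\0&0\end{pmatrix}$, $\gamma_-=\sqrt2\begin{pmatrix}0&0\\-1&0\end{pmatrix}$, $\Gamma_\pm=\gamma_\pm\otimes1$, $\Gamma_i=\mathrm{diag}(-1,1)\otimes\gamma_i$ and let $C$ be the bilinear form with matrix $\sigma_2\otimes C_V$. The spinor bundle of $M_B$, of rank 32, is trivialised by the frame $\partial_+,\ \partial_-+\frac12\sum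 B_{ij}x^ix^j\partial_+,\ \partial_i$, and $\nabla$ denotes the Levi-Civita connection on vector fields and on spinors. Let $X^\pm=\frac12(1\pm\gamma_1\gamma_2\gamma_3\gamma_4)$, $\gamma_{125}=\gamma_1\gamma_2\gamma_5$, $$\bar c=(\alpha_+X^++\alpha_-X^-)\gamma_{125},\qquad d=(\alpha_+'X^++\alpha_-'X^-)\gamma_{125},$$ $s_{\bar c,d}(v)=\bar c\,v-v\,d$ and $s_{d,\bar c}(v)=d\,v-v\,\bar c$ for $v\in V$, where $e_i$ acts as $\gamma_i$. Let $D$ be the connection $D_\mu=\nabla_\mu+\rho(e_\mu)$ on spinors with $\rho(e_+)=0$, $\rho(e_-)=\begin{pmatrix}\bar c&0\\0&d\end{pmatrix}$, $\rho(e_i)=-\frac1{\sqrt2}\begin{pmatrix}0&s_{\bar c,d}(e_i)\\0&0\end{pmatrix}$ (with respect to the frame above). *The superalgebra.* $\mathcal K_0$ is the complex span of the Killing vector fields $$K_{(\pm)}=\partial_\pm,\quad K_{(i)}=\cos(\lambda_ix^-)\partial_i+\lambda_i\sin(\lambda_ix^-)x^i\partial_+,\quad K_{(i^*)}=\lambda_i\sin(\lambda_ix^-)\partial_i-\lambda_i^2\cos(\lambda_ix^-)x^i\partial_+,$$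 $1\le i\le9$, and $K_{(ij)}=x^j\partial_i-x^i\partial_j$, $(i,j)\in P:=\{1,2\}^2\cup\{3,4\}^2\cup\{5\}^2\cup\{6,7,8,9\}^2$. $\mathcal K_1$ is the space of the spinor fields $$\vec\xi=\vec\xi(\xi_1,\xi_2)=e^{-x^-\bar c}\xi_1+\Big(1+\tfrac12\sum_i x^i\,\gamma_+\otimes s_{\bar c,d}(e_i)\Big)e^{-x^-d}\xi_2$$ with constant $\xi_1\in S^-$, $\xi_2\in S^+$, $X^-\xi_2=0$. The even-even bracket is the commutator of vector fields. The even-odd bracket is the spinorial Lie derivative $\mathcal L_K\psi=\nabla_K\psi-\frac14\sum_{a,b}g_B(\nabla_{E_a}K,E_b)\Gamma^{ab}\psi$ ($E_a$ the frame above). The odd-odd bracket of $\vec\xi=\vec\xi(\xi_1,\xi_2)$ and $\vec\eta=\vec\xi(\eta_1,\eta_2)$ is $$\begin{aligned}\{\vec\xi,\vec\eta\}=\;&C(\xi_1,\Gamma_-\eta_1)K_{(+)}+C(\xi_2,\Gamma_+\eta_2)K_{(-)}+\sum_i\big(C(\xi_1,\Gamma_i\eta_2)+C(\eta_1,\Gamma_i\xi_2)\big)K_{(i)}\\&+\sum_i\big(C(\xi_1,s_{\bar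 c,d}(B^{-1}e_i)\eta_2)-C(s_{\bar c,d}(B^{-1}e_i)\xi_2,\eta_1)\big)K_{(i^*)}\\&-\tfrac14\sum_{(i,j)\in P}C\big(\xi_2,\Gamma_+(s_{d,\bar c}(e_j)\gamma_i+\gamma_is_{\bar c,d}(e_j))\eta_2\big)K_{(ij)} .\end{aligned}$$ **Theorem.** 1. $\mathcal K_0\oplus\mathcal K_1$ is a geometric superalgebra: a graded skew-symmetric superalgebra in which $\mathcal K_0$ is a Lie algebra of (complexified) Killing vector fields, $\mathcal K_1$ consists of $D$-parallel spinors, $\mathcal L$ is a representation of $\mathcal K_0$ on $\mathcal K_1$, and $[K,\{\vec\xi,\vec\eta\}]=\{\mathcal L_K\vec\xi,\vec\eta\}+\{\vec\xi,\mathcal L_K\vec\eta\}$. Moreover $\dim_{\mathbb C}\mathcal K_1=24=\frac34\cdot32$, and if $D$ is not flat, then the superalgebra is non-restricted, i.e. $\mathcal K_1$ is the space of all smooth $D$-parallel spinors. 2. This geometric superalgebra is a geometric supersymmetry, i.e. $\mathcal K_0\oplus\mathcal K_1$ is a Lie superalgebra (the graded Jacobi identity holds), if and only if $\alpha_+=-3\alpha_+'$.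 3. Equivalently, it is a geometric supersymmetry if and only if $$B=-\mathrm{diag}\big((\alpha_--\alpha_+')^2\mathbf 1_2,\ (\alpha_-+\alpha_+')^2\mathbf 1_2,\ 16\alpha_+'^2,\ 4\alpha_+'^2\mathbf 1_4\big),$$ $$\bar c=(-3\alpha_+'X^++\alpha_-X^-)\gamma_{125},\qquad d=(\alpha_+'X^++\alpha_-'X^-)\gamma_{125}.$$ -/

import Mathlib

open scoped Kronecker ContDiff BigOperators

namespace CahenWallach

noncomputable section

/-! ## Coordinates, metric and Levi-Civita connection -/

/-- Index set of the eleven coordinates: `inl 0` is `+`, `inl 1` is `-`, and `inr i` is the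
coordinate `x^(i+1)` of the euclidean space `V = ℝ⁹`. -/
abbrev Idx := Fin 2 ⊕ Fin 9

/-- Points of the Cahen-Wallach space in its global coordinates `(x⁺, x⁻, x¹, …, x⁹)`. -/
abbrev Pt := Idx → ℝ

/-- Vector fields with complex coefficients, in the coordinate basis. -/
abbrev VField := Pt → Idx → ℂ

/-- The partial derivative `∂_μ f`. -/
def pderiv {E : Type*} [NormedAddCommGroup E] [NormedSpace ℝ E] (μ : Idx) (f : Pt → E)
    (x : Pt) : E :=
  fderiv ℝ f x (Pi.single μ 1)

/-- The quadratic function `∑ B_ij x^i x^j`. -/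
def quad (B : Matrix (Fin 9) (Fin 9) ℝ) (x : Pt) : ℝ :=
  ∑ i, ∑ j, B i j * x (Sum.inr i) * x (Sum.inr j)

/-- `g_B = 2 dx⁺ dx⁻ - ∑ B_ij x^i x^j (dx⁻)² + ∑ (dx^i)²`. -/
def metric (B : Matrix (Fin 9) (Fin 9) ℝ) (x : Pt) : Matrix Idx Idx ℝ :=
  Matrix.fromBlocks !![0, 1; 1, -quad B x] 0 0 1

/-- The Lorentzian scalar product on `W = ℝ^{1,1} ⊕ V` in the basis `e₊, e₋, e_i`. -/
def eta : Matrix Idx Idx ℝ := Matrix.fromBlocks !![0, 1; 1, 0] 0 0 1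

/-- Christoffel symbols `Γ^k_{ij}` of a metric. -/
def christoffel (G : Pt → Matrix Idx Idx ℝ) (k i j : Idx) (x : Pt) : ℝ :=
  (1 / 2) * ∑ l, (G x)⁻¹ k l *
    (pderiv i (fun y => G y j l) x + pderiv j (fun y => G y i l) x
      - pderiv l (fun y => G y i j) x)

/-- The Levi-Civita derivative `∇_μ Y` of a vector field. -/
def covDeriv (G : Pt → Matrix Idx Idx ℝ) (μ : Idx) (Y : VField) : VField :=
  fun x k => pderiv μ Y x k + ∑ j, (christoffel G k μ j x : ℂ) * Y x j

/-- The scalar product of two complex tangent vectors at `x` (complex bilinear). -/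
def inner (G : Pt → Matrix Idx Idx ℝ) (x : Pt) (v w : Idx → ℂ) : ℂ :=
  ∑ κ, ∑ ν, (G x κ ν : ℂ) * v κ * w ν

/-- The frame `E₊ = ∂₊`, `E₋ = ∂₋ + ½ (∑ B_ij x^i x^j) ∂₊`, `E_i = ∂_i`; the frame vectors are the
columns. -/
def frameMatrix (B : Matrix (Fin 9) (Fin 9) ℝ) (x : Pt) : Matrix Idx Idx ℝ :=
  Matrix.fromBlocks !![1, quad B x / 2; 0, 1] 0 0 1

/-- The dual coframe `θ⁺ = dx⁺ - ½ (∑ B_ij x^i x^j) dx⁻`, `θ⁻ = dx⁻`, `θ^i = dx^i`; the entry at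
`(a, μ)` is `θ^a(∂_μ)`. -/
def coframeMatrix (B : Matrix (Fin 9) (Fin 9) ℝ) (x : Pt) : Matrix Idx Idx ℝ :=
  Matrix.fromBlocks !![1, -quad B x / 2; 0, 1] 0 0 1

/-- The frame vector field `E_a`. -/
def frame (B : Matrix (Fin 9) (Fin 9) ℝ) (a : Idx) : VField :=
  fun x κ => (frameMatrix B x κ a : ℂ)

/-- The Levi-Civita connection form `(ω_μ)_{ab} = g(E_a, ∇_μ E_b)`. -/
def connForm (B : Matrix (Fin 9) (Fin 9) ℝ) (μ a b : Idx) (x : Pt) : ℂ :=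
  inner (metric B) x (frame B a x) (covDeriv (metric B) μ (frame B b) x)

/-- The commutator of vector fields. -/
def lieBr (X Y : VField) : VField :=
  fun x => ∑ μ, (X x μ • pderiv μ Y x - Y x μ • pderiv μ X x)

/-- (Complexified) Killing vector fields: smooth with `L_X g_B = 0`. -/
def IsKilling (B : Matrix (Fin 9) (Fin 9) ℝ) (X : VField) : Prop :=
  ContDiff ℝ ∞ X ∧ ∀ x i j,
    ∑ k, (X x k * (pderiv k (fun y => metric B y i j) x : ℂ)
      + (metric B x k j : ℂ) * pderiv i X x k + (metric B x i k : ℂ) * pderiv j X x k) = 0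

/-- The action of `v* ∈ V*` on `W`, i.e. `Bv ∧ e₊`, where `x ∧ y (z) = ⟨y,z⟩ x - ⟨x,z⟩ y`. -/
def vstarAct (B : Matrix (Fin 9) (Fin 9) ℝ) (v : Fin 9 → ℝ) (w : Idx → ℝ) : Idx → ℝ :=
  let Bv : Idx → ℝ := Sum.elim 0 (B.mulVec v)
  let ep : Idx → ℝ := Pi.single (Sum.inl 0) 1
  (ep ⬝ᵥ eta.mulVec w) • Bv - (Bv ⬝ᵥ eta.mulVec w) • ep

/-- `M_B` is indecomposable: there is no proper non-zero `V*`-invariant subspace of `W` on which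
the scalar product is non-degenerate. -/
def IsIndecomposable (B : Matrix (Fin 9) (Fin 9) ℝ) : Prop :=
  ¬ ∃ U : Submodule ℝ (Idx → ℝ), U ≠ ⊥ ∧ U ≠ ⊤ ∧
    (∀ v, ∀ w ∈ U, vstarAct B v w ∈ U) ∧
    (∀ u ∈ U, (∀ w ∈ U, u ⬝ᵥ eta.mulVec w = 0) → u = 0)

/-! ## Clifford matrices and spinors -/

/-- Index set of a basis of `S(V) = ℂ² ⊗ ℂ⁸`. -/
abbrev SV := Fin 2 × Fin 8

/-- Index set of a basis of `S(W) = S₂ ⊗ S(V)`. The first factor index is `0` on the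
`-1`-eigenspace `S⁻` of `σ`, and `1` on the `+1`-eigenspace `S⁺`. -/
abbrev SW := Fin 2 × SV

/-- Spinor fields, written in the trivialisation of the spinor bundle given by the frame `E_a`. -/
abbrev SField := Pt → SW → ℂ

/-- Left multiplication by the imaginary octonion units. -/
def oct : Fin 7 → Matrix (Fin 8) (Fin 8) ℂ := ![
  !![0, -1, 0, 0, 0, 0, 0, 0;
     1, 0, 0, 0, 0, 0, 0, 0;
     0, 0, 0, -1, 0, 0, 0, 0;
     0, 0, 1, 0, 0, 0, 0, 0;
     0, 0, 0, 0, 0, -1, 0, 0;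
     0, 0, 0, 0, 1, 0, 0, 0;
     0, 0, 0, 0, 0, 0, 0, 1;
     0, 0, 0, 0, 0, 0, -1, 0],
  !![0, 0, -1, 0, 0, 0, 0, 0;
     0, 0, 0, 1, 0, 0, 0, 0;
     1, 0, 0, 0, 0, 0, 0, 0;
     0, -1, 0, 0, 0, 0, 0, 0;
     0, 0, 0, 0, 0, 0, -1, 0;
     0, 0, 0, 0, 0, 0, 0, -1;
     0, 0, 0, 0, 1, 0, 0, 0;
     0, 0, 0, 0, 0, 1, 0, 0],
  !![0, 0, 0, -1, 0, 0, 0, 0;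
     0, 0, -1, 0, 0, 0, 0, 0;
     0, 1, 0, 0, 0, 0, 0, 0;
     1, 0, 0, 0, 0, 0, 0, 0;
     0, 0, 0, 0, 0, 0, 0, -1;
     0, 0, 0, 0, 0, 0, 1, 0;
     0, 0, 0, 0, 0, -1, 0, 0;
     0, 0, 0, 0, 1, 0, 0, 0],
  !![0, 0, 0, 0, -1, 0, 0, 0;
     0, 0, 0, 0, 0, 1, 0, 0;
     0, 0, 0, 0, 0, 0, 1, 0;
     0, 0, 0, 0, 0, 0, 0, 1;
     1, 0, 0, 0, 0, 0, 0, 0;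
     0, -1, 0, 0, 0, 0, 0, 0;
     0, 0, -1, 0, 0, 0, 0, 0;
     0, 0, 0, -1, 0, 0, 0, 0],
  !![0, 0, 0, 0, 0, -1, 0, 0;
     0, 0, 0, 0, -1, 0, 0, 0;
     0, 0, 0, 0, 0, 0, 0, 1;
     0, 0, 0, 0, 0, 0, -1, 0;
     0, 1, 0, 0, 0, 0, 0, 0;
     1, 0, 0, 0, 0, 0, 0, 0;
     0, 0, 0, 1, 0, 0, 0, 0;
     0, 0, -1, 0, 0, 0, 0, 0],
  !![0, 0, 0, 0, 0, 0, -1, 0;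
     0, 0, 0, 0, 0, 0, 0, -1;
     0, 0, 0, 0, -1, 0, 0, 0;
     0, 0, 0, 0, 0, 1, 0, 0;
     0, 0, 1, 0, 0, 0, 0, 0;
     0, 0, 0, -1, 0, 0, 0, 0;
     1, 0, 0, 0, 0, 0, 0, 0;
     0, 1, 0, 0, 0, 0, 0, 0],
  !![0, 0, 0, 0, 0, 0, 0, -1;
     0, 0, 0, 0, 0, 0, 1, 0;
     0, 0, 0, 0, 0, -1, 0, 0;
     0, 0, 0, 0, -1, 0, 0, 0;
     0, 0, 0, 1, 0, 0, 0, 0;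
     0, 0, 1, 0, 0, 0, 0, 0;
     0, -1, 0, 0, 0, 0, 0, 0;
     1, 0, 0, 0, 0, 0, 0, 0]]

/-- Pauli matrices. -/
def sigma1 : Matrix (Fin 2) (Fin 2) ℂ := !![0, 1; 1, 0]
/-- Pauli matrices. -/
def sigma2 : Matrix (Fin 2) (Fin 2) ℂ := !![0, -Complex.I; Complex.I, 0]
/-- Pauli matrices. -/
def sigma3 : Matrix (Fin 2) (Fin 2) ℂ := !![1, 0; 0, -1]

/-- The Clifford matrices `γ₁, …, γ₉` of `V = ℝ⁹` (convention `v w + w v = -2⟨v,w⟩`);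
`gam i` is `γ_{i+1}`. -/
def gam (i : Fin 9) : Matrix SV SV ℂ :=
  if h : (i : ℕ) < 7 then sigma1 ⊗ₖ oct ⟨i, h⟩
  else if (i : ℕ) = 7 then (-Complex.I • sigma2) ⊗ₖ 1
  else (-Complex.I • sigma3) ⊗ₖ 1

/-- `γ₊` on `S₂`. -/
def gPlus : Matrix (Fin 2) (Fin 2) ℂ := ((Real.sqrt 2 : ℝ) : ℂ) • !![0, 1; 0, 0]
/-- `γ₋` on `S₂`. -/
def gMinus : Matrix (Fin 2) (Fin 2) ℂ := ((Real.sqrt 2 : ℝ) : ℂ) • !![0, 0; -1, 0]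
/-- The volume element `σ = ½[γ₊, γ₋]`, with eigenvalue `-1` on `S₂⁻` and `+1` on `S₂⁺`. -/
def sigmaVol : Matrix (Fin 2) (Fin 2) ℂ := !![-1, 0; 0, 1]
/-- The projection `σ₋` onto `S₂⁻`. -/
def projMinus : Matrix (Fin 2) (Fin 2) ℂ := !![1, 0; 0, 0]
/-- The projection `σ₊` onto `S₂⁺`. -/
def projPlus : Matrix (Fin 2) (Fin 2) ℂ := !![0, 0; 0, 1]

/-- The Clifford matrices `Γ_a` of `W`. -/
def Gam : Idx → Matrix SW SW ℂ :=
  Sum.elim ![gPlus ⊗ₖ 1, gMinus ⊗ₖ 1] (fun i => sigmaVol ⊗ₖ gam i)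

/-- The Clifford matrices `Γ^a` with raised index. -/
def GamUp (a : Idx) : Matrix SW SW ℂ := ∑ b, (eta a b : ℂ) • Gam b

/-- `Γ^{ab} = ½[Γ^a, Γ^b]`. -/
def GamUp2 (a b : Idx) : Matrix SW SW ℂ :=
  (1 / 2 : ℂ) • (GamUp a * GamUp b - GamUp b * GamUp a)

/-- The charge conjugation `C_V = σ₃ ⊗ 1` of `V`. -/
def CV : Matrix SV SV ℂ := sigma3 ⊗ₖ 1

/-- The charge conjugation `C_W = σ₂ ⊗ C_V` of `W` as a bilinear form. -/
def CW (ξ η : SW → ℂ) : ℂ := ξ ⬝ᵥ (sigma2 ⊗ₖ CV).mulVec η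

/-- The Levi-Civita connection on spinors, `∇_μ ψ = ∂_μ ψ - ¼ ∑ (ω_μ)_{ab} Γ^{ab} ψ`. -/
def spinNabla (B : Matrix (Fin 9) (Fin 9) ℝ) (μ : Idx) (ψ : SField) : SField :=
  fun x => pderiv μ ψ x
    - (1 / 4 : ℂ) • ∑ a, ∑ b, connForm B μ a b x • (GamUp2 a b).mulVec (ψ x)

/-- The spinorial Lie derivative
`L_K ψ = ∇_K ψ - Γ(∇K) ψ = ∇_K ψ - ¼ ∑ g(∇_{E_a} K, E_b) Γ^{ab} ψ`. -/
def spinLie (B : Matrix (Fin 9) (Fin 9) ℝ) (K : VField) (ψ : SField) : SField :=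
  fun x => ∑ μ, K x μ • spinNabla B μ ψ x
    - (1 / 4 : ℂ) • ∑ a, ∑ b,
        inner (metric B) x (∑ μ, frame B a x μ • covDeriv (metric B) μ K x) (frame B b x)
          • (GamUp2 a b).mulVec (ψ x)

/-! ## The four-parameter family -/

/-- The four real parameters `α₊, α₋, α₊', α₋'`. -/
structure Params where
  /-- `α₊` -/
  ap : ℝ
  /-- `α₋` -/
  am : ℝ
  /-- `α₊'` -/
  ap' : ℝ
  /-- `α₋'` -/
  am' : ℝ

/-- `X⁺ = ½(1 + γ₁γ₂γ₃γ₄)`. -/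
def Xplus : Matrix SV SV ℂ := (1 / 2 : ℂ) • (1 + gam 0 * gam 1 * gam 2 * gam 3)
/-- `X⁻ = ½(1 - γ₁γ₂γ₃γ₄)`. -/
def Xminus : Matrix SV SV ℂ := (1 / 2 : ℂ) • (1 - gam 0 * gam 1 * gam 2 * gam 3)
/-- `γ₁₂₅ = γ₁γ₂γ₅`. -/
def gam125 : Matrix SV SV ℂ := gam 0 * gam 1 * gam 4

namespace Params

variable (P : Params)

/-- `c̄ = (α₊ X⁺ + α₋ X⁻) γ₁₂₅`. -/
def cbar : Matrix SV SV ℂ := ((P.ap : ℂ) • Xplus + (P.am : ℂ) • Xminus) * gam125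

/-- `d = (α₊' X⁺ + α₋' X⁻) γ₁₂₅`. -/
def d : Matrix SV SV ℂ := ((P.ap' : ℂ) • Xplus + (P.am' : ℂ) • Xminus) * gam125

/-- The real numbers `κ_i`, with `λ_i = -i κ_i`. -/
def kap : Fin 9 → ℝ :=
  ![P.am - P.ap', P.am - P.ap', P.am + P.ap', P.am + P.ap', P.ap - P.ap',
    P.ap + P.ap', P.ap + P.ap', P.ap + P.ap', P.ap + P.ap']

/-- The numbers `λ_i`, with `B = diag(λ₁², …, λ₉²)`. -/
def lam (i : Fin 9) : ℂ := -Complex.I * (P.kap i : ℂ)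

/-- `B = -diag((α₋-α₊')² 1₂, (α₋+α₊')² 1₂, (α₊-α₊')² 1₁, (α₊+α₊')² 1₄)`. -/
def B : Matrix (Fin 9) (Fin 9) ℝ := -Matrix.diagonal (fun i => P.kap i ^ 2)

/-- `s_{c̄,d}(e_i) = c̄ γ_i - γ_i d`. -/
def s (i : Fin 9) : Matrix SV SV ℂ := P.cbar * gam i - gam i * P.d

/-- `s_{d,c̄}(e_i) = d γ_i - γ_i c̄`. -/
def sd (i : Fin 9) : Matrix SV SV ℂ := P.d * gam i - gam i * P.cbar

/-- `s_{c̄,d}(B⁻¹ e_i)`. -/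
def sBinv (i : Fin 9) : Matrix SV SV ℂ := ∑ k, ((P.B⁻¹ k i : ℝ) : ℂ) • P.s k

/-- The equivariant map `ρ` on `W`: `ρ(e₊) = 0`, `ρ(e₋) = σ₋ ⊗ c̄ + σ₊ ⊗ d`,
`ρ(e_i) = -½ γ₊ ⊗ s_{c̄,d}(e_i)`. In matrix blocks `ρ(e₋) = (c̄, 0; 0, d)`. -/
def rho : Idx → Matrix SW SW ℂ :=
  Sum.elim ![0, projMinus ⊗ₖ P.cbar + projPlus ⊗ₖ P.d]
    (fun i => (-(1 / 2) : ℂ) • (gPlus ⊗ₖ P.s i))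

/-- The connection `D_μ = ∇_μ + ρ(θ(∂_μ))` on the spinor bundle. -/
def D (μ : Idx) (ψ : SField) : SField :=
  fun x => spinNabla P.B μ ψ x
    + ∑ a, (coframeMatrix P.B x a μ : ℂ) • (P.rho a).mulVec (ψ x)

/-- Smooth spinor fields that are parallel with respect to `D`. -/
def IsParallel (ψ : SField) : Prop :=
  ContDiff ℝ ∞ ψ ∧ ∀ μ x, P.D μ ψ x = 0

/-- The curvature of `D` vanishes. -/
def IsFlat : Prop :=
  ∀ ψ : SField, ContDiff ℝ ∞ ψ → ∀ μ ν, P.D μ (P.D ν ψ) = P.D ν (P.D μ ψ)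

/-! ### The even part -/

/-- The coordinate vector `∂_μ`. -/
def del (μ : Idx) : Idx → ℂ := Pi.single μ 1

/-- `K₍₊₎ = ∂₊`. The signs of `K₍₊₎`, `K₍₋₎`, `K₍ᵢ*₎` are normalised such that the spinorial Lie
derivative satisfies `L_{K₍μ₎} ξ(ξ₁⁰,ξ₂⁰) = -ξ(ρ(e_μ)(ξ₁⁰,ξ₂⁰))`. -/
def KPlus : VField := fun _ => del (Sum.inl 0)

/-- `K₍₋₎ = ∂₋`. -/
def KMinus : VField := fun _ => del (Sum.inl 1)

/-- `K₍ᵢ₎ = cos(λ_i x⁻) ∂_i + λ_i sin(λ_i x⁻) x^i ∂₊`. -/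
def KDir (i : Fin 9) : VField := fun x =>
  Complex.cos (P.lam i * x (Sum.inl 1)) • del (Sum.inr i)
    + (P.lam i * Complex.sin (P.lam i * x (Sum.inl 1)) * x (Sum.inr i)) • del (Sum.inl 0)

/-- `K₍ᵢ*₎ = λ_i sin(λ_i x⁻) ∂_i - λ_i² cos(λ_i x⁻) x^i ∂₊`. -/
def KStar (i : Fin 9) : VField := fun x =>
  (P.lam i * Complex.sin (P.lam i * x (Sum.inl 1))) • del (Sum.inr i)
    - (P.lam i ^ 2 * Complex.cos (P.lam i * x (Sum.inl 1)) * x (Sum.inr i)) • del (Sum.inl 0)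

/-- `K₍ᵢⱼ₎ = x^j ∂_i - x^i ∂_j`. -/
def KRot (i j : Fin 9) : VField := fun x =>
  (x (Sum.inr j) : ℂ) • del (Sum.inr i) - (x (Sum.inr i) : ℂ) • del (Sum.inr j)

/-- The blocks `{1,2}, {3,4}, {5}, {6,7,8,9}` of `{1,…,9}`; the pair `(i,j)` is admissible for
`K₍ᵢⱼ₎` if both lie in the same block. -/
def block : Fin 9 → Fin 4 := ![0, 0, 1, 1, 2, 3, 3, 3, 3]

/-- The (complexified) even part `𝒦₀`. -/
def K0 : Submodule ℂ VField :=
  Submodule.span ℂ ({KPlus, KMinus} ∪ Set.range P.KDir ∪ Set.range P.KStar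
    ∪ {X | ∃ i j, block i = block j ∧ X = KRot i j})

/-! ### The odd part -/

/-- The embedding `S(V) ≅ S⁻(W) ⊂ S(W)`. -/
def inMinus (ξ : SV → ℂ) : SW → ℂ := fun p => if p.1 = 0 then ξ p.2 else 0

/-- The embedding `S(V) ≅ S⁺(W) ⊂ S(W)`. -/
def inPlus (ξ : SV → ℂ) : SW → ℂ := fun p => if p.1 = 1 then ξ p.2 else 0

/-- The spinor field
`ξ(ξ₁⁰,ξ₂⁰) = exp(-x⁻ c̄) ξ₁⁰ + (1 + ½ ∑ x^i Γ₊ s_{c̄,d}(e_i)) exp(-x⁻ d) ξ₂⁰`. -/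
def spinor (ξ₁ ξ₂ : SV → ℂ) : SField := fun x =>
  inMinus ((NormedSpace.exp ((-(x (Sum.inl 1)) : ℂ) • P.cbar)).mulVec ξ₁)
    + (1 + (1 / 2 : ℂ) • ∑ i, (x (Sum.inr i) : ℂ) • (gPlus ⊗ₖ P.s i)).mulVec
        (inPlus ((NormedSpace.exp ((-(x (Sum.inl 1)) : ℂ) • P.d)).mulVec ξ₂))

theorem inMinus_add (a b : SV → ℂ) : inMinus (a + b) = inMinus a + inMinus b := by
  funext p; by_cases h : p.1 = 0 <;> simp [inMinus, h]

theorem inPlus_add (a b : SV → ℂ) : inPlus (a + b) = inPlus a + inPlus b := by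
  funext p; by_cases h : p.1 = 1 <;> simp [inPlus, h]

theorem inMinus_smul (c : ℂ) (a : SV → ℂ) : inMinus (c • a) = c • inMinus a := by
  funext p; by_cases h : p.1 = 0 <;> simp [inMinus, h]

theorem inPlus_smul (c : ℂ) (a : SV → ℂ) : inPlus (c • a) = c • inPlus a := by
  funext p; by_cases h : p.1 = 1 <;> simp [inPlus, h]

theorem spinor_add (a b a' b' : SV → ℂ) :
    P.spinor (a + a') (b + b') = P.spinor a b + P.spinor a' b' := by
  funext x
  simp only [spinor, Pi.add_apply, Matrix.mulVec_add, inMinus_add, inPlus_add]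
  abel

theorem spinor_smul (c : ℂ) (a b : SV → ℂ) :
    P.spinor (c • a) (c • b) = c • P.spinor a b := by
  funext x
  simp only [spinor, Pi.smul_apply, Matrix.mulVec_smul, inMinus_smul, inPlus_smul, smul_add]

/-- The odd part `𝒦₁`: the spinor fields `ξ(ξ₁⁰,ξ₂⁰)` with `X⁻ ξ₂⁰ = 0`. -/
def K1 : Submodule ℂ SField where
  carrier := {ψ | ∃ ξ₁ ξ₂, Xminus.mulVec ξ₂ = 0 ∧ ψ = P.spinor ξ₁ ξ₂}
  add_mem' := by
    rintro _ _ ⟨a, b, hb, rfl⟩ ⟨a', b', hb', rfl⟩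
    exact ⟨a + a', b + b', by rw [Matrix.mulVec_add, hb, hb', add_zero], (P.spinor_add ..).symm⟩
  zero_mem' := ⟨0, 0, Matrix.mulVec_zero _, by
    simpa using (P.spinor_smul 0 0 0).symm⟩
  smul_mem' := by
    rintro c _ ⟨a, b, hb, rfl⟩
    exact ⟨c • a, c • b, by rw [Matrix.mulVec_smul, hb, smul_zero], (P.spinor_smul ..).symm⟩

/-! ### The odd-odd bracket

The constant spinors `ξ₁⁰, ξ₂⁰` of a field `ψ = ξ(ξ₁⁰,ξ₂⁰)` are recovered as the components of
`ψ` at the origin. -/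

/-- The component `ξ₁⁰` of a spinor field, as an element of `S⁻(W)`. -/
def c1 (ψ : SField) : SW → ℂ := (projMinus ⊗ₖ (1 : Matrix SV SV ℂ)).mulVec (ψ 0)

/-- The component `ξ₂⁰` of a spinor field, as an element of `S⁺(W)`. -/
def c2 (ψ : SField) : SW → ℂ := (projPlus ⊗ₖ (1 : Matrix SV SV ℂ)).mulVec (ψ 0)

/-- The `K₍₊₎`-coefficient `C(ξ₁⁰, Γ₋ η₁⁰)`. -/
def brPlus (ψ φ : SField) : ℂ := CW (c1 ψ) ((Gam (Sum.inl 1)).mulVec (c1 φ))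

/-- The `K₍₋₎`-coefficient `C(ξ₂⁰, Γ₊ η₂⁰)`. -/
def brMinus (ψ φ : SField) : ℂ := CW (c2 ψ) ((Gam (Sum.inl 0)).mulVec (c2 φ))

/-- The `K₍ᵢ₎`-coefficient `C(ξ₁⁰, Γ_i η₂⁰) + C(η₁⁰, Γ_i ξ₂⁰)`. -/
def brDir (i : Fin 9) (ψ φ : SField) : ℂ :=
  CW (c1 ψ) ((Gam (Sum.inr i)).mulVec (c2 φ)) + CW (c1 φ) ((Gam (Sum.inr i)).mulVec (c2 ψ))

/-- The `K₍ᵢ*₎`-coefficient `C(ξ₁⁰, s_{c̄,d}(B⁻¹e_i) η₂⁰) - C(s_{c̄,d}(B⁻¹e_i) ξ₂⁰, η₁⁰)`. The even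
Clifford element `s_{c̄,d}(B⁻¹e_i)` acts on `S(W) = S₂ ⊗ S(V)` through the second factor. -/
def brStar (i : Fin 9) (ψ φ : SField) : ℂ :=
  CW (c1 ψ) (((1 : Matrix (Fin 2) (Fin 2) ℂ) ⊗ₖ P.sBinv i).mulVec (c2 φ))
    - CW (((1 : Matrix (Fin 2) (Fin 2) ℂ) ⊗ₖ P.sBinv i).mulVec (c2 ψ)) (c1 φ)

/-- The `K₍ᵢⱼ₎`-coefficient
`-½ C(ξ₂⁰, Γ₊ (s_{d,c̄}(e_j) Γ_i + Γ_i s_{c̄,d}(e_j)) η₂⁰)`. The element in brackets is applied to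
`η₂⁰ ∈ S⁺(W)`, on which the Clifford algebra of `V` acts through the second factor. -/
def brRot (i j : Fin 9) (ψ φ : SField) : ℂ :=
  -(1 / 2) * CW (c2 ψ) ((Gam (Sum.inl 0)).mulVec
    (((1 : Matrix (Fin 2) (Fin 2) ℂ) ⊗ₖ (P.sd j * gam i + gam i * P.s j)).mulVec (c2 φ)))

/-- The odd-odd bracket `{ψ, φ}`. -/
def oddBr (ψ φ : SField) : VField :=
  brPlus ψ φ • KPlus + brMinus ψ φ • KMinus
    + ∑ i, brDir i ψ φ • P.KDir i + ∑ i, P.brStar i ψ φ • P.KStar i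
    + (1 / 2 : ℂ) • ∑ i, ∑ j, if block i = block j then P.brRot i j ψ φ • KRot i j else 0

/-! ### The superalgebra -/

/-- The graded bracket on pairs (vector field, spinor field): the commutator of vector fields, the
spinorial Lie derivative and the odd-odd bracket. -/
def bracket (x y : VField × SField) : VField × SField :=
  (lieBr x.1 y.1 + P.oddBr x.2 y.2, spinLie P.B x.1 y.2 - spinLie P.B y.1 x.2)

/-- The homogeneous parts `𝒦₀` and `𝒦₁` of `𝒦₀ ⊕ 𝒦₁`. -/
def part : ZMod 2 → Submodule ℂ (VField × SField) :=
  fun i => if i = 0 then P.K0.prod ⊥ else (⊥ : Submodule ℂ VField).prod P.K1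

end Params

/-- The subspaces `A 0` and `A 1` with the bracket `br` form a graded skew-symmetric
superalgebra. -/
structure IsSuperalgebra {E : Type*} [AddCommGroup E] [Module ℂ E] (br : E → E → E)
    (A : ZMod 2 → Submodule ℂ E) : Prop where
  direct : Disjoint (A 0) (A 1)
  closed : ∀ i j, ∀ x ∈ A i, ∀ y ∈ A j, br x y ∈ A (i + j)
  add_left : ∀ x ∈ A 0 ⊔ A 1, ∀ y ∈ A 0 ⊔ A 1, ∀ z ∈ A 0 ⊔ A 1,
    br (x + y) z = br x z + br y z
  add_right : ∀ x ∈ A 0 ⊔ A 1, ∀ y ∈ A 0 ⊔ A 1, ∀ z ∈ A 0 ⊔ A 1,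
    br x (y + z) = br x y + br x z
  smul_left : ∀ c : ℂ, ∀ x ∈ A 0 ⊔ A 1, ∀ y ∈ A 0 ⊔ A 1, br (c • x) y = c • br x y
  smul_right : ∀ c : ℂ, ∀ x ∈ A 0 ⊔ A 1, ∀ y ∈ A 0 ⊔ A 1, br x (c • y) = c • br x y
  skew : ∀ i j, ∀ x ∈ A i, ∀ y ∈ A j, br x y = -((-1 : ℂ) ^ (i.val * j.val) • br y x)

/-- A Lie superalgebra: a graded skew-symmetric superalgebra with the graded Jacobi identity. -/
structure IsLieSuperalgebra {E : Type*} [AddCommGroup E] [Module ℂ E] (br : E → E → E)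
    (A : ZMod 2 → Submodule ℂ E) : Prop extends IsSuperalgebra br A where
  jacobi : ∀ i j k, ∀ x ∈ A i, ∀ y ∈ A j, ∀ z ∈ A k,
    (-1 : ℂ) ^ (i.val * k.val) • br x (br y z) + (-1 : ℂ) ^ (j.val * k.val) • br z (br x y)
      + (-1 : ℂ) ^ (i.val * j.val) • br y (br z x) = 0

namespace Params

variable (P : Params)

/-- `𝒦₀ ⊕ 𝒦₁` is a geometric superalgebra: a graded skew-symmetric superalgebra that extends a Lie
algebra `𝒦₀` of Killing vector fields by a space `𝒦₁` of parallel spinors, on which `𝒦₀` acts by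
the spinorial Lie derivative, with a `𝒦₀`-equivariant odd-odd bracket. -/
structure IsGeometricSuperalgebra : Prop where
  superalgebra : IsSuperalgebra P.bracket P.part
  killing : ∀ X ∈ P.K0, IsKilling P.B X
  parallel : ∀ ψ ∈ P.K1, P.IsParallel ψ
  even_jacobi : ∀ X ∈ P.K0, ∀ Y ∈ P.K0, ∀ Z ∈ P.K0,
    lieBr X (lieBr Y Z) + lieBr Z (lieBr X Y) + lieBr Y (lieBr Z X) = 0
  action : ∀ X ∈ P.K0, ∀ Y ∈ P.K0, ∀ ψ ∈ P.K1,
    spinLie P.B (lieBr X Y) ψ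
      = spinLie P.B X (spinLie P.B Y ψ) - spinLie P.B Y (spinLie P.B X ψ)
  equivariant : ∀ X ∈ P.K0, ∀ ψ ∈ P.K1, ∀ φ ∈ P.K1,
    lieBr X (P.oddBr ψ φ) = P.oddBr (spinLie P.B X ψ) φ + P.oddBr ψ (spinLie P.B X φ)

/-- Geometric supersymmetry: the geometric superalgebra is a Lie superalgebra. -/
def IsGeometricSupersymmetry : Prop :=
  P.IsGeometricSuperalgebra ∧ IsLieSuperalgebra P.bracket P.part

/-- The odd part is maximal: it consists of all spinor fields that are parallel for `D`. -/
def IsNonRestricted : Prop := ∀ ψ, ψ ∈ P.K1 ↔ P.IsParallel ψ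

end Params

end

end CahenWallach

/-!
The whole superalgebra is transported to linear algebra over the spinor module `S(V) = ℂ¹⁶`, where
only Clifford identities remain to be checked.

*The algebraic model.* An element of `𝒦₀` is `Params.field c` for coefficients `c : Coef`: its
components along the `∂_i` are solutions of `f'' = -λ_i² f` plus a rotation that preserves the
blocks on which `κ_i²` is given by one formula. Because Wronskians are constant, the commutator is
an algebraic bracket `Params.br` of coefficients (`Params.lieBr_field`). An element of `𝒦₁` is
determined by a pair `(ξ₁, ξ₂)` with `γ₁γ₂γ₃γ₄ ξ₂ = ξ₂`, which is the condition `X⁻ ξ₂ = 0`. On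
this eigenspace `c̄`, `d` and `s_i` simplify: `s_i ξ = k_i γ_i γ₁₂₅ ξ` for a number `k_i` with
`k_i² = κ_i²` (`Params.s_of_chi`, `Params.sEig_one_sq`), hence `c̄ s_i ξ - s_i d ξ = κ_i² γ_i ξ`
(`Params.cbar_s_sub_s_d`). This is the equation that makes the spinor fields in `𝒦₁` parallel
(`Params.isParallel_spinor`), and it allows the oscillating coefficients of a Killing field to be
absorbed into the exponentials (`Params.osc_expVec`). The spinorial Lie derivative thus becomes an
algebraic action `Params.act` (`Params.spinLie_spinor`), and the odd-odd bracket an algebraic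
bilinear map `Params.obr` (`Params.oddBr_eq`). Indecomposability enters through `k_i ≠ 0`
(`Params.k_ne_zero`), as `obr` involves `B⁻¹`.

*The identities.* The Jacobi identity of `br` is `Params.br_jacobi`, the representation property
is `Params.act_br`, and the equivariance of the odd-odd bracket is `Params.obr_act`. None of them
needs a relation between `α₊` and `α₊'`: they rest on the Clifford relation and on the fact that
rotations that preserve the blocks commute with `B`, `c̄` and `d`. The Jacobi identity for three
odd elements follows by polarisation (`Params.cyclic_sum_eq_zero`) from the identity `[{ξ, ξ}, ξ]
= 0`, whose two components are the cubic Fierz identities `Params.fierz_plus` and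
`Params.fierz_minus`. They hold if `α₊ = -3 α₊'`, and evaluating the first one at one spinor shows
that this condition is necessary (`Params.act_obr_eq_zero_iff`).

*Non-restrictedness and dimension.* A parallel spinor field is determined by its value at the
origin (`Params.IsParallel.ext`), and the `S⁺`-component of this value is annihilated by the
curvature `c̄ s_i - s_i d + b_i γ_i`, where `b_i = -κ_i²` (`Params.IsParallel.curvature`). The
curvature is a scalar multiple of `γ_i X⁻` (`Params.curvature_eq`). If all these scalars vanish,
then `D` is flat (`Params.isFlat_of`); otherwise that component lies in `ker X⁻`, so that the
field belongs to `𝒦₁`. Finally `γ₁` exchanges the eigenspaces of `γ₁γ₂γ₃γ₄`, so that `ker X⁻` has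
dimension `8` (`Params.finrank_ker_Xminus`) and `𝒦₁` has dimension `16 + 8 = 24`.
-/

namespace CahenWallach

open Matrix

/-! ### Clifford monomials -/

/-- The action of a Kronecker product on a vector, one factor at a time. -/
theorem kronecker_mulVec_apply {l m : Type*} [Fintype l] [Fintype m]
    (A : Matrix l l ℂ) (M : Matrix m m ℂ) (ξ : l × m → ℂ) (s : l) (b : m) :
    ((A ⊗ₖ M) *ᵥ ξ) (s, b) = ∑ t, A s t * (M *ᵥ fun c => ξ (t, c)) b := by
  simp only [mulVec, dotProduct, kroneckerMap_apply, Fintype.sum_prod_type, Finset.mul_sum,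
    mul_assoc]

/-- A monomial transformation of spinors: component `p` of the image is `i^n` times component `q`,
where `N p = (n, q)`. Products of the `γ_i` are of this form. -/
noncomputable def mono (N : SV → ℕ × SV) (ξ : SV → ℂ) : SV → ℂ :=
  fun p => Complex.I ^ (N p).1 * ξ (N p).2

/-- The exponents of `i` (`0` or `2`) in the rows of the octonionic matrices. -/
def octPhase : Fin 7 → Fin 8 → ℕ := ![
  ![2, 0, 2, 0, 2, 0, 0, 2],
  ![2, 0, 0, 2, 2, 2, 0, 0],
  ![2, 2, 0, 0, 2, 0, 2, 0],
  ![2, 0, 0, 0, 0, 2, 2, 2],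
  ![2, 2, 0, 2, 0, 0, 0, 2],
  ![2, 2, 2, 0, 0, 2, 0, 0],
  ![2, 0, 2, 2, 0, 0, 2, 0]]

/-- The monomial data of `gam i`, that is of `γ_{i+1}`: row `b` of the octonionic matrix `oct a`
has its only entry in column `b xor (a + 1)`. -/
def gamData (i : Fin 9) (p : SV) : ℕ × SV :=
  if h : (i : ℕ) < 7 then (octPhase ⟨i, h⟩ p.2, (1 - p.1, p.2 ^^^ ⟨i + 1, by omega⟩))
  else if (i : ℕ) = 7 then (if p.1 = 0 then 2 else 0, (1 - p.1, p.2))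
  else (if p.1 = 0 then 3 else 1, p)

theorem oct_mulVec (a : Fin 7) (v : Fin 8 → ℂ) (b : Fin 8) :
    (oct a *ᵥ v) b = Complex.I ^ octPhase a b * v (b ^^^ ⟨a + 1, by omega⟩) := by
  fin_cases a <;> fin_cases b <;>
    simp [oct, octPhase, mulVec, dotProduct, Fin.sum_univ_eight]

theorem gam_mulVec (i : Fin 9) (ξ : SV → ℂ) : gam i *ᵥ ξ = mono (gamData i) ξ := by
  funext ⟨s, b⟩
  by_cases h : (i : ℕ) < 7
  · rw [gam, dif_pos h, kronecker_mulVec_apply]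
    simp only [oct_mulVec, mono, gamData, h, dif_pos]
    fin_cases s <;> simp [sigma1]
  · by_cases h7 : (i : ℕ) = 7
    · rw [gam, dif_neg h, if_pos h7, kronecker_mulVec_apply]
      simp only [mono, gamData, h7]
      fin_cases s <;> simp [sigma2]
    · rw [gam, dif_neg h, if_neg h7, kronecker_mulVec_apply]
      simp only [mono, gamData, h, h7]
      fin_cases s <;> simp [sigma3]

theorem mono_mono (M N : SV → ℕ × SV) (ξ : SV → ℂ) :
    mono M (mono N ξ) = mono (fun p => ((M p).1 + (N (M p).2).1, (N (M p).2).2)) ξ := by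
  funext p
  simp only [mono, pow_add, mul_assoc]

/-- Two monomial transformations agree if their data agree modulo `i^4 = 1`. All relations between
products of the `γ_i` reduce to this finite comparison of data. -/
theorem mono_eq_mono {M N : SV → ℕ × SV}
    (h : ∀ p, (M p).1 % 4 = (N p).1 % 4 ∧ (M p).2 = (N p).2) (ξ : SV → ℂ) :
    mono M ξ = mono N ξ := by
  funext p
  simp only [mono, (h p).2]
  rw [← Nat.div_add_mod (M p).1 4, ← Nat.div_add_mod (N p).1 4, (h p).1]
  simp [pow_add, pow_mul]

theorem pow_smul_mono (n : ℕ) (M : SV → ℕ × SV) (ξ : SV → ℂ) :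
    ((-1 : ℂ) ^ n) • mono M ξ = mono (fun p => (2 * n + (M p).1, (M p).2)) ξ := by
  funext p
  simp [mono, pow_add, pow_mul, mul_assoc]

theorem neg_eq_mono (ξ : SV → ℂ) : -ξ = mono (fun p => (2, p)) ξ := by
  funext p
  simp [mono]

theorem eq_mono (ξ : SV → ℂ) : ξ = mono (fun p => (0, p)) ξ := by
  funext p
  simp [mono]

theorem gam_gam_self (i : Fin 9) (ξ : SV → ℂ) : gam i *ᵥ gam i *ᵥ ξ = -ξ := by
  rw [gam_mulVec, gam_mulVec, mono_mono, neg_eq_mono]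
  exact mono_eq_mono (by revert i; decide +kernel) ξ

theorem gam_gam_of_ne {i j : Fin 9} (h : i ≠ j) (ξ : SV → ℂ) :
    gam i *ᵥ gam j *ᵥ ξ = -(gam j *ᵥ gam i *ᵥ ξ) := by
  rw [← neg_one_smul ℂ, ← pow_one (-1 : ℂ)]
  simp only [gam_mulVec, mono_mono, pow_smul_mono]
  exact mono_eq_mono (by revert i j; decide +kernel) ξ

/-- The Clifford relation `γ_i γ_j + γ_j γ_i = -2 δ_ij`. -/
theorem gam_anticomm (i j : Fin 9) (ξ : SV → ℂ) :
    gam i *ᵥ gam j *ᵥ ξ + gam j *ᵥ gam i *ᵥ ξ = (if i = j then -2 else 0 : ℂ) • ξ := by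
  by_cases h : i = j
  · subst h
    rw [gam_gam_self, if_pos rfl]
    module
  · rw [gam_gam_of_ne h, if_neg h]
    simp

/-- The involution `γ₁γ₂γ₃γ₄`, with `X^± = ½(1 ± γ₁γ₂γ₃γ₄)`. -/
noncomputable def gam1234 : Matrix SV SV ℂ := gam 0 * gam 1 * gam 2 * gam 3

theorem gam1234_mulVec (ξ : SV → ℂ) :
    gam1234 *ᵥ ξ = gam 0 *ᵥ gam 1 *ᵥ gam 2 *ᵥ gam 3 *ᵥ ξ := by
  simp only [gam1234, mulVec_mulVec, Matrix.mul_assoc]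

theorem gam125_mulVec (ξ : SV → ℂ) : gam125 *ᵥ ξ = gam 0 *ᵥ gam 1 *ᵥ gam 4 *ᵥ ξ := by
  simp only [gam125, mulVec_mulVec, Matrix.mul_assoc]

theorem gam1234_gam1234 (ξ : SV → ℂ) : gam1234 *ᵥ gam1234 *ᵥ ξ = ξ := by
  conv_rhs => rw [eq_mono ξ]
  simp only [gam1234_mulVec, gam_mulVec, mono_mono]
  exact mono_eq_mono (by decide +kernel) ξ

theorem gam125_gam125 (ξ : SV → ℂ) : gam125 *ᵥ gam125 *ᵥ ξ = ξ := by
  conv_rhs => rw [eq_mono ξ]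
  simp only [gam125_mulVec, gam_mulVec, mono_mono]
  exact mono_eq_mono (by decide +kernel) ξ

theorem gam1234_gam125 (ξ : SV → ℂ) :
    gam1234 *ᵥ gam125 *ᵥ ξ = gam125 *ᵥ gam1234 *ᵥ ξ := by
  simp only [gam125_mulVec, gam1234_mulVec, gam_mulVec, mono_mono]
  exact mono_eq_mono (by decide +kernel) ξ

/-- The sign `ε_i` in `γ₁₂₅ γ_i = ε_i γ_i γ₁₂₅`. -/
noncomputable def eps (i : Fin 9) : ℂ := (-1) ^ (![0, 0, 1, 1, 0, 1, 1, 1, 1] i : ℕ)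

/-- The sign `h_i` in `γ₁₂₃₄ γ_i = h_i γ_i γ₁₂₃₄`. -/
noncomputable def hsgn (i : Fin 9) : ℂ := (-1) ^ (![1, 1, 1, 1, 0, 0, 0, 0, 0] i : ℕ)

theorem gam125_gam (i : Fin 9) (ξ : SV → ℂ) :
    gam125 *ᵥ gam i *ᵥ ξ = eps i • gam i *ᵥ gam125 *ᵥ ξ := by
  simp only [eps, gam125_mulVec, gam_mulVec, mono_mono, pow_smul_mono]
  exact mono_eq_mono (by revert i; decide +kernel) ξ

theorem gam1234_gam (i : Fin 9) (ξ : SV → ℂ) :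
    gam1234 *ᵥ gam i *ᵥ ξ = hsgn i • gam i *ᵥ gam1234 *ᵥ ξ := by
  simp only [hsgn, gam1234_mulVec, gam_mulVec, mono_mono, pow_smul_mono]
  exact mono_eq_mono (by revert i; decide +kernel) ξ

theorem eps_mul_self (i : Fin 9) : eps i * eps i = 1 := by
  rw [eps, ← mul_pow]; simp

theorem hsgn_mul_self (i : Fin 9) : hsgn i * hsgn i = 1 := by
  rw [hsgn, ← mul_pow]; simp

/-- The bilinear form on `S(V)` given by the charge conjugation. -/
noncomputable def beta (ξ η : SV → ℂ) : ℂ := ξ ⬝ᵥ CV *ᵥ η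

theorem beta_eq (ξ η : SV → ℂ) :
    beta ξ η = ∑ b, ξ (0, b) * η (0, b) - ∑ b, ξ (1, b) * η (1, b) := by
  have h : ∀ s b, (CV *ᵥ η) (s, b) = (if s = 0 then 1 else -1) * η (s, b) := by
    intro s b
    rw [CV, kronecker_mulVec_apply]
    fin_cases s <;> simp [sigma3]
  simp only [beta, dotProduct, Fintype.sum_prod_type, h, Fin.sum_univ_two]
  simp [Finset.sum_neg_distrib, sub_eq_add_neg]

theorem beta_comm (ξ η : SV → ℂ) : beta ξ η = beta η ξ := by
  simp only [beta_eq, mul_comm]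

theorem beta_add_left (a b c : SV → ℂ) : beta (a + b) c = beta a c + beta b c := by
  simp [beta, add_dotProduct]

theorem beta_add_right (a b c : SV → ℂ) : beta a (b + c) = beta a b + beta a c := by
  simp [beta, mulVec_add, dotProduct_add]

theorem beta_smul_left (r : ℂ) (a b : SV → ℂ) : beta (r • a) b = r * beta a b := by
  simp [beta, smul_dotProduct]

theorem beta_smul_right (r : ℂ) (a b : SV → ℂ) : beta a (r • b) = r * beta a b := by
  simp [beta, mulVec_smul, dotProduct_smul]

theorem beta_neg_right (a b : SV → ℂ) : beta a (-b) = -beta a b := by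
  simp [beta, mulVec_neg]

theorem beta_sub_right (a b c : SV → ℂ) : beta a (b - c) = beta a b - beta a c := by
  simp [beta, mulVec_sub]

theorem beta_sub_left (a b c : SV → ℂ) : beta (a - b) c = beta a c - beta b c := by
  simp [beta, sub_dotProduct]

theorem beta_zero_right (a : SV → ℂ) : beta a 0 = 0 := by simp [beta]

theorem beta_zero_left (a : SV → ℂ) : beta 0 a = 0 := by simp [beta]

theorem beta_sum_left {ι : Type*} (s : Finset ι) (f : ι → SV → ℂ) (b : SV → ℂ) :
    beta (∑ i ∈ s, f i) b = ∑ i ∈ s, beta (f i) b := by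
  simp [beta, sum_dotProduct]

theorem beta_sum_right {ι : Type*} (s : Finset ι) (f : ι → SV → ℂ) (b : SV → ℂ) :
    beta b (∑ i ∈ s, f i) = ∑ i ∈ s, beta b (f i) := by
  simp only [beta_comm b, beta_sum_left]

/-- Clifford multiplication by vectors is self-adjoint for `beta`. -/
theorem beta_gam (i : Fin 9) (ξ η : SV → ℂ) : beta (gam i *ᵥ ξ) η = beta ξ (gam i *ᵥ η) := by
  simp only [gam_mulVec, beta_eq, mono]
  fin_cases i <;> simp [gamData, octPhase, Fin.sum_univ_eight] <;> ring_nf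

/-- Clifford multiplication by `γ₁γ₂γ₅` is skew for `beta`. -/
theorem beta_gam125 (ξ η : SV → ℂ) : beta (gam125 *ᵥ ξ) η = -beta ξ (gam125 *ᵥ η) := by
  have h : gam 4 *ᵥ gam 1 *ᵥ gam 0 *ᵥ η = -(gam125 *ᵥ η) := by
    rw [gam125_mulVec]
    simp only [gam_mulVec, mono_mono]
    rw [← neg_one_smul ℂ, ← pow_one (-1 : ℂ), pow_smul_mono]
    exact mono_eq_mono (by decide +kernel) η
  simp only [gam125_mulVec ξ, beta_gam, h, beta_neg_right]

theorem beta_gam1234 (ξ η : SV → ℂ) : beta (gam1234 *ᵥ ξ) η = beta ξ (gam1234 *ᵥ η) := by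
  have h : gam 3 *ᵥ gam 2 *ᵥ gam 1 *ᵥ gam 0 *ᵥ η = gam1234 *ᵥ η := by
    rw [gam1234_mulVec]
    simp only [gam_mulVec, mono_mono]
    exact mono_eq_mono (by decide +kernel) η
  simp only [gam1234_mulVec ξ, beta_gam, h]


namespace Params

variable (P : Params)

/-! ### The Clifford elements `c̄`, `d` on the eigenspaces of `γ₁γ₂γ₃γ₄` -/

theorem cbar_mulVec (ξ : SV → ℂ) :
    P.cbar *ᵥ ξ = ((P.ap + P.am : ℂ) / 2) • gam125 *ᵥ ξ
      + ((P.ap - P.am : ℂ) / 2) • gam1234 *ᵥ gam125 *ᵥ ξ := by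
  have h : P.cbar = ((P.ap + P.am : ℂ) / 2) • gam125
      + ((P.ap - P.am : ℂ) / 2) • (gam1234 * gam125) := by
    have hX : gam 0 * gam 1 * gam 2 * gam 3 = gam1234 := rfl
    simp only [cbar, Xplus, Xminus, hX, Matrix.add_mul, Matrix.smul_mul, Matrix.sub_mul,
      Matrix.one_mul]
    module
  rw [h, add_mulVec, smul_mulVec, smul_mulVec, mulVec_mulVec]

theorem d_mulVec (ξ : SV → ℂ) :
    P.d *ᵥ ξ = ((P.ap' + P.am' : ℂ) / 2) • gam125 *ᵥ ξ
      + ((P.ap' - P.am' : ℂ) / 2) • gam1234 *ᵥ gam125 *ᵥ ξ :=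
  -- `d` is the element `c̄` for the parameters `(α₊', α₋')`.
  cbar_mulVec ⟨P.ap', P.am', 0, 0⟩ ξ

theorem s_mulVec (i : Fin 9) (ξ : SV → ℂ) :
    P.s i *ᵥ ξ = P.cbar *ᵥ gam i *ᵥ ξ - gam i *ᵥ P.d *ᵥ ξ := by
  rw [s, sub_mulVec, mulVec_mulVec, mulVec_mulVec]

theorem sd_mulVec (i : Fin 9) (ξ : SV → ℂ) :
    P.sd i *ᵥ ξ = P.d *ᵥ gam i *ᵥ ξ - gam i *ᵥ P.cbar *ᵥ ξ := by
  rw [sd, sub_mulVec, mulVec_mulVec, mulVec_mulVec]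

/-- The number `a` with `c̄ γ_i ξ = a γ_i γ₁₂₅ ξ` if `γ₁₂₃₄ ξ = σ ξ`. -/
noncomputable def cEig (σ : ℂ) (i : Fin 9) : ℂ :=
  eps i * ((P.ap + P.am : ℂ) / 2 + (P.ap - P.am : ℂ) / 2 * (hsgn i * σ))

/-- The number `a` with `d ξ = a γ₁₂₅ ξ` if `γ₁₂₃₄ ξ = σ ξ`. -/
noncomputable def dEig (σ : ℂ) : ℂ := (P.ap' + P.am' : ℂ) / 2 + (P.ap' - P.am' : ℂ) / 2 * σ

/-- The number `k` with `s_i ξ = k γ_i γ₁₂₅ ξ` if `γ₁₂₃₄ ξ = σ ξ`. -/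
noncomputable def sEig (σ : ℂ) (i : Fin 9) : ℂ := P.cEig σ i - P.dEig σ

variable {σ : ℂ} {ξ : SV → ℂ}

theorem chi_gam125 (h : gam1234 *ᵥ ξ = σ • ξ) :
    gam1234 *ᵥ gam125 *ᵥ ξ = σ • gam125 *ᵥ ξ := by
  rw [gam1234_gam125, h, mulVec_smul]

theorem chi_gam (h : gam1234 *ᵥ ξ = σ • ξ) (i : Fin 9) :
    gam1234 *ᵥ gam i *ᵥ ξ = (hsgn i * σ) • gam i *ᵥ ξ := by
  rw [gam1234_gam, h, mulVec_smul, smul_smul]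

theorem cbar_gam (h : gam1234 *ᵥ ξ = σ • ξ) (i : Fin 9) :
    P.cbar *ᵥ gam i *ᵥ ξ = P.cEig σ i • gam i *ᵥ gam125 *ᵥ ξ := by
  rw [cbar_mulVec, chi_gam125 (chi_gam h i), gam125_gam, cEig]
  module

theorem d_of_chi (h : gam1234 *ᵥ ξ = σ • ξ) : P.d *ᵥ ξ = P.dEig σ • gam125 *ᵥ ξ := by
  rw [d_mulVec, chi_gam125 h, dEig]
  module

theorem s_of_chi (h : gam1234 *ᵥ ξ = σ • ξ) (i : Fin 9) :
    P.s i *ᵥ ξ = P.sEig σ i • gam i *ᵥ gam125 *ᵥ ξ := by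
  rw [s_mulVec, P.cbar_gam h, P.d_of_chi h, mulVec_smul, sEig]
  module

/-- On an eigenspace of `γ₁γ₂γ₃γ₄` the Clifford element `c̄² e_i - 2 c̄ e_i d + e_i d²` is a
multiple of `e_i`. -/
theorem cbar_s_sub_s_d (h : gam1234 *ᵥ ξ = σ • ξ) (i : Fin 9) :
    P.cbar *ᵥ P.s i *ᵥ ξ - P.s i *ᵥ P.d *ᵥ ξ = P.sEig σ i ^ 2 • gam i *ᵥ ξ := by
  have h' := chi_gam125 h
  rw [P.s_of_chi h, mulVec_smul, P.cbar_gam h', P.d_of_chi h, mulVec_smul, P.s_of_chi h',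
    gam125_gam125, sEig]
  module

/-- The number `k_i` equals `κ_i` up to sign. -/
theorem sEig_one_sq (i : Fin 9) : P.sEig 1 i ^ 2 = (P.kap i : ℂ) ^ 2 := by
  have h : i = 0 ∨ i = 1 ∨ i = 2 ∨ i = 3 ∨ i = 4 ∨ i = 5 ∨ i = 6 ∨ i = 7 ∨ i = 8 := by
    revert i; decide
  rcases h with rfl | rfl | rfl | rfl | rfl | rfl | rfl | rfl | rfl <;>
    simp only [sEig, cEig, dEig, eps, hsgn, kap, cons_val] <;> push_cast <;> ring

theorem eps_eq_of_block {i j : Fin 9} (h : block i = block j) : eps i = eps j := by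
  have : ∀ i j, block i = block j →
    (![0, 0, 1, 1, 0, 1, 1, 1, 1] i : ℕ) = ![0, 0, 1, 1, 0, 1, 1, 1, 1] j := by decide
  rw [eps, this i j h, ← eps]

theorem hsgn_eq_of_block {i j : Fin 9} (h : block i = block j) : hsgn i = hsgn j := by
  have : ∀ i j, block i = block j →
    (![1, 1, 1, 1, 0, 0, 0, 0, 0] i : ℕ) = ![1, 1, 1, 1, 0, 0, 0, 0, 0] j := by decide
  rw [hsgn, this i j h, ← hsgn]

theorem sEig_eq_of_block (σ : ℂ) {i j : Fin 9} (h : block i = block j) :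
    P.sEig σ i = P.sEig σ j := by
  simp only [sEig, cEig, eps_eq_of_block h, hsgn_eq_of_block h]

/-- The diagonal entries `b_i = λ_i² = -κ_i²` of `B`. -/
noncomputable def b (i : Fin 9) : ℂ := -(P.kap i : ℂ) ^ 2

theorem b_eq (i : Fin 9) : P.b i = -P.sEig 1 i ^ 2 := by rw [sEig_one_sq, b]

theorem lam_sq (i : Fin 9) : P.lam i ^ 2 = P.b i := by
  rw [lam, mul_pow, neg_sq, Complex.I_sq, b]; ring

theorem b_eq_of_block {i j : Fin 9} (h : block i = block j) : P.b i = P.b j := by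
  rw [b_eq, b_eq, P.sEig_eq_of_block 1 h]

/-- Distinct blocks are distinguished by the signs `ε` and `h`. -/
theorem block_eq_of_signs : ∀ {i j : Fin 9}, eps i = eps j → hsgn i = hsgn j →
    block i = block j := by
  have key : ∀ i j : Fin 9, block i ≠ block j →
      (![0, 0, 1, 1, 0, 1, 1, 1, 1] i : ℕ) % 2 ≠ (![0, 0, 1, 1, 0, 1, 1, 1, 1] j) % 2 ∨
      (![1, 1, 1, 1, 0, 0, 0, 0, 0] i : ℕ) % 2 ≠ (![1, 1, 1, 1, 0, 0, 0, 0, 0] j) % 2 := by decide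
  have hpow : ∀ m n : ℕ, (-1 : ℂ) ^ m = (-1) ^ n → m % 2 = n % 2 := by
    intro m n h
    rcases Nat.even_or_odd m with hm | hm <;> rcases Nat.even_or_odd n with hn | hn <;>
      simp only [hm.neg_one_pow, hn.neg_one_pow] at h <;> try norm_num at h
    · rw [Nat.even_iff.1 hm, Nat.even_iff.1 hn]
    · rw [Nat.odd_iff.1 hm, Nat.odd_iff.1 hn]
  intro i j he hh
  by_contra hb
  rcases key i j hb with h | h
  · exact h (hpow _ _ he)
  · exact h (hpow _ _ hh)

/-! ### Adjoints for the form `beta` -/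

theorem beta_cbar (ξ η : SV → ℂ) : beta (P.cbar *ᵥ ξ) η = -beta ξ (P.cbar *ᵥ η) := by
  simp only [cbar_mulVec, beta_add_left, beta_smul_left, beta_add_right, beta_smul_right,
    beta_gam125, beta_gam1234, gam1234_gam125]
  ring

theorem beta_d (ξ η : SV → ℂ) : beta (P.d *ᵥ ξ) η = -beta ξ (P.d *ᵥ η) :=
  beta_cbar ⟨P.ap', P.am', 0, 0⟩ ξ η

/-- Eigenspaces of `γ₁γ₂γ₃γ₄` to different eigenvalues are orthogonal. -/
theorem beta_eq_zero_of_chi {τ : ℂ} {η : SV → ℂ} (hξ : gam1234 *ᵥ ξ = σ • ξ)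
    (hη : gam1234 *ᵥ η = τ • η) (h : σ ≠ τ) : beta ξ η = 0 := by
  have := beta_gam1234 ξ η
  rw [hξ, hη, beta_smul_left, beta_smul_right] at this
  have h2 : (σ - τ) * beta ξ η = 0 := by linear_combination this
  exact (mul_eq_zero.1 h2).resolve_left (sub_ne_zero.2 h)

end Params

/-! ### Spinors in coordinates -/

/-- The spinor with the given sixteen components. -/
def vec16 (a0 a1 a2 a3 a4 a5 a6 a7 a8 a9 a10 a11 a12 a13 a14 a15 : ℂ) : SV → ℂ :=
  fun p => ![![a0, a1, a2, a3, a4, a5, a6, a7], ![a8, a9, a10, a11, a12, a13, a14, a15]] p.1 p.2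

section Coordinates
open Complex

theorem gam0_vec16 (a0 a1 a2 a3 a4 a5 a6 a7 a8 a9 a10 a11 a12 a13 a14 a15 : ℂ) :
    gam 0 *ᵥ vec16 a0 a1 a2 a3 a4 a5 a6 a7
        a8 a9 a10 a11 a12 a13 a14 a15 =
      vec16 (-a9) a8 (-a11) a10 (-a13) a12 a15 (-a14)
        (-a1) a0 (-a3) a2 (-a5) a4 a7 (-a6) := by
  funext ⟨s, b⟩
  fin_cases s <;> fin_cases b <;> simp [gam_mulVec, mono, gamData, octPhase, vec16]

theorem gam1_vec16 (a0 a1 a2 a3 a4 a5 a6 a7 a8 a9 a10 a11 a12 a13 a14 a15 : ℂ) :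
    gam 1 *ᵥ vec16 a0 a1 a2 a3 a4 a5 a6 a7
        a8 a9 a10 a11 a12 a13 a14 a15 =
      vec16 (-a10) a11 a8 (-a9) (-a14) (-a15) a12 a13
        (-a2) a3 a0 (-a1) (-a6) (-a7) a4 a5 := by
  funext ⟨s, b⟩
  fin_cases s <;> fin_cases b <;> simp [gam_mulVec, mono, gamData, octPhase, vec16]

theorem gam2_vec16 (a0 a1 a2 a3 a4 a5 a6 a7 a8 a9 a10 a11 a12 a13 a14 a15 : ℂ) :
    gam 2 *ᵥ vec16 a0 a1 a2 a3 a4 a5 a6 a7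
        a8 a9 a10 a11 a12 a13 a14 a15 =
      vec16 (-a11) (-a10) a9 a8 (-a15) a14 (-a13) a12
        (-a3) (-a2) a1 a0 (-a7) a6 (-a5) a4 := by
  funext ⟨s, b⟩
  fin_cases s <;> fin_cases b <;> simp [gam_mulVec, mono, gamData, octPhase, vec16]

theorem gam3_vec16 (a0 a1 a2 a3 a4 a5 a6 a7 a8 a9 a10 a11 a12 a13 a14 a15 : ℂ) :
    gam 3 *ᵥ vec16 a0 a1 a2 a3 a4 a5 a6 a7
        a8 a9 a10 a11 a12 a13 a14 a15 =
      vec16 (-a12) a13 a14 a15 a8 (-a9) (-a10) (-a11)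
        (-a4) a5 a6 a7 a0 (-a1) (-a2) (-a3) := by
  funext ⟨s, b⟩
  fin_cases s <;> fin_cases b <;> simp [gam_mulVec, mono, gamData, octPhase, vec16]

theorem gam4_vec16 (a0 a1 a2 a3 a4 a5 a6 a7 a8 a9 a10 a11 a12 a13 a14 a15 : ℂ) :
    gam 4 *ᵥ vec16 a0 a1 a2 a3 a4 a5 a6 a7
        a8 a9 a10 a11 a12 a13 a14 a15 =
      vec16 (-a13) (-a12) a15 (-a14) a9 a8 a11 (-a10)
        (-a5) (-a4) a7 (-a6) a1 a0 a3 (-a2) := by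
  funext ⟨s, b⟩
  fin_cases s <;> fin_cases b <;> simp [gam_mulVec, mono, gamData, octPhase, vec16]

theorem gam5_vec16 (a0 a1 a2 a3 a4 a5 a6 a7 a8 a9 a10 a11 a12 a13 a14 a15 : ℂ) :
    gam 5 *ᵥ vec16 a0 a1 a2 a3 a4 a5 a6 a7
        a8 a9 a10 a11 a12 a13 a14 a15 =
      vec16 (-a14) (-a15) (-a12) a13 a10 (-a11) a8 a9
        (-a6) (-a7) (-a4) a5 a2 (-a3) a0 a1 := by
  funext ⟨s, b⟩
  fin_cases s <;> fin_cases b <;> simp [gam_mulVec, mono, gamData, octPhase, vec16]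

theorem gam6_vec16 (a0 a1 a2 a3 a4 a5 a6 a7 a8 a9 a10 a11 a12 a13 a14 a15 : ℂ) :
    gam 6 *ᵥ vec16 a0 a1 a2 a3 a4 a5 a6 a7
        a8 a9 a10 a11 a12 a13 a14 a15 =
      vec16 (-a15) a14 (-a13) (-a12) a11 a10 (-a9) a8
        (-a7) a6 (-a5) (-a4) a3 a2 (-a1) a0 := by
  funext ⟨s, b⟩
  fin_cases s <;> fin_cases b <;> simp [gam_mulVec, mono, gamData, octPhase, vec16]

theorem gam7_vec16 (a0 a1 a2 a3 a4 a5 a6 a7 a8 a9 a10 a11 a12 a13 a14 a15 : ℂ) :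
    gam 7 *ᵥ vec16 a0 a1 a2 a3 a4 a5 a6 a7
        a8 a9 a10 a11 a12 a13 a14 a15 =
      vec16 (-a8) (-a9) (-a10) (-a11) (-a12) (-a13) (-a14) (-a15)
        a0 a1 a2 a3 a4 a5 a6 a7 := by
  funext ⟨s, b⟩
  fin_cases s <;> fin_cases b <;> simp [gam_mulVec, mono, gamData, vec16]

theorem gam8_vec16 (a0 a1 a2 a3 a4 a5 a6 a7 a8 a9 a10 a11 a12 a13 a14 a15 : ℂ) :
    gam 8 *ᵥ vec16 a0 a1 a2 a3 a4 a5 a6 a7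
        a8 a9 a10 a11 a12 a13 a14 a15 =
      vec16 (-(I * a0)) (-(I * a1)) (-(I * a2)) (-(I * a3)) (-(I * a4)) (-(I * a5)) (-(I * a6))
        (-(I * a7))
        (I * a8) (I * a9) (I * a10) (I * a11) (I * a12) (I * a13) (I * a14) (I * a15) := by
  funext ⟨s, b⟩
  fin_cases s <;> fin_cases b <;> simp [gam_mulVec, mono, gamData, vec16]

theorem gam125_vec16 (a0 a1 a2 a3 a4 a5 a6 a7 a8 a9 a10 a11 a12 a13 a14 a15 : ℂ) :
    gam125 *ᵥ vec16 a0 a1 a2 a3 a4 a5 a6 a7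
        a8 a9 a10 a11 a12 a13 a14 a15 =
      vec16 a14 (-a15) (-a12) (-a13) (-a10) (-a11) a8 (-a9)
        a6 (-a7) (-a4) (-a5) (-a2) (-a3) a0 (-a1) := by
  simp only [gam125_mulVec, gam0_vec16, gam1_vec16, gam4_vec16, neg_neg]

theorem gam1234_vec16 (a0 a1 a2 a3 a4 a5 a6 a7 a8 a9 a10 a11 a12 a13 a14 a15 : ℂ) :
    gam1234 *ᵥ vec16 a0 a1 a2 a3 a4 a5 a6 a7
        a8 a9 a10 a11 a12 a13 a14 a15 =
      vec16 a4 (-a5) (-a6) (-a7) a0 (-a1) (-a2) (-a3)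
        a12 (-a13) (-a14) (-a15) a8 (-a9) (-a10) (-a11) := by
  simp only [gam1234_mulVec, gam0_vec16, gam1_vec16, gam2_vec16, gam3_vec16, neg_neg]

theorem eq_vec16 (ξ : SV → ℂ) :
    ξ = vec16 (ξ (0, 0)) (ξ (0, 1)) (ξ (0, 2)) (ξ (0, 3)) (ξ (0, 4)) (ξ (0, 5)) (ξ (0, 6))
      (ξ (0, 7))
      (ξ (1, 0)) (ξ (1, 1)) (ξ (1, 2)) (ξ (1, 3)) (ξ (1, 4)) (ξ (1, 5)) (ξ (1, 6)) (ξ (1, 7)) := by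
  funext ⟨s, b⟩
  fin_cases s <;> fin_cases b <;> rfl

theorem add_vec16 (a0 a1 a2 a3 a4 a5 a6 a7 a8 a9 a10 a11 a12 a13 a14 a15
    b0 b1 b2 b3 b4 b5 b6 b7 b8 b9 b10 b11 b12 b13 b14 b15 : ℂ) :
    vec16 a0 a1 a2 a3 a4 a5 a6 a7 a8 a9 a10 a11 a12 a13 a14 a15
      + vec16 b0 b1 b2 b3 b4 b5 b6 b7 b8 b9 b10 b11 b12 b13 b14 b15 =
    vec16 (a0 + b0) (a1 + b1) (a2 + b2) (a3 + b3) (a4 + b4) (a5 + b5) (a6 + b6) (a7 + b7)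
      (a8 + b8) (a9 + b9) (a10 + b10) (a11 + b11) (a12 + b12) (a13 + b13) (a14 + b14)
      (a15 + b15) := by
  funext ⟨s, b⟩
  fin_cases s <;> fin_cases b <;> rfl

theorem smul_vec16 (r a0 a1 a2 a3 a4 a5 a6 a7 a8 a9 a10 a11 a12 a13 a14 a15 : ℂ) :
    r • vec16 a0 a1 a2 a3 a4 a5 a6 a7 a8 a9 a10 a11 a12 a13 a14 a15 =
    vec16 (r * a0) (r * a1) (r * a2) (r * a3) (r * a4) (r * a5) (r * a6) (r * a7)
      (r * a8) (r * a9) (r * a10) (r * a11) (r * a12) (r * a13) (r * a14) (r * a15) := by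
  funext ⟨s, b⟩
  fin_cases s <;> fin_cases b <;> rfl

theorem zero_eq_vec16 : (0 : SV → ℂ) = vec16 0 0 0 0 0 0 0 0 0 0 0 0 0 0 0 0 := by
  funext ⟨s, b⟩
  fin_cases s <;> fin_cases b <;> rfl

theorem beta_vec16 (a0 a1 a2 a3 a4 a5 a6 a7 a8 a9 a10 a11 a12 a13 a14 a15
    b0 b1 b2 b3 b4 b5 b6 b7 b8 b9 b10 b11 b12 b13 b14 b15 : ℂ) :
    beta (vec16 a0 a1 a2 a3 a4 a5 a6 a7 a8 a9 a10 a11 a12 a13 a14 a15)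
      (vec16 b0 b1 b2 b3 b4 b5 b6 b7 b8 b9 b10 b11 b12 b13 b14 b15) =
    a0 * b0 + a1 * b1 + a2 * b2 + a3 * b3 + a4 * b4 + a5 * b5 + a6 * b6 + a7 * b7
      - (a8 * b8 + a9 * b9 + a10 * b10 + a11 * b11 + a12 * b12 + a13 * b13 + a14 * b14
        + a15 * b15) := by
  rw [beta_eq, Fin.sum_univ_eight, Fin.sum_univ_eight]
  rfl

/-- The coordinates of the `+1`-eigenspace of `γ₁γ₂γ₃γ₄`. -/
theorem exists_vec16_of_chi {ξ : SV → ℂ} (h : gam1234 *ᵥ ξ = ξ) :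
    ∃ a0 a1 a2 a3 a8 a9 a10 a11 : ℂ,
      ξ = vec16 a0 a1 a2 a3 a0 (-a1) (-a2) (-a3) a8 a9 a10 a11 a8 (-a9) (-a10) (-a11) := by
  refine ⟨ξ (0, 0), ξ (0, 1), ξ (0, 2), ξ (0, 3), ξ (1, 0), ξ (1, 1), ξ (1, 2), ξ (1, 3), ?_⟩
  rw [eq_vec16 ξ, gam1234_vec16] at h
  have h' := fun p => congrFun h p
  simp only [Prod.forall, Fin.forall_fin_succ, vec16] at h'
  funext ⟨s, b⟩
  fin_cases s <;> fin_cases b <;> simp [vec16] at h' ⊢ <;> tauto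

end Coordinates

namespace Params
variable (P : Params)

theorem sEig_one (i : Fin 9) :
    P.sEig 1 i = (![P.am - P.ap', P.am - P.ap', -P.am - P.ap', -P.am - P.ap', P.ap - P.ap',
      -P.ap - P.ap', -P.ap - P.ap', -P.ap - P.ap', -P.ap - P.ap'] : Fin 9 → ℂ) i := by
  have h : i = 0 ∨ i = 1 ∨ i = 2 ∨ i = 3 ∨ i = 4 ∨ i = 5 ∨ i = 6 ∨ i = 7 ∨ i = 8 := by
    revert i; decide
  rcases h with rfl | rfl | rfl | rfl | rfl | rfl | rfl | rfl | rfl <;>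
    simp only [sEig, cEig, dEig, eps, hsgn, cons_val] <;> ring

end Params

/-! ### Vectors and rotations acting on spinors -/

/-- Clifford multiplication `∑ x_i γ_i` by a complex vector. -/
noncomputable def cl (x : Fin 9 → ℂ) (ξ : SV → ℂ) : SV → ℂ := ∑ i, x i • gam i *ᵥ ξ

/-- The spin representation `¼ ∑ R_ij γ_i γ_j` of an infinitesimal rotation. -/
noncomputable def rot (R : Matrix (Fin 9) (Fin 9) ℂ) (ξ : SV → ℂ) : SV → ℂ :=
  (1 / 4 : ℂ) • ∑ i, ∑ j, R i j • gam i *ᵥ gam j *ᵥ ξ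

/-- Infinitesimal rotations that preserve the blocks. -/
structure IsRot (R : Matrix (Fin 9) (Fin 9) ℂ) : Prop where
  skew : ∀ i j, R j i = -R i j
  eq_zero : ∀ i j, Params.block i ≠ Params.block j → R i j = 0

theorem cl_add_left (x y : Fin 9 → ℂ) (ξ : SV → ℂ) : cl (x + y) ξ = cl x ξ + cl y ξ := by
  simp [cl, add_smul, Finset.sum_add_distrib]

theorem cl_sub_left (x y : Fin 9 → ℂ) (ξ : SV → ℂ) : cl (x - y) ξ = cl x ξ - cl y ξ := by
  simp [cl, sub_smul, Finset.sum_sub_distrib]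

theorem cl_smul_left (c : ℂ) (x : Fin 9 → ℂ) (ξ : SV → ℂ) : cl (c • x) ξ = c • cl x ξ := by
  simp [cl, mul_smul, Finset.smul_sum]

theorem cl_add (x : Fin 9 → ℂ) (ξ η : SV → ℂ) : cl x (ξ + η) = cl x ξ + cl x η := by
  simp [cl, mulVec_add, Finset.sum_add_distrib]

theorem cl_smul (c : ℂ) (x : Fin 9 → ℂ) (ξ : SV → ℂ) : cl x (c • ξ) = c • cl x ξ := by
  simp only [cl, mulVec_smul, Finset.smul_sum, smul_comm c]

theorem rot_add_left (R S : Matrix (Fin 9) (Fin 9) ℂ) (ξ : SV → ℂ) :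
    rot (R + S) ξ = rot R ξ + rot S ξ := by
  simp only [rot, Matrix.add_apply, add_smul, Finset.sum_add_distrib, smul_add]

theorem rot_smul_left (c : ℂ) (R : Matrix (Fin 9) (Fin 9) ℂ) (ξ : SV → ℂ) :
    rot (c • R) ξ = c • rot R ξ := by
  simp only [rot, Matrix.smul_apply, smul_eq_mul, mul_smul, Finset.smul_sum, smul_comm c]

theorem rot_sub_left (R S : Matrix (Fin 9) (Fin 9) ℂ) (ξ : SV → ℂ) :
    rot (R - S) ξ = rot R ξ - rot S ξ := by
  simp only [rot, Matrix.sub_apply, sub_smul, Finset.sum_sub_distrib, smul_sub]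

theorem rot_add (R : Matrix (Fin 9) (Fin 9) ℂ) (ξ η : SV → ℂ) :
    rot R (ξ + η) = rot R ξ + rot R η := by
  simp only [rot, mulVec_add, Finset.sum_add_distrib, smul_add]

theorem rot_smul (c : ℂ) (R : Matrix (Fin 9) (Fin 9) ℂ) (ξ : SV → ℂ) :
    rot R (c • ξ) = c • rot R ξ := by
  simp only [rot, mulVec_smul, Finset.smul_sum, smul_comm c]

theorem rot_neg (R : Matrix (Fin 9) (Fin 9) ℂ) (ξ : SV → ℂ) : rot R (-ξ) = -rot R ξ := by
  simpa using rot_smul (-1) R ξ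

theorem rot_sub (R : Matrix (Fin 9) (Fin 9) ℂ) (ξ η : SV → ℂ) :
    rot R (ξ - η) = rot R ξ - rot R η := by
  rw [sub_eq_add_neg, rot_add, rot_neg, sub_eq_add_neg]

theorem rot_sum (R : Matrix (Fin 9) (Fin 9) ℂ) {ι : Type*} (s : Finset ι) (f : ι → SV → ℂ) :
    rot R (∑ i ∈ s, f i) = ∑ i ∈ s, rot R (f i) := by
  classical
  induction s using Finset.induction_on with
  | empty => simp [rot]
  | insert a s h ih => rw [Finset.sum_insert h, Finset.sum_insert h, rot_add, ih]

/-- The spin representation covers the vector representation. -/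
theorem rot_gam {R : Matrix (Fin 9) (Fin 9) ℂ} (hR : IsRot R) (i : Fin 9) (ξ : SV → ℂ) :
    rot R (gam i *ᵥ ξ) = gam i *ᵥ rot R ξ - ∑ k, R k i • gam k *ᵥ ξ := by
  have key : ∀ j l, gam j *ᵥ gam l *ᵥ gam i *ᵥ ξ = gam i *ᵥ gam j *ᵥ gam l *ᵥ ξ
      + (if l = i then -2 else 0 : ℂ) • gam j *ᵥ ξ
        - (if j = i then -2 else 0 : ℂ) • gam l *ᵥ ξ := by
    intro j l
    have h1 := congrArg (gam j *ᵥ ·) (gam_anticomm l i ξ)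
    have h2 := gam_anticomm j i (gam l *ᵥ ξ)
    simp only [mulVec_add, mulVec_smul] at h1
    linear_combination h1 - h2
  have hl : ∑ j, ∑ l, R j l • ((if l = i then -2 else 0 : ℂ) • gam j *ᵥ ξ)
      = (-2 : ℂ) • ∑ k, R k i • gam k *ᵥ ξ := by
    simp only [ite_smul, zero_smul, smul_ite, smul_zero, Finset.sum_ite_eq', Finset.mem_univ,
      if_true, Finset.smul_sum, smul_comm (-2 : ℂ)]
  have hj : ∑ j, ∑ l, R j l • ((if j = i then -2 else 0 : ℂ) • gam l *ᵥ ξ)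
      = (2 : ℂ) • ∑ k, R k i • gam k *ᵥ ξ := by
    rw [Finset.sum_comm]
    simp only [ite_smul, zero_smul, smul_ite, smul_zero, Finset.sum_ite_eq', Finset.mem_univ,
      if_true, Finset.smul_sum, hR.skew _ i]
    refine Finset.sum_congr rfl fun k _ => ?_
    module
  simp only [rot, key, smul_add, smul_sub, Finset.sum_add_distrib, Finset.sum_sub_distrib, hl, hj,
    mulVec_smul, Matrix.mulVec_sum]
  module

theorem rot_cl {R : Matrix (Fin 9) (Fin 9) ℂ} (hR : IsRot R) (x : Fin 9 → ℂ) (ξ : SV → ℂ) :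
    rot R (cl x ξ) = cl x (rot R ξ) - cl (R *ᵥ x) ξ := by
  have h : cl (R *ᵥ x) ξ = ∑ i, x i • ∑ k, R k i • gam k *ᵥ ξ := by
    simp only [cl, mulVec, dotProduct, Finset.sum_smul, Finset.smul_sum]
    rw [Finset.sum_comm]
    refine Finset.sum_congr rfl fun k _ => Finset.sum_congr rfl fun i _ => ?_
    rw [smul_smul, mul_comm]
  rw [h]
  simp only [cl, rot_sum, rot_smul, rot_gam hR, smul_sub, Finset.sum_sub_distrib]

theorem rot_rot {R : Matrix (Fin 9) (Fin 9) ℂ} (hR : IsRot R) (S : Matrix (Fin 9) (Fin 9) ℂ)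
    (ξ : SV → ℂ) : rot R (rot S ξ) = rot S (rot R ξ) + rot (S * R - R * S) ξ := by
  have e1 : ∑ i, ∑ j, S i j • ∑ k, R k i • gam k *ᵥ gam j *ᵥ ξ
      = ∑ i, ∑ j, (R * S) i j • gam i *ᵥ gam j *ᵥ ξ := by
    simp only [Matrix.mul_apply, Finset.sum_smul, Finset.smul_sum]
    rw [Finset.sum_comm]
    simp_rw [fun j => Finset.sum_comm (s := (Finset.univ : Finset (Fin 9))) (t := Finset.univ)
      (f := fun i k => S i j • R k i • gam k *ᵥ gam j *ᵥ ξ)]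
    rw [Finset.sum_comm]
    refine Finset.sum_congr rfl fun k _ => Finset.sum_congr rfl fun j _ =>
      Finset.sum_congr rfl fun i _ => ?_
    rw [smul_smul, mul_comm]
  have e2 : ∑ i, ∑ j, S i j • gam i *ᵥ ∑ k, R k j • gam k *ᵥ ξ
      = -∑ i, ∑ j, (S * R) i j • gam i *ᵥ gam j *ᵥ ξ := by
    simp only [Matrix.mul_apply, Finset.sum_smul, Finset.smul_sum, Matrix.mulVec_sum, mulVec_smul,
      ← Finset.sum_neg_distrib]
    refine Finset.sum_congr rfl fun i _ => ?_
    rw [Finset.sum_comm]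
    refine Finset.sum_congr rfl fun k _ => Finset.sum_congr rfl fun j _ => ?_
    rw [hR.skew j k]
    module
  have e3 : rot R (rot S ξ) = rot S (rot R ξ)
      - (1 / 4 : ℂ) • (∑ i, ∑ j, S i j • ∑ k, R k i • gam k *ᵥ gam j *ᵥ ξ
        + ∑ i, ∑ j, S i j • gam i *ᵥ ∑ k, R k j • gam k *ᵥ ξ) := by
    conv_lhs => rw [rot.eq_1 S ξ]
    rw [rot.eq_1 S (rot R ξ)]
    simp only [rot_smul, rot_sum, rot_gam hR, mulVec_sub, smul_sub, Finset.sum_sub_distrib]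
    module
  rw [e3, e1, e2, rot_sub_left, rot.eq_1 (S * R), rot.eq_1 (R * S)]
  module

/-- An operator that commutes with the `γ_i` up to a sign that is constant on blocks commutes with
the rotations that preserve the blocks. -/
theorem mulVec_rot {R : Matrix (Fin 9) (Fin 9) ℂ} (hR : IsRot R) {M : Matrix SV SV ℂ}
    {e : Fin 9 → ℂ} (he : ∀ i j, Params.block i = Params.block j → e i * e j = 1)
    (hM : ∀ i ξ, M *ᵥ gam i *ᵥ ξ = e i • gam i *ᵥ M *ᵥ ξ) (ξ : SV → ℂ) :
    M *ᵥ rot R ξ = rot R (M *ᵥ ξ) := by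
  simp only [rot, mulVec_smul, Matrix.mulVec_sum]
  congr 1
  refine Finset.sum_congr rfl fun i _ => Finset.sum_congr rfl fun j _ => ?_
  by_cases h : Params.block i = Params.block j
  · rw [hM, hM, mulVec_smul, smul_smul (e i), he i j h, one_smul]
  · rw [hR.eq_zero i j h, zero_smul, zero_smul]

theorem gam125_rot {R : Matrix (Fin 9) (Fin 9) ℂ} (hR : IsRot R) (ξ : SV → ℂ) :
    gam125 *ᵥ rot R ξ = rot R (gam125 *ᵥ ξ) :=
  mulVec_rot hR (fun i j h => by rw [Params.eps_eq_of_block h, eps_mul_self]) gam125_gam ξ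

theorem gam1234_rot {R : Matrix (Fin 9) (Fin 9) ℂ} (hR : IsRot R) (ξ : SV → ℂ) :
    gam1234 *ᵥ rot R ξ = rot R (gam1234 *ᵥ ξ) :=
  mulVec_rot hR (fun i j h => by rw [Params.hsgn_eq_of_block h, hsgn_mul_self]) gam1234_gam ξ

theorem cbar_rot (P : Params) {R : Matrix (Fin 9) (Fin 9) ℂ} (hR : IsRot R) (ξ : SV → ℂ) :
    P.cbar *ᵥ rot R ξ = rot R (P.cbar *ᵥ ξ) := by
  simp only [Params.cbar_mulVec, gam125_rot hR, gam1234_rot hR, rot_add, rot_smul]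

theorem d_rot (P : Params) {R : Matrix (Fin 9) (Fin 9) ℂ} (hR : IsRot R) (ξ : SV → ℂ) :
    P.d *ᵥ rot R ξ = rot R (P.d *ᵥ ξ) :=
  cbar_rot ⟨P.ap', P.am', 0, 0⟩ hR ξ

theorem beta_rot {R : Matrix (Fin 9) (Fin 9) ℂ} (hR : IsRot R) (ξ η : SV → ℂ) :
    beta (rot R ξ) η = -beta ξ (rot R η) := by
  simp only [rot, beta_smul_left, beta_smul_right, beta_sum_left, beta_sum_right, beta_gam]
  rw [Finset.sum_comm]
  rw [← mul_neg, ← Finset.sum_neg_distrib]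
  congr 1
  refine Finset.sum_congr rfl fun i _ => ?_
  rw [← Finset.sum_neg_distrib]
  refine Finset.sum_congr rfl fun j _ => ?_
  rw [hR.skew i j]
  ring

theorem beta_cl_right (x : Fin 9 → ℂ) (ξ η : SV → ℂ) :
    beta ξ (cl x η) = ∑ i, x i * beta ξ (gam i *ᵥ η) := by
  simp only [cl, beta_sum_right, beta_smul_right]

theorem beta_cl (x : Fin 9 → ℂ) (ξ η : SV → ℂ) : beta (cl x ξ) η = beta ξ (cl x η) := by
  simp only [cl, beta_sum_left, beta_sum_right, beta_smul_left, beta_smul_right, beta_gam]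

/-- Rotations that preserve the blocks commute with diagonal matrices that are constant on the
blocks. -/
theorem IsRot.mulVec_mul {R : Matrix (Fin 9) (Fin 9) ℂ} (hR : IsRot R) {a : Fin 9 → ℂ}
    (ha : ∀ i j, Params.block i = Params.block j → a i = a j) (x : Fin 9 → ℂ) :
    R *ᵥ (a * x) = a * R *ᵥ x := by
  funext i
  simp only [mulVec, dotProduct, Pi.mul_apply, Finset.mul_sum]
  refine Finset.sum_congr rfl fun j _ => ?_
  by_cases h : Params.block i = Params.block j
  · rw [ha i j h]; ring
  · rw [hR.eq_zero i j h]; ring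


namespace Params
variable (P : Params)

/-! ### Cubic Fierz identities for the bracket of odd elements -/

/-- The matrix of coefficients of `K₍ᵢⱼ₎` in the bracket of two odd elements, up to a factor. -/
noncomputable def rotBr (ξ η : SV → ℂ) : Matrix (Fin 9) (Fin 9) ℂ := Matrix.of fun i j =>
  if block i = block j then P.sEig 1 i * ((beta ξ (gam i *ᵥ gam j *ᵥ gam125 *ᵥ η)
    - beta ξ (gam j *ᵥ gam i *ᵥ gam125 *ᵥ η)) / 2) else 0

theorem rotBr_eq (ξ η : SV → ℂ) (i j : Fin 9) : P.rotBr ξ η i j =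
    if block i = block j ∧ i ≠ j then P.sEig 1 i * beta ξ (gam i *ᵥ gam j *ᵥ gam125 *ᵥ η)
    else 0 := by
  by_cases h : i = j
  · simp [rotBr, h]
  · simp only [rotBr, of_apply, gam_gam_of_ne (Ne.symm h), beta_neg_right, ne_eq, h,
      not_false_eq_true, and_true]
    congr 1
    ring

theorem sum_fin_nine {E : Type*} [AddCommMonoid E] (F : Fin 9 → E) :
    ∑ i, F i = F 0 + F 1 + F 2 + F 3 + F 4 + F 5 + F 6 + F 7 + F 8 := by
  rw [Fin.sum_univ_castSucc, Fin.sum_univ_eight]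
  rfl

/-- The pairs of distinct indices in a common block. -/
theorem sum_block {E : Type*} [AddCommMonoid E] (F : Fin 9 → Fin 9 → E) :
    (∑ i, ∑ j, if block i = block j ∧ i ≠ j then F i j else 0) =
      F 0 1 + F 1 0 + (F 2 3 + F 3 2) + (F 5 6 + F 5 7 + F 5 8 + F 6 5 + F 6 7 + F 6 8
        + F 7 5 + F 7 6 + F 7 8 + F 8 5 + F 8 6 + F 8 7) := by
  simp +decide [Fin.sum_univ_succ, block]
  abel

theorem rot_rotBr (ξ η : SV → ℂ) :
    rot (P.rotBr ξ ξ) η =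
      (1 / 2 : ℂ) • ((P.sEig 1 0 * beta ξ (gam 0 *ᵥ gam 1 *ᵥ gam125 *ᵥ ξ)) • gam 0 *ᵥ gam 1 *ᵥ η
      + (P.sEig 1 2 * beta ξ (gam 2 *ᵥ gam 3 *ᵥ gam125 *ᵥ ξ)) • gam 2 *ᵥ gam 3 *ᵥ η
      + (P.sEig 1 5 * beta ξ (gam 5 *ᵥ gam 6 *ᵥ gam125 *ᵥ ξ)) • gam 5 *ᵥ gam 6 *ᵥ η
      + (P.sEig 1 5 * beta ξ (gam 5 *ᵥ gam 7 *ᵥ gam125 *ᵥ ξ)) • gam 5 *ᵥ gam 7 *ᵥ η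
      + (P.sEig 1 5 * beta ξ (gam 5 *ᵥ gam 8 *ᵥ gam125 *ᵥ ξ)) • gam 5 *ᵥ gam 8 *ᵥ η
      + (P.sEig 1 5 * beta ξ (gam 6 *ᵥ gam 7 *ᵥ gam125 *ᵥ ξ)) • gam 6 *ᵥ gam 7 *ᵥ η
      + (P.sEig 1 5 * beta ξ (gam 6 *ᵥ gam 8 *ᵥ gam125 *ᵥ ξ)) • gam 6 *ᵥ gam 8 *ᵥ η
      + (P.sEig 1 5 * beta ξ (gam 7 *ᵥ gam 8 *ᵥ gam125 *ᵥ ξ)) • gam 7 *ᵥ gam 8 *ᵥ η) := by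
  have key : ∀ i j : Fin 9, block i = block j → i ≠ j →
      (P.sEig 1 j * beta ξ (gam j *ᵥ gam i *ᵥ gam125 *ᵥ ξ)) • gam j *ᵥ gam i *ᵥ η
      = (P.sEig 1 i * beta ξ (gam i *ᵥ gam j *ᵥ gam125 *ᵥ ξ)) • gam i *ᵥ gam j *ᵥ η := by
    intro i j hb h
    rw [gam_gam_of_ne h.symm, gam_gam_of_ne h.symm, beta_neg_right, P.sEig_eq_of_block 1 hb]
    module
  have h6 : P.sEig 1 6 = P.sEig 1 5 := P.sEig_eq_of_block 1 rfl
  have h7 : P.sEig 1 7 = P.sEig 1 5 := P.sEig_eq_of_block 1 rfl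
  simp only [rot, rotBr_eq, ite_smul, zero_smul]
  rw [sum_block, key 0 1 rfl (by decide), key 2 3 rfl (by decide), key 5 6 rfl (by decide),
    key 5 7 rfl (by decide), key 5 8 rfl (by decide), key 6 7 rfl (by decide),
    key 6 8 rfl (by decide), key 7 8 rfl (by decide), h6, h7]
  module

set_option maxHeartbeats 4000000 in
/-- The Jacobi identity for an odd element with components `(ξ₁, ξ)`, component in `S⁺`: a cubic
identity on the `+1`-eigenspace of `γ₁γ₂γ₃γ₄`, verified in its eight coordinates. -/
theorem fierz_plus (hP : P.ap = -3 * P.ap') {ξ : SV → ℂ} (h : gam1234 *ᵥ ξ = ξ) :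
    beta ξ ξ • P.d *ᵥ ξ + rot (P.rotBr ξ ξ) ξ = 0 := by
  have h' : gam1234 *ᵥ ξ = (1 : ℂ) • ξ := by rw [h, one_smul]
  rw [P.d_of_chi h', rot_rotBr, sEig_one, sEig_one, sEig_one, hP, dEig]
  obtain ⟨a0, a1, a2, a3, a8, a9, a10, a11, rfl⟩ := exists_vec16_of_chi h
  simp only [gam0_vec16, gam1_vec16, gam2_vec16, gam3_vec16, gam5_vec16, gam6_vec16, gam7_vec16,
    gam8_vec16, gam125_vec16, beta_vec16, smul_vec16, add_vec16, zero_eq_vec16, cons_val]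
  push_cast
  congr 1 <;> ring_nf <;> simp only [Complex.I_sq] <;> ring

set_option maxHeartbeats 4000000 in
/-- The Jacobi identity for an odd element with components `(η, ξ)`, component in `S⁻`: an identity
quadratic in `ξ` and linear in `η`, verified in coordinates. -/
theorem fierz_minus (hP : P.ap = -3 * P.ap') {ξ : SV → ℂ} (h : gam1234 *ᵥ ξ = ξ) (η : SV → ℂ) :
    beta ξ ξ • P.cbar *ᵥ η
      + ∑ i, ((P.sEig 1 i * beta η (gam i *ᵥ ξ)) • gam i *ᵥ gam125 *ᵥ ξ
        - (P.sEig 1 i * beta η (gam i *ᵥ gam125 *ᵥ ξ)) • gam i *ᵥ ξ)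
      + rot (P.rotBr ξ ξ) η = 0 := by
  rw [P.cbar_mulVec, rot_rotBr]
  simp only [sEig_one, hP]
  obtain ⟨a0, a1, a2, a3, a8, a9, a10, a11, rfl⟩ := exists_vec16_of_chi h
  rw [eq_vec16 η]
  generalize η (0, 0) = b0, η (0, 1) = b1, η (0, 2) = b2, η (0, 3) = b3, η (0, 4) = b4,
    η (0, 5) = b5, η (0, 6) = b6, η (0, 7) = b7, η (1, 0) = b8, η (1, 1) = b9, η (1, 2) = b10,
    η (1, 3) = b11, η (1, 4) = b12, η (1, 5) = b13, η (1, 6) = b14, η (1, 7) = b15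
  simp only [sum_fin_nine, sub_eq_add_neg, ← neg_smul]
  simp only [gam0_vec16, gam1_vec16, gam2_vec16, gam3_vec16, gam4_vec16, gam5_vec16, gam6_vec16,
    gam7_vec16, gam8_vec16, gam125_vec16, gam1234_vec16, beta_vec16, smul_vec16, add_vec16,
    zero_eq_vec16, cons_val]
  push_cast
  congr 1 <;> ring_nf <;> simp only [Complex.I_sq] <;> ring

/-- The identity `fierz_plus` fails unless `α₊ = -3 α₊'`. -/
theorem eq_of_fierz_plus (h : ∀ ξ : SV → ℂ, gam1234 *ᵥ ξ = ξ →
    beta ξ ξ • P.d *ᵥ ξ + rot (P.rotBr ξ ξ) ξ = 0) : P.ap = -3 * P.ap' := by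
  -- The spinor below lies in the `+1`-eigenspace and is not null for `beta`; the coordinate `(1,
  -- 2)` of the identity at this spinor amounts to `α₊ + 3 α₊' = 0`.
  have hξ : gam1234 *ᵥ vec16 1 0 0 0 1 0 0 0 0 0 0 0 0 0 0 0 =
      vec16 1 0 0 0 1 0 0 0 0 0 0 0 0 0 0 0 := by
    simp only [gam1234_vec16, neg_zero]
  have h' := congrFun (h _ hξ) (1, 2)
  rw [P.d_of_chi (hξ.trans (one_smul ℂ _).symm), rot_rotBr, sEig_one, sEig_one, sEig_one, dEig]
    at h'
  simp only [gam0_vec16, gam1_vec16, gam2_vec16, gam3_vec16, gam5_vec16, gam6_vec16, gam7_vec16,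
    gam8_vec16, gam125_vec16, beta_vec16, smul_vec16, add_vec16, cons_val] at h'
  simp [vec16] at h'
  have h2 : (P.ap : ℂ) = ((-3 * P.ap' : ℝ) : ℂ) := by
    push_cast
    linear_combination (P.ap + P.ap' : ℂ) * Complex.I_sq - h'
  exact_mod_cast h2

end Params

/-! ### The algebraic model of the superalgebra -/

/-- Coefficients of an element of `𝒦₀`: the element `p K₍₊₎ + m K₍₋₎ + ∑ u_i K₍ᵢ₎ + ∑ v_i K₍ᵢ*₎`
plus the rotation field `∑ R_ij x^j ∂_i`. -/
@[ext]
structure Coef where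
  /-- the coefficient of `K₍₊₎` -/
  p : ℂ
  /-- the coefficient of `K₍₋₎` -/
  m : ℂ
  /-- the coefficients of the `K₍ᵢ₎` -/
  u : Fin 9 → ℂ
  /-- the coefficients of the `K₍ᵢ*₎` -/
  v : Fin 9 → ℂ
  /-- the infinitesimal rotation -/
  R : Matrix (Fin 9) (Fin 9) ℂ

namespace Coef

noncomputable instance : Add Coef := ⟨fun c c' => ⟨c.p + c'.p, c.m + c'.m, c.u + c'.u, c.v + c'.v,
    c.R + c'.R⟩⟩
noncomputable instance : SMul ℂ Coef := ⟨fun t c => ⟨t * c.p, t * c.m, t • c.u, t • c.v, t • c.R⟩⟩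

@[simp] theorem add_p (c c' : Coef) : (c + c').p = c.p + c'.p := rfl
@[simp] theorem add_m (c c' : Coef) : (c + c').m = c.m + c'.m := rfl
@[simp] theorem add_u (c c' : Coef) : (c + c').u = c.u + c'.u := rfl
@[simp] theorem add_v (c c' : Coef) : (c + c').v = c.v + c'.v := rfl
@[simp] theorem add_R (c c' : Coef) : (c + c').R = c.R + c'.R := rfl
@[simp] theorem smul_p (t : ℂ) (c : Coef) : (t • c).p = t * c.p := rfl
@[simp] theorem smul_m (t : ℂ) (c : Coef) : (t • c).m = t * c.m := rfl
@[simp] theorem smul_u (t : ℂ) (c : Coef) : (t • c).u = t • c.u := rfl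
@[simp] theorem smul_v (t : ℂ) (c : Coef) : (t • c).v = t • c.v := rfl
@[simp] theorem smul_R (t : ℂ) (c : Coef) : (t • c).R = t • c.R := rfl

end Coef

/-- The positive number `½√2`. -/
noncomputable def rt : ℂ := ((Real.sqrt 2 : ℝ) : ℂ) / 2

theorem rt_sq : rt ^ 2 = 1 / 2 := by
  have h : ((Real.sqrt 2 : ℝ) : ℂ) ^ 2 = 2 := by
    rw [← Complex.ofReal_pow, Real.sq_sqrt (by norm_num)]; norm_num
  rw [rt, div_pow, h]; norm_num

theorem IsRot.add {R S : Matrix (Fin 9) (Fin 9) ℂ} (hR : IsRot R) (hS : IsRot S) :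
    IsRot (R + S) where
  skew i j := by simp [hR.skew i j, hS.skew i j]; ring
  eq_zero i j h := by simp [hR.eq_zero i j h, hS.eq_zero i j h]

theorem IsRot.smul {R : Matrix (Fin 9) (Fin 9) ℂ} (t : ℂ) (hR : IsRot R) : IsRot (t • R) where
  skew i j := by simp [hR.skew i j]
  eq_zero i j h := by simp [hR.eq_zero i j h]

theorem IsRot.transpose {R : Matrix (Fin 9) (Fin 9) ℂ} (hR : IsRot R) : Rᵀ = -R := by
  ext i j
  simp [hR.skew i j]

theorem IsRot.bracket {R S : Matrix (Fin 9) (Fin 9) ℂ} (hR : IsRot R) (hS : IsRot S) :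
    IsRot (S * R - R * S) where
  skew i j := by
    have h : (S * R - R * S)ᵀ = -(S * R - R * S) := by
      rw [transpose_sub, transpose_mul, transpose_mul, hR.transpose, hS.transpose]
      noncomm_ring
    exact congrFun (congrFun h i) j
  eq_zero i j h := by
    simp only [Matrix.sub_apply, Matrix.mul_apply]
    rw [Finset.sum_eq_zero, Finset.sum_eq_zero, sub_zero] <;> intro k _ <;>
      by_cases hk : Params.block i = Params.block k
    · rw [hS.eq_zero k j (fun e => h (hk.trans e)), mul_zero]
    · rw [hR.eq_zero i k hk, zero_mul]
    · rw [hR.eq_zero k j (fun e => h (hk.trans e)), mul_zero]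
    · rw [hS.eq_zero i k hk, zero_mul]

theorem IsRot.dotProduct_mulVec {R : Matrix (Fin 9) (Fin 9) ℂ} (hR : IsRot R) (x y : Fin 9 → ℂ) :
    (R *ᵥ x) ⬝ᵥ y = -(x ⬝ᵥ R *ᵥ y) := by
  rw [Matrix.dotProduct_mulVec x, ← Matrix.mulVec_transpose, hR.transpose, neg_mulVec]
  simp

namespace Params
variable (P : Params)

/-- The numbers `k_i` with `s_i ξ = k_i γ_i γ₁₂₅ ξ` for `X⁻ ξ = 0`; they satisfy `k_i² = κ_i²`. -/
noncomputable def k : Fin 9 → ℂ := P.sEig 1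

theorem b_eq_k (i : Fin 9) : P.b i = -P.k i ^ 2 := P.b_eq i

theorem k_eq_of_block {i j : Fin 9} (h : block i = block j) : P.k i = P.k j :=
  P.sEig_eq_of_block 1 h

theorem b_eq_neg : P.b = -(P.k * P.k) := by
  funext i
  rw [b_eq_k, Pi.neg_apply, Pi.mul_apply, sq]

/-- The commutator of vector fields in `𝒦₀` in terms of coefficients. -/
noncomputable def br (c c' : Coef) : Coef where
  p := (P.b * c.v) ⬝ᵥ c'.u - (P.b * c.u) ⬝ᵥ c'.v
  m := 0
  u := c.m • (P.b * c'.v) - c'.m • (P.b * c.v) + c'.R *ᵥ c.u - c.R *ᵥ c'.u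
  v := c'.m • c.u - c.m • c'.u + c'.R *ᵥ c.v - c.R *ᵥ c'.v
  R := c'.R * c.R - c.R * c'.R

/-- The spinorial Lie derivative of `ξ(ξ₁, ξ₂)`, `X⁻ ξ₂ = 0`, along an element of `𝒦₀`, in terms of
`(ξ₁, ξ₂)`. -/
noncomputable def act (c : Coef) (ξ : (SV → ℂ) × (SV → ℂ)) : (SV → ℂ) × (SV → ℂ) :=
  (-c.m • P.cbar *ᵥ ξ.1 + rt • (cl (P.k * c.u) (gam125 *ᵥ ξ.2) - cl (P.b * c.v) ξ.2) + rot c.R ξ.1,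
    -c.m • P.d *ᵥ ξ.2 + rot c.R ξ.2)

/-- The odd-odd bracket in terms of `(ξ₁, ξ₂)` and `(η₁, η₂)`. -/
noncomputable def obr (ξ η : (SV → ℂ) × (SV → ℂ)) : Coef where
  p := 2 * rt * Complex.I * beta ξ.1 η.1
  m := 2 * rt * Complex.I * beta ξ.2 η.2
  u i := -Complex.I * (beta ξ.1 (gam i *ᵥ η.2) + beta η.1 (gam i *ᵥ ξ.2))
  v i := Complex.I * (P.k i)⁻¹ *
    (beta ξ.1 (gam i *ᵥ gam125 *ᵥ η.2) + beta η.1 (gam i *ᵥ gam125 *ᵥ ξ.2))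
  R := (-2 * rt * Complex.I) • P.rotBr ξ.2 η.2

variable {P}

theorem br_add_left (c c' c'' : Coef) : P.br (c + c') c'' = P.br c c'' + P.br c' c'' := by
  ext <;> simp [br, mulVec_add, add_mulVec, mul_add, add_mul, add_dotProduct] <;> ring

theorem br_add_right (c c' c'' : Coef) : P.br c'' (c + c') = P.br c'' c + P.br c'' c' := by
  ext <;> simp [br, mulVec_add, add_mulVec, mul_add, add_mul, dotProduct_add] <;> ring

theorem br_smul_left (t : ℂ) (c c' : Coef) : P.br (t • c) c' = t • P.br c c' := by
  ext <;> simp [br, mulVec_smul, smul_mulVec, mul_sub, mul_add] <;> ring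

theorem br_smul_right (t : ℂ) (c c' : Coef) : P.br c (t • c') = t • P.br c c' := by
  ext <;> simp [br, mulVec_smul, smul_mulVec, mul_sub, mul_add] <;> ring

theorem act_add_left (c c' : Coef) (ξ : (SV → ℂ) × (SV → ℂ)) :
    P.act (c + c') ξ = P.act c ξ + P.act c' ξ := by
  ext1
  · simp only [act, Coef.add_m, Coef.add_u, Coef.add_v, Coef.add_R, mul_add, cl_add_left,
      rot_add_left, Prod.mk_add_mk]
    module
  · simp only [act, Coef.add_m, Coef.add_R, rot_add_left, Prod.mk_add_mk]
    module

theorem act_smul_left (t : ℂ) (c : Coef) (ξ : (SV → ℂ) × (SV → ℂ)) :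
    P.act (t • c) ξ = t • P.act c ξ := by
  ext1
  · simp only [act, Coef.smul_m, Coef.smul_u, Coef.smul_v, Coef.smul_R, mul_smul_comm, cl_smul_left,
      rot_smul_left, Prod.smul_mk]
    module
  · simp only [act, Coef.smul_m, Coef.smul_R, rot_smul_left, Prod.smul_mk]
    module

theorem act_add_right (c : Coef) (ξ η : (SV → ℂ) × (SV → ℂ)) :
    P.act c (ξ + η) = P.act c ξ + P.act c η := by
  ext1
  · simp only [act, Prod.fst_add, Prod.snd_add, mulVec_add, cl_add, rot_add]
    module
  · simp only [act, Prod.fst_add, Prod.snd_add, mulVec_add, rot_add]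
    module

theorem act_smul_right (t : ℂ) (c : Coef) (ξ : (SV → ℂ) × (SV → ℂ)) :
    P.act c (t • ξ) = t • P.act c ξ := by
  ext1
  · simp only [act, Prod.smul_fst, Prod.smul_snd, mulVec_smul, cl_smul, rot_smul, Prod.smul_mk]
    module
  · simp only [act, Prod.smul_snd, mulVec_smul, rot_smul, Prod.smul_mk]
    module

theorem obr_add_left (ξ η ζ : (SV → ℂ) × (SV → ℂ)) :
    P.obr (ξ + η) ζ = P.obr ξ ζ + P.obr η ζ := by
  ext <;> simp only [obr, rotBr, Prod.fst_add, Prod.snd_add, beta_add_left, mulVec_add,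
    beta_add_right, Coef.add_p, Coef.add_m, Coef.add_u, Coef.add_v, Coef.add_R, Pi.add_apply,
    Matrix.add_apply, Matrix.smul_apply, of_apply, smul_eq_mul] <;> (try split_ifs) <;> ring

theorem obr_add_right (ξ η ζ : (SV → ℂ) × (SV → ℂ)) :
    P.obr ζ (ξ + η) = P.obr ζ ξ + P.obr ζ η := by
  ext <;> simp only [obr, rotBr, Prod.fst_add, Prod.snd_add, beta_add_left, mulVec_add,
    beta_add_right, Coef.add_p, Coef.add_m, Coef.add_u, Coef.add_v, Coef.add_R, Pi.add_apply,
    Matrix.add_apply, Matrix.smul_apply, of_apply, smul_eq_mul] <;> (try split_ifs) <;> ring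

theorem obr_smul_left (t : ℂ) (ξ η : (SV → ℂ) × (SV → ℂ)) :
    P.obr (t • ξ) η = t • P.obr ξ η := by
  ext <;> simp only [obr, rotBr, Prod.smul_fst, Prod.smul_snd, beta_smul_left, mulVec_smul,
    beta_smul_right, Coef.smul_p, Coef.smul_m, Coef.smul_u, Coef.smul_v, Coef.smul_R,
    Pi.smul_apply, Matrix.smul_apply, of_apply, smul_eq_mul] <;> (try split_ifs) <;> ring

theorem obr_smul_right (t : ℂ) (ξ η : (SV → ℂ) × (SV → ℂ)) :
    P.obr ξ (t • η) = t • P.obr ξ η := by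
  ext <;> simp only [obr, rotBr, Prod.smul_fst, Prod.smul_snd, beta_smul_left, mulVec_smul,
    beta_smul_right, Coef.smul_p, Coef.smul_m, Coef.smul_u, Coef.smul_v, Coef.smul_R,
    Pi.smul_apply, Matrix.smul_apply, of_apply, smul_eq_mul] <;> (try split_ifs) <;> ring

theorem k_mul_mulVec {R : Matrix (Fin 9) (Fin 9) ℂ} (hR : IsRot R) (x : Fin 9 → ℂ) :
    R *ᵥ (P.k * x) = P.k * R *ᵥ x :=
  hR.mulVec_mul (fun _ _ h => P.k_eq_of_block h) x

theorem b_mul_mulVec {R : Matrix (Fin 9) (Fin 9) ℂ} (hR : IsRot R) (x : Fin 9 → ℂ) :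
    R *ᵥ (P.b * x) = P.b * R *ᵥ x :=
  hR.mulVec_mul (fun _ _ h => P.b_eq_of_block h) x

/-- The Jacobi identity for the coefficients of vector fields. -/
theorem br_jacobi {c c' c'' : Coef} (h : IsRot c.R) (h' : IsRot c'.R) (h'' : IsRot c''.R) :
    P.br c (P.br c' c'') + P.br c'' (P.br c c') + P.br c' (P.br c'' c) = ⟨0, 0, 0, 0, 0⟩ := by
  have hp : ∀ {R : Matrix (Fin 9) (Fin 9) ℂ} (_ : IsRot R) (x y : Fin 9 → ℂ),
      (P.b * x) ⬝ᵥ R *ᵥ y = -((P.b * y) ⬝ᵥ R *ᵥ x) := by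
    intro R hR x y
    have hb : ∀ x y : Fin 9 → ℂ, (P.b * x) ⬝ᵥ y = x ⬝ᵥ (P.b * y) := by
      intro x y
      simp only [dotProduct, Pi.mul_apply]
      exact Finset.sum_congr rfl fun i _ => by ring
    rw [← hR.dotProduct_mulVec (P.b * y) x, b_mul_mulVec hR, hb (R *ᵥ y), dotProduct_comm]
  have hb2 : ∀ x y : Fin 9 → ℂ, (P.b * x) ⬝ᵥ (P.b * y) = (P.b * y) ⬝ᵥ (P.b * x) :=
    fun x y => dotProduct_comm _ _
  have hb3 : ∀ x y : Fin 9 → ℂ, (P.b * x) ⬝ᵥ y = (P.b * y) ⬝ᵥ x := by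
    intro x y
    simp only [dotProduct, Pi.mul_apply]
    exact Finset.sum_congr rfl fun i _ => by ring
  refine Coef.ext ?_ ?_ ?_ ?_ ?_
  · simp only [br, Coef.add_p, dotProduct_add, dotProduct_sub, dotProduct_smul, smul_eq_mul]
    linear_combination hp h'' c.v c'.u - hp h'' c.u c'.v + hp h c'.v c''.u - hp h c'.u c''.v
      + hp h' c''.v c.u - hp h' c''.u c.v
      + c'.m * (hb2 c.v c''.v + hb3 c.u c''.u) + c''.m * (hb2 c'.v c.v + hb3 c'.u c.u)
      + c.m * (hb2 c''.v c'.v + hb3 c''.u c'.u)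
  · simp [br]
  · simp only [br, Coef.add_u, mulVec_add, mulVec_sub, mulVec_smul, sub_mulVec, b_mul_mulVec h,
      b_mul_mulVec h', b_mul_mulVec h'', ← mulVec_mulVec]
    funext i
    simp only [Pi.add_apply, Pi.sub_apply, Pi.smul_apply, Pi.mul_apply, smul_eq_mul, Pi.zero_apply]
    ring
  · simp only [br, Coef.add_v, mulVec_add, mulVec_sub, mulVec_smul, sub_mulVec, b_mul_mulVec h,
      b_mul_mulVec h', b_mul_mulVec h'', ← mulVec_mulVec]
    funext i
    simp only [Pi.add_apply, Pi.sub_apply, Pi.smul_apply, Pi.mul_apply, smul_eq_mul, Pi.zero_apply]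
    ring
  · simp only [br, Coef.add_R]
    noncomm_ring

/-! ### The representation and the equivariance of the odd-odd bracket -/

theorem chi_act {c : Coef} (h : IsRot c.R) {ξ : (SV → ℂ) × (SV → ℂ)} (hξ : gam1234 *ᵥ ξ.2 = ξ.2) :
    gam1234 *ᵥ (P.act c ξ).2 = (P.act c ξ).2 := by
  have h1 : gam1234 *ᵥ ξ.2 = (1 : ℂ) • ξ.2 := by rw [hξ, one_smul]
  simp only [act, mulVec_add, mulVec_smul, gam1234_rot h, hξ, P.d_of_chi h1, chi_gam125 h1,
    one_smul]

theorem cbar_cl {ξ : SV → ℂ} (h : gam1234 *ᵥ ξ = ξ) (x : Fin 9 → ℂ) :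
    P.cbar *ᵥ cl x ξ = cl (P.k * x) (gam125 *ᵥ ξ) + P.dEig 1 • cl x (gam125 *ᵥ ξ) := by
  have h1 : gam1234 *ᵥ ξ = (1 : ℂ) • ξ := by rw [h, one_smul]
  simp only [cl, Matrix.mulVec_sum, mulVec_smul, P.cbar_gam h1, Finset.smul_sum,
    ← Finset.sum_add_distrib, Pi.mul_apply, k, sEig]
  exact Finset.sum_congr rfl fun i _ => by module

/-- `act` is a representation on the pairs `(ξ₁, ξ₂)` with `X⁻ ξ₂ = 0`. -/
theorem act_br {c c' : Coef} (h : IsRot c.R) (h' : IsRot c'.R) {ξ : (SV → ℂ) × (SV → ℂ)}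
    (hξ : gam1234 *ᵥ ξ.2 = ξ.2) :
    P.act (P.br c c') ξ = P.act c (P.act c' ξ) - P.act c' (P.act c ξ) := by
  have h1 : gam1234 *ᵥ ξ.2 = (1 : ℂ) • ξ.2 := by rw [hξ, one_smul]
  have hG : gam1234 *ᵥ gam125 *ᵥ ξ.2 = gam125 *ᵥ ξ.2 := by rw [gam1234_gam125, hξ]
  have hu : cl (P.k * (P.br c c').u) (gam125 *ᵥ ξ.2)
      = c.m • cl (P.k * (P.b * c'.v)) (gam125 *ᵥ ξ.2)
        - c'.m • cl (P.k * (P.b * c.v)) (gam125 *ᵥ ξ.2)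
        + cl (c'.R *ᵥ (P.k * c.u)) (gam125 *ᵥ ξ.2) - cl (c.R *ᵥ (P.k * c'.u)) (gam125 *ᵥ ξ.2) := by
    simp only [br, mul_add, mul_sub, mul_smul_comm, cl_add_left, cl_sub_left, cl_smul_left,
      k_mul_mulVec h, k_mul_mulVec h']
  have hv : cl (P.b * (P.br c c').v) ξ.2
      = c.m • cl (P.k * (P.k * c'.u)) ξ.2 - c'.m • cl (P.k * (P.k * c.u)) ξ.2
        + cl (c'.R *ᵥ (P.b * c.v)) ξ.2 - cl (c.R *ᵥ (P.b * c'.v)) ξ.2 := by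
    have hbk : ∀ x, P.b * x = -(P.k * (P.k * x)) := fun x => by rw [b_eq_neg, neg_mul, mul_assoc]
    have h3 : P.b * (P.br c c').v = c.m • (P.k * (P.k * c'.u)) - c'.m • (P.k * (P.k * c.u))
        + c'.R *ᵥ (P.b * c.v) - c.R *ᵥ (P.b * c'.v) := by
      simp only [br, mul_add, mul_sub, mul_smul_comm, b_mul_mulVec h, b_mul_mulVec h', hbk c.u,
        hbk c'.u, smul_neg]
      abel
    rw [h3]
    simp only [cl_add_left, cl_sub_left, cl_smul_left]
  refine Prod.ext ?_ ?_
  · simp only [act, Prod.fst_sub, hu, hv]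
    simp only [br, mulVec_add, mulVec_sub, mulVec_smul, cl_add, cl_smul, rot_add, rot_sub, rot_smul,
      cbar_cl hξ, cbar_cl hG, P.d_of_chi h1, gam125_gam125, gam125_rot h, gam125_rot h',
      rot_cl h, rot_cl h', cbar_rot P h, cbar_rot P h', rot_rot h c'.R, smul_add, smul_sub,
        neg_zero,
      zero_smul]
    module
  · simp only [act, Prod.snd_sub]
    simp only [br, mulVec_add, mulVec_smul, rot_add, rot_smul, d_rot P h, d_rot P h',
      rot_rot h c'.R, neg_zero, zero_smul]
    module

end Params
namespace Params
variable {P : Params}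

/-! ### The rotation part of the odd-odd bracket -/

theorem beta_gam_gam_gam125 (ξ η : SV → ℂ) (i j : Fin 9) :
    beta (gam j *ᵥ gam125 *ᵥ ξ) (gam i *ᵥ η) =
      -(eps i * eps j) * beta ξ (gam j *ᵥ gam i *ᵥ gam125 *ᵥ η) := by
  rw [beta_gam, beta_gam125, gam125_gam, gam125_gam, mulVec_smul, smul_smul,
    beta_smul_right]
  ring

/-- The symmetrisation of `γ_i γ_j γ₁₂₅` on the `+1`-eigenspace of `γ₁γ₂γ₃γ₄` vanishes unless `i`
and `j` lie in the same block. -/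
theorem beta_gam_gam125_symm {ξ η : SV → ℂ} (hξ : gam1234 *ᵥ ξ = ξ) (hη : gam1234 *ᵥ η = η)
    (i j : Fin 9) :
    beta (gam j *ᵥ gam125 *ᵥ ξ) (gam i *ᵥ η) + beta (gam j *ᵥ gam125 *ᵥ η) (gam i *ᵥ ξ) =
      if block i = block j then beta ξ (gam i *ᵥ gam j *ᵥ gam125 *ᵥ η)
        - beta ξ (gam j *ᵥ gam i *ᵥ gam125 *ᵥ η) else 0 := by
  have h1 : gam1234 *ᵥ ξ = (1 : ℂ) • ξ := by rw [hξ, one_smul]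
  have h2 : gam1234 *ᵥ η = (1 : ℂ) • η := by rw [hη, one_smul]
  have e2 : beta (gam j *ᵥ gam125 *ᵥ η) (gam i *ᵥ ξ)
      = beta ξ (gam i *ᵥ gam j *ᵥ gam125 *ᵥ η) := by
    rw [beta_comm, beta_gam]
  split_ifs with hb
  · rw [beta_gam_gam_gam125, e2, eps_eq_of_block hb, eps_mul_self]
    ring
  · by_cases hh : hsgn i = hsgn j
    · have he : eps i ≠ eps j := fun he => hb (block_eq_of_signs he hh)
      have he' : eps i * eps j = -1 := by
        have h3 : (eps i - eps j) * (eps i * eps j + 1) = 0 := by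
          linear_combination eps j * eps_mul_self i - eps i * eps_mul_self j
        exact eq_neg_of_add_eq_zero_left ((mul_eq_zero.1 h3).resolve_left (sub_ne_zero.2 he))
      have hij : j ≠ i := fun e => hb (by rw [e])
      rw [beta_gam_gam_gam125, e2, he', gam_gam_of_ne hij, beta_neg_right]
      ring
    · rw [beta_eq_zero_of_chi (chi_gam (chi_gam125 h1) j) (chi_gam h2 i),
        beta_eq_zero_of_chi (chi_gam (chi_gam125 h2) j) (chi_gam h1 i), add_zero] <;>
      · rw [mul_one, mul_one]
        exact fun e => hh e.symm

theorem beta_gam_gam_symm (ξ η : SV → ℂ) (i j : Fin 9) :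
    beta (gam j *ᵥ ξ) (gam i *ᵥ η) + beta (gam j *ᵥ η) (gam i *ᵥ ξ)
      = if i = j then -2 * beta ξ η else 0 := by
  rw [beta_comm (gam j *ᵥ η), beta_gam, beta_gam, ← beta_add_right, add_comm, gam_anticomm,
    beta_smul_right]
  split_ifs <;> ring

theorem beta_gam125_gam125 (ξ η : SV → ℂ) : beta (gam125 *ᵥ ξ) (gam125 *ᵥ η) = -beta ξ η := by
  rw [beta_gam125, gam125_gam125]

theorem rotBr_comm {ξ η : SV → ℂ} : P.rotBr ξ η = P.rotBr η ξ := by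
  ext i j
  simp only [rotBr, of_apply]
  split_ifs with hb
  · have h := beta_gam_gam_gam125 ξ η i j
    have h' := beta_gam_gam_gam125 ξ η j i
    have e : ∀ i j : Fin 9, beta (gam j *ᵥ gam125 *ᵥ ξ) (gam i *ᵥ η)
        = beta η (gam i *ᵥ gam j *ᵥ gam125 *ᵥ ξ) := fun i j => by rw [beta_comm, beta_gam]
    rw [e, eps_eq_of_block hb, eps_mul_self] at h h'
    rw [h, h']
    ring
  · rfl

theorem obr_comm (ξ η : (SV → ℂ) × (SV → ℂ)) : P.obr ξ η = P.obr η ξ := by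
  simp only [obr, beta_comm ξ.1 η.1, beta_comm ξ.2 η.2, rotBr_comm (ξ := ξ.2) (η := η.2), add_comm]

theorem isRot_rotBr (ξ η : SV → ℂ) : IsRot (P.rotBr ξ η) where
  skew i j := by
    simp only [rotBr, of_apply, eq_comm (a := block j)]
    split_ifs with hb
    · rw [P.sEig_eq_of_block 1 hb]; ring
    · ring
  eq_zero i j h := by simp [rotBr, h]

theorem isRot_obr (ξ η : (SV → ℂ) × (SV → ℂ)) : IsRot (P.obr ξ η).R :=
  (isRot_rotBr _ _).smul _

/-- The action of `rot R` on both arguments of `rotBr`. -/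
theorem rotBr_rot {R : Matrix (Fin 9) (Fin 9) ℂ} (hR : IsRot R) (ξ η : SV → ℂ) :
    P.rotBr (rot R ξ) η + P.rotBr ξ (rot R η) = P.rotBr ξ η * R - R * P.rotBr ξ η := by
  set F : Matrix (Fin 9) (Fin 9) ℂ := of fun i j => beta ξ (gam i *ᵥ gam j *ᵥ gam125 *ᵥ η) with hF
  have hFR : ∀ i j, beta (rot R ξ) (gam i *ᵥ gam j *ᵥ gam125 *ᵥ η)
      + beta ξ (gam i *ᵥ gam j *ᵥ gam125 *ᵥ rot R η)
      = ∑ k, (F i k * R k j + R k i * F k j) := by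
    intro i j
    rw [beta_rot hR, rot_gam hR, rot_gam hR, gam125_rot hR, Finset.sum_add_distrib]
    simp only [mulVec_sub, Matrix.mulVec_sum, mulVec_smul, beta_sub_right, beta_sum_right,
      beta_smul_right, hF, of_apply, mul_comm (R _ j)]
    ring
  ext i j
  simp only [Matrix.sub_apply, Matrix.mul_apply, Matrix.add_apply, ← Finset.sum_sub_distrib]
  by_cases hb : block i = block j
  · have e : ∀ k, P.rotBr ξ η i k * R k j - R i k * P.rotBr ξ η k j
        = P.sEig 1 i / 2 * ((F i k * R k j + R k i * F k j)
          - (F j k * R k i + R k j * F k i)) := by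
      intro k
      rw [hR.skew i k]
      by_cases hk : block i = block k
      · have hk' : block k = block j := hk.symm.trans hb
        simp only [rotBr, of_apply, hk, hk', if_true, hF, P.sEig_eq_of_block 1 hk]
        ring
      · rw [hR.eq_zero i k hk, hR.eq_zero k j (fun e => hk (hb.trans e.symm))]
        ring
    simp only [e, ← Finset.mul_sum, Finset.sum_sub_distrib, ← hFR]
    simp only [rotBr, of_apply, hb, if_true]
    ring
  · simp only [rotBr, of_apply, hb, if_false, add_zero]
    refine (Finset.sum_eq_zero fun k _ => ?_).symm
    by_cases hk : block i = block k
    · have hk' : block k ≠ block j := fun e => hb (hk.trans e)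
      simp [hk', hR.eq_zero k j hk']
    · simp [hk, hR.eq_zero i k hk]

theorem rotBr_add_left (ξ ξ' η : SV → ℂ) : P.rotBr (ξ + ξ') η = P.rotBr ξ η + P.rotBr ξ' η := by
  ext i j
  simp only [rotBr, of_apply, Matrix.add_apply, beta_add_left]
  split_ifs <;> ring

theorem rotBr_smul_left (t : ℂ) (ξ η : SV → ℂ) : P.rotBr (t • ξ) η = t • P.rotBr ξ η := by
  ext i j
  simp only [rotBr, of_apply, Matrix.smul_apply, beta_smul_left, smul_eq_mul]
  split_ifs <;> ring

theorem rotBr_add_right (ξ η η' : SV → ℂ) : P.rotBr ξ (η + η') = P.rotBr ξ η + P.rotBr ξ η' := by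
  rw [rotBr_comm, rotBr_add_left, rotBr_comm (ξ := η), rotBr_comm (ξ := η')]

theorem rotBr_smul_right (t : ℂ) (ξ η : SV → ℂ) : P.rotBr ξ (t • η) = t • P.rotBr ξ η := by
  rw [rotBr_comm, rotBr_smul_left, rotBr_comm]

theorem rotBr_gam125 (ξ η : SV → ℂ) :
    P.rotBr (gam125 *ᵥ ξ) η + P.rotBr ξ (gam125 *ᵥ η) = 0 := by
  ext i j
  simp only [rotBr, of_apply, Matrix.add_apply, Matrix.zero_apply, gam125_gam125]
  split_ifs with hb
  · simp only [beta_gam125, gam125_gam, mulVec_smul, beta_smul_right, gam125_gam125,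
      eps_eq_of_block hb]
    linear_combination P.sEig 1 i / 2 * (beta ξ (gam j *ᵥ gam i *ᵥ η)
      - beta ξ (gam i *ᵥ gam j *ᵥ η)) * eps_mul_self j
  · ring

theorem beta_cl_gam125 {ξ η : SV → ℂ} (hξ : gam1234 *ᵥ ξ = ξ) (hη : gam1234 *ᵥ η = η)
    (x : Fin 9 → ℂ) (i : Fin 9) :
    beta (cl (P.k * x) (gam125 *ᵥ ξ)) (gam i *ᵥ η) + beta (cl (P.k * x) (gam125 *ᵥ η)) (gam i *ᵥ ξ)
      = 2 * (P.rotBr ξ η *ᵥ x) i := by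
  simp only [cl, beta_sum_left, beta_smul_left, mulVec, dotProduct, Finset.mul_sum,
    ← Finset.sum_add_distrib, ← mul_add, beta_gam_gam125_symm hξ hη, rotBr, of_apply]
  refine Finset.sum_congr rfl fun j _ => ?_
  split_ifs with hb
  · rw [Pi.mul_apply, ← P.k_eq_of_block hb, k]; ring
  · ring

theorem beta_cl_gam (ξ η : SV → ℂ) (x : Fin 9 → ℂ) (i : Fin 9) :
    beta (cl x ξ) (gam i *ᵥ η) + beta (cl x η) (gam i *ᵥ ξ) = -2 * x i * beta ξ η := by
  simp only [cl, beta_sum_left, beta_smul_left, ← Finset.sum_add_distrib, ← mul_add,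
    beta_gam_gam_symm, mul_ite, mul_zero, Finset.sum_ite_eq, Finset.mem_univ, if_true]
  ring

theorem beta_cl_gam_gam125 {ξ η : SV → ℂ} (hξ : gam1234 *ᵥ ξ = ξ) (hη : gam1234 *ᵥ η = η)
    (x : Fin 9 → ℂ) (i : Fin 9) :
    beta (cl (P.b * x) ξ) (gam i *ᵥ gam125 *ᵥ η) + beta (cl (P.b * x) η) (gam i *ᵥ gam125 *ᵥ ξ)
      = 2 * P.k i * (P.rotBr ξ η *ᵥ x) i := by
  have h : ∀ j, beta (gam j *ᵥ ξ) (gam i *ᵥ gam125 *ᵥ η) + beta (gam j *ᵥ η) (gam i *ᵥ gam125 *ᵥ ξ)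
      = if block i = block j then beta ξ (gam j *ᵥ gam i *ᵥ gam125 *ᵥ η)
        - beta ξ (gam i *ᵥ gam j *ᵥ gam125 *ᵥ η) else 0 := by
    intro j
    rw [beta_comm, beta_comm (gam j *ᵥ η), add_comm, beta_gam_gam125_symm hξ hη]
    simp only [eq_comm]
  simp only [cl, beta_sum_left, beta_smul_left, mulVec, dotProduct, Finset.mul_sum,
    ← Finset.sum_add_distrib, ← mul_add, h, rotBr, of_apply]
  refine Finset.sum_congr rfl fun j _ => ?_
  split_ifs with hb
  · rw [Pi.mul_apply, ← P.b_eq_of_block hb, b_eq_k, k]; ring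
  · ring

theorem beta_rot_gam {R : Matrix (Fin 9) (Fin 9) ℂ} (hR : IsRot R) (ξ η : SV → ℂ) (i : Fin 9) :
    beta (rot R ξ) (gam i *ᵥ η) + beta ξ (gam i *ᵥ rot R η)
      = -∑ j, R i j * beta ξ (gam j *ᵥ η) := by
  have h : ∑ j, R j i * beta ξ (gam j *ᵥ η) = -∑ j, R i j * beta ξ (gam j *ᵥ η) := by
    rw [← Finset.sum_neg_distrib]
    exact Finset.sum_congr rfl fun j _ => by rw [hR.skew i j, neg_mul]
  rw [beta_rot hR, rot_gam hR, beta_sub_right, beta_sum_right]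
  simp only [beta_smul_right, h]
  ring

/-- The odd-odd bracket is equivariant. -/
theorem obr_act (hk : ∀ i, P.k i ≠ 0) {c : Coef} (h : IsRot c.R) {ξ η : (SV → ℂ) × (SV → ℂ)}
    (hξ : gam1234 *ᵥ ξ.2 = ξ.2) (hη : gam1234 *ᵥ η.2 = η.2) :
    P.obr (P.act c ξ) η + P.obr ξ (P.act c η) = P.br c (P.obr ξ η) := by
  have h1 : gam1234 *ᵥ ξ.2 = (1 : ℂ) • ξ.2 := by rw [hξ, one_smul]
  have h2 : gam1234 *ᵥ η.2 = (1 : ℂ) • η.2 := by rw [hη, one_smul]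
  have hc : ∀ i, P.cEig 1 i = P.k i + P.dEig 1 := fun i => by rw [k, sEig]; ring
  refine Coef.ext ?_ ?_ ?_ ?_ ?_
  · have hU : (P.b * c.v) ⬝ᵥ (P.obr ξ η).u
        = -Complex.I * (beta ξ.1 (cl (P.b * c.v) η.2) + beta η.1 (cl (P.b * c.v) ξ.2)) := by
      simp only [obr, dotProduct, beta_cl_right, ← Finset.sum_add_distrib, Finset.mul_sum]
      exact Finset.sum_congr rfl fun i _ => by ring
    have hV : (P.b * c.u) ⬝ᵥ (P.obr ξ η).v
        = -Complex.I * (beta ξ.1 (cl (P.k * c.u) (gam125 *ᵥ η.2))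
          + beta η.1 (cl (P.k * c.u) (gam125 *ᵥ ξ.2))) := by
      simp only [obr, dotProduct, beta_cl_right, ← Finset.sum_add_distrib, Finset.mul_sum]
      refine Finset.sum_congr rfl fun i _ => ?_
      have := hk i
      simp only [Pi.mul_apply, b_eq_k]
      field_simp
    simp only [br, hU, hV]
    simp only [obr, act, Coef.add_p, beta_add_left, beta_add_right, beta_smul_left, beta_smul_right,
      beta_sub_left, beta_sub_right, beta_rot h, beta_cbar, beta_cl, beta_comm ξ.2,
        beta_comm (gam125 *ᵥ ξ.2)]
    linear_combination (2 * Complex.I * (beta η.1 (cl (P.k * c.u) (gam125 *ᵥ ξ.2))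
      - beta η.1 (cl (P.b * c.v) ξ.2) + beta ξ.1 (cl (P.k * c.u) (gam125 *ᵥ η.2))
      - beta ξ.1 (cl (P.b * c.v) η.2))) * rt_sq
  · simp only [obr, act, Coef.add_m, beta_add_left, beta_add_right, beta_smul_left, beta_smul_right,
      beta_rot h, beta_d]
    simp only [br]
    ring
  · funext i
    have q1 := beta_cl_gam125 (P := P) hξ hη c.u i
    have q2 := beta_cl_gam ξ.2 η.2 (P.b * c.v) i
    have r1 := beta_rot_gam h ξ.1 η.2 i
    have r2 := beta_rot_gam h η.1 ξ.2 i
    simp only [obr, act, Coef.add_u, Pi.add_apply, beta_add_left, beta_smul_left, beta_sub_left,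
      mulVec_add, mulVec_smul, beta_add_right, beta_smul_right, beta_cbar, P.cbar_gam h1,
      P.cbar_gam h2, P.d_of_chi h1, P.d_of_chi h2, hc]
    simp only [br, Pi.add_apply, Pi.sub_apply, Pi.smul_apply, Pi.mul_apply, smul_mulVec,
      smul_eq_mul,
      b_eq_k]
    have hR : (c.R *ᵥ fun i => -Complex.I * (beta ξ.1 (gam i *ᵥ η.2) + beta η.1 (gam i *ᵥ ξ.2))) i
        = -Complex.I * (∑ j, c.R i j * beta ξ.1 (gam j *ᵥ η.2)
          + ∑ j, c.R i j * beta η.1 (gam j *ᵥ ξ.2)) := by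
      simp only [mulVec, dotProduct, ← Finset.sum_add_distrib, Finset.mul_sum]
      exact Finset.sum_congr rfl fun j _ => by ring
    rw [Pi.mul_apply, b_eq_k] at q2
    rw [hR]
    linear_combination -Complex.I * rt * q1 + Complex.I * rt * q2 - Complex.I * r1
      - Complex.I * r2 + Complex.I * c.m * P.k i * (beta ξ.1 (gam i *ᵥ gam125 *ᵥ η.2)
        + beta η.1 (gam i *ᵥ gam125 *ᵥ ξ.2)) * mul_inv_cancel₀ (hk i)
  · funext i
    have hξ' : gam1234 *ᵥ gam125 *ᵥ ξ.2 = gam125 *ᵥ ξ.2 := by rw [gam1234_gam125, hξ]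
    have hη' : gam1234 *ᵥ gam125 *ᵥ η.2 = gam125 *ᵥ η.2 := by rw [gam1234_gam125, hη]
    have q1 := beta_cl_gam (gam125 *ᵥ ξ.2) (gam125 *ᵥ η.2) (P.k * c.u) i
    have q2 := beta_cl_gam_gam125 (P := P) hξ hη c.v i
    have r1 := beta_rot_gam h ξ.1 (gam125 *ᵥ η.2) i
    have r2 := beta_rot_gam h η.1 (gam125 *ᵥ ξ.2) i
    rw [beta_gam125_gam125, Pi.mul_apply] at q1
    have e : ∀ ζ : SV → ℂ, gam1234 *ᵥ ζ = (1 : ℂ) • ζ → ∀ j,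
        P.cbar *ᵥ gam j *ᵥ gam125 *ᵥ ζ = (P.k j + P.dEig 1) • gam j *ᵥ ζ := fun ζ hζ j => by
      rw [P.cbar_gam (chi_gam125 hζ), hc, gam125_gam125]
    simp only [obr, act, Coef.add_v, Pi.add_apply, beta_add_left, beta_smul_left, beta_sub_left,
      mulVec_add, mulVec_smul, beta_add_right, beta_smul_right, beta_cbar, e ξ.2 h1,
      e η.2 h2, P.d_of_chi h1, P.d_of_chi h2, gam125_gam125, gam125_rot h]
    simp only [br, Pi.add_apply, Pi.sub_apply, Pi.smul_apply, smul_mulVec, smul_eq_mul]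
    have hR : (c.R *ᵥ fun i => Complex.I * (P.k i)⁻¹ * (beta ξ.1 (gam i *ᵥ gam125 *ᵥ η.2)
          + beta η.1 (gam i *ᵥ gam125 *ᵥ ξ.2))) i
        = Complex.I * (P.k i)⁻¹ * (∑ j, c.R i j * beta ξ.1 (gam j *ᵥ gam125 *ᵥ η.2)
          + ∑ j, c.R i j * beta η.1 (gam j *ᵥ gam125 *ᵥ ξ.2)) := by
      simp only [mulVec, dotProduct, ← Finset.sum_add_distrib, Finset.mul_sum]
      refine Finset.sum_congr rfl fun j _ => ?_
      by_cases hb : block i = block j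
      · rw [P.k_eq_of_block hb]; ring
      · rw [h.eq_zero i j hb]; ring
    rw [hR]
    linear_combination Complex.I * (P.k i)⁻¹ * (rt * q1 - rt * q2 + r1 + r2)
      + (Complex.I * c.m * (beta ξ.1 (gam i *ᵥ η.2) + beta η.1 (gam i *ᵥ ξ.2))
        + 2 * rt * Complex.I * c.u i * beta ξ.2 η.2
        - 2 * rt * Complex.I * (P.rotBr ξ.2 η.2 *ᵥ c.v) i) * mul_inv_cancel₀ (hk i)
  · have e : ∀ ζ : (SV → ℂ) × (SV → ℂ), gam1234 *ᵥ ζ.2 = (1 : ℂ) • ζ.2 → (P.act c ζ).2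
        = (-c.m * P.dEig 1) • gam125 *ᵥ ζ.2 + rot c.R ζ.2 := fun ζ hζ => by
      rw [act, P.d_of_chi hζ, smul_smul]
    have e1 := rotBr_rot (P := P) h ξ.2 η.2
    have e2 := rotBr_gam125 (P := P) ξ.2 η.2
    simp only [obr, Coef.add_R, e ξ h1, e η h2, rotBr_add_left, rotBr_add_right, rotBr_smul_left,
      rotBr_smul_right, br, Matrix.smul_mul, Matrix.mul_smul]
    rw [← smul_sub, ← e1]
    rw [eq_neg_of_add_eq_zero_right e2]
    module

/-! ### The Jacobi identity for three odd elements -/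

/-- A trilinear map that is symmetric in its first two arguments and vanishes on the diagonal has
vanishing cyclic sums. -/
theorem cyclic_sum_eq_zero {M N : Type*} [AddCommGroup M] [AddCommGroup N] [Module ℂ N]
    (g : M → M → M → N) (h1 : ∀ x x' y z, g (x + x') y z = g x y z + g x' y z)
    (h2 : ∀ x y y' z, g x (y + y') z = g x y z + g x y' z)
    (h3 : ∀ x y z z', g x y (z + z') = g x y z + g x y z') (hs : ∀ x y z, g x y z = g y x z)
    (S : AddSubmonoid M) (h0 : ∀ x ∈ S, g x x x = 0) {x y z : M} (hx : x ∈ S) (hy : y ∈ S)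
    (hz : z ∈ S) : g y z x + g x y z + g z x y = 0 := by
  have e1 := h0 _ (S.add_mem (S.add_mem hx hy) hz)
  have e2 := h0 _ (S.add_mem hx hy)
  have e3 := h0 _ (S.add_mem hx hz)
  have e4 := h0 _ (S.add_mem hy hz)
  have e5 := h0 _ hx
  have e6 := h0 _ hy
  have e7 := h0 _ hz
  simp only [h1, h2, h3, hs y x, hs z x, hs z y] at e1 e2 e3 e4 e5 e6 e7 ⊢
  have : (2 : ℂ) • (g y z x + g x y z + g x z y) = 0 := by
    linear_combination (norm := module) e1 - e2 - e3 - e4 + e5 + e6 + e7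
  exact (smul_eq_zero.1 this).resolve_left two_ne_zero

/-- The `S⁺`-component of `[{ξ, ξ}, ξ]` is the left-hand side of `fierz_plus`. -/
theorem act_obr_snd (ξ : (SV → ℂ) × (SV → ℂ)) : (P.act (P.obr ξ ξ) ξ).2
    = (-2 * rt * Complex.I) • (beta ξ.2 ξ.2 • P.d *ᵥ ξ.2 + rot (P.rotBr ξ.2 ξ.2) ξ.2) := by
  simp only [act, obr, rot_smul_left]
  module

/-- The `S⁻`-component of `[{ξ, ξ}, ξ]` is the left-hand side of `fierz_minus`. -/
theorem act_obr_fst (hk : ∀ i, P.k i ≠ 0) (ξ : (SV → ℂ) × (SV → ℂ)) : (P.act (P.obr ξ ξ) ξ).1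
    = (-2 * rt * Complex.I) • (beta ξ.2 ξ.2 • P.cbar *ᵥ ξ.1
      + ∑ i, ((P.sEig 1 i * beta ξ.1 (gam i *ᵥ ξ.2)) • gam i *ᵥ gam125 *ᵥ ξ.2
        - (P.sEig 1 i * beta ξ.1 (gam i *ᵥ gam125 *ᵥ ξ.2)) • gam i *ᵥ ξ.2)
      + rot (P.rotBr ξ.2 ξ.2) ξ.1) := by
  have e : cl (P.k * (P.obr ξ ξ).u) (gam125 *ᵥ ξ.2) - cl (P.b * (P.obr ξ ξ).v) ξ.2
      = (-2 * Complex.I) • ∑ i, ((P.sEig 1 i * beta ξ.1 (gam i *ᵥ ξ.2)) • gam i *ᵥ gam125 *ᵥ ξ.2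
        - (P.sEig 1 i * beta ξ.1 (gam i *ᵥ gam125 *ᵥ ξ.2)) • gam i *ᵥ ξ.2) := by
    simp only [cl, ← Finset.sum_sub_distrib, Finset.smul_sum]
    refine Finset.sum_congr rfl fun i _ => ?_
    have h : P.b i * (P.obr ξ ξ).v i
        = -2 * Complex.I * P.k i * beta ξ.1 (gam i *ᵥ gam125 *ᵥ ξ.2) := by
      have := hk i
      simp only [obr, b_eq_k]
      field_simp
      ring
    rw [Pi.mul_apply, Pi.mul_apply, h]
    simp only [obr, k]
    module
  rw [act, e]
  simp only [obr, rot_smul_left]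
  module

/-- The Jacobi identity for three equal odd elements holds exactly if `α₊ = -3 α₊'`. -/
theorem act_obr_eq_zero_iff (hk : ∀ i, P.k i ≠ 0) :
    (∀ ξ : (SV → ℂ) × (SV → ℂ), gam1234 *ᵥ ξ.2 = ξ.2 → P.act (P.obr ξ ξ) ξ = 0)
      ↔ P.ap = -3 * P.ap' := by
  constructor
  · intro h
    refine P.eq_of_fierz_plus fun ξ hξ => ?_
    have h' := congrArg Prod.snd (h (0, ξ) hξ)
    rw [act_obr_snd] at h'
    refine (smul_eq_zero.1 h').resolve_left ?_
    have : rt ≠ 0 := fun h0 => by have := rt_sq; norm_num [h0] at this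
    simp [this]
  · intro hP ξ hξ
    refine Prod.ext ?_ ?_
    · rw [act_obr_fst hk, P.fierz_minus hP hξ, smul_zero, Prod.fst_zero]
    · rw [act_obr_snd, P.fierz_plus hP hξ, smul_zero, Prod.snd_zero]

end Params

/-! ### The Levi-Civita connection -/

/-- A partial derivative is the derivative along a coordinate line. -/
theorem pderiv_eq {E : Type*} [NormedAddCommGroup E] [NormedSpace ℝ E] {μ : Idx} {f : Pt → E}
    {x : Pt} {v : E} (hf : DifferentiableAt ℝ f x)
    (h : HasDerivAt (fun t : ℝ => f (x + t • Pi.single μ 1)) v 0) : pderiv μ f x = v := by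
  have h1 : HasDerivAt (fun t : ℝ => x + t • (Pi.single μ 1 : Pt)) (Pi.single μ 1) 0 := by
    simpa using ((hasDerivAt_id (0 : ℝ)).smul_const (Pi.single μ 1 : Pt)).const_add x
  have h2 : HasFDerivAt f (fderiv ℝ f x) (x + (0 : ℝ) • (Pi.single μ 1 : Pt)) := by
    simpa using hf.hasFDerivAt
  exact (h2.comp_hasDerivAt (0 : ℝ) h1).unique h

theorem pderiv_const {E : Type*} [NormedAddCommGroup E] [NormedSpace ℝ E] (μ : Idx) (c : E)
    (x : Pt) : pderiv μ (fun _ => c) x = 0 := by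
  simp [pderiv]

theorem pderiv_ofReal {F : Pt → ℝ} {x : Pt} (μ : Idx) (h : DifferentiableAt ℝ F x) :
    pderiv μ (fun y => (F y : ℂ)) x = ((pderiv μ F x : ℝ) : ℂ) :=
  congrArg (fun L : Pt →L[ℝ] ℂ => L (Pi.single μ 1))
    (Complex.ofRealCLM.hasFDerivAt.comp x h.hasFDerivAt).fderiv

namespace Params
variable (P : Params)

/-- The diagonal entries `b_i = -κ_i²` of `B` as real numbers. -/
noncomputable def bR (i : Fin 9) : ℝ := -P.kap i ^ 2

theorem ofReal_bR (i : Fin 9) : (P.bR i : ℂ) = P.b i := by simp [bR, b]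

theorem quad_eq (x : Pt) : quad P.B x = ∑ i, P.bR i * x (Sum.inr i) ^ 2 := by
  rw [quad]
  refine Finset.sum_congr rfl fun i _ => ?_
  rw [Finset.sum_eq_single i]
  · simp [B, bR]; ring
  · intro j _ h
    simp [B, Matrix.diagonal_apply_ne' _ h]
  · simp

/-- The partial derivatives of the function `∑ B_ij x^i x^j`. -/
noncomputable def dquad (x : Pt) : Idx → ℝ :=
  Sum.elim 0 (fun i => 2 * P.bR i * x (Sum.inr i))

theorem pderiv_quad (μ : Idx) (x : Pt) : pderiv μ (quad P.B) x = P.dquad x μ := by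
  have e : quad P.B = fun x => ∑ i, P.bR i * x (Sum.inr i) ^ 2 := funext P.quad_eq
  rw [e]
  refine pderiv_eq (by fun_prop) ?_
  have h : ∀ i, HasDerivAt (fun t : ℝ => P.bR i * (x + t • (Pi.single μ 1 : Pt)) (Sum.inr i) ^ 2)
      (2 * P.bR i * x (Sum.inr i) * (Pi.single μ 1 : Pt) (Sum.inr i)) 0 := by
    intro i
    have h1 : HasDerivAt (fun t : ℝ => (x + t • (Pi.single μ 1 : Pt)) (Sum.inr i))
        ((Pi.single μ 1 : Pt) (Sum.inr i)) 0 := by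
      simpa using ((hasDerivAt_id (0 : ℝ)).mul_const ((Pi.single μ 1 : Pt) (Sum.inr i))).const_add
        (x (Sum.inr i))
    exact ((h1.pow 2).const_mul (P.bR i)).congr_deriv (by simp; ring)
  convert HasDerivAt.fun_sum (u := Finset.univ) fun i _ => h i using 1
  rcases μ with μ | μ
  · simp [dquad]
  · simp [dquad, Pi.single_apply, Sum.inr.injEq]

theorem metric_apply (x : Pt) (i j : Idx) : metric P.B x i j =
    (if i = Sum.inl 1 ∧ j = Sum.inl 1 then -1 else 0) * quad P.B x + eta i j := by
  rcases i with i | i <;> rcases j with j | j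
  · fin_cases i <;> fin_cases j <;> simp [metric, eta]
  all_goals simp [metric, eta]

theorem differentiable_quad : Differentiable ℝ (quad P.B) := by
  have e : quad P.B = fun x => ∑ i, P.bR i * x (Sum.inr i) ^ 2 := funext P.quad_eq
  rw [e]
  fun_prop

theorem pderiv_metric (μ i j : Idx) (x : Pt) : pderiv μ (fun y => metric P.B y i j) x =
    if i = Sum.inl 1 ∧ j = Sum.inl 1 then -P.dquad x μ else 0 := by
  simp only [P.metric_apply]
  rw [← P.pderiv_quad μ x]
  simp only [pderiv]
  rw [fderiv_add_const, fderiv_const_mul (P.differentiable_quad x)]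
  split_ifs <;> simp

theorem pderiv_ofReal_metric (μ i j : Idx) (x : Pt) :
    pderiv μ (fun y => (metric P.B y i j : ℂ)) x =
      if i = Sum.inl 1 ∧ j = Sum.inl 1 then -(P.dquad x μ : ℂ) else 0 := by
  rw [pderiv_ofReal, pderiv_metric]
  · split_ifs <;> simp
  · simp only [P.metric_apply]
    exact ((P.differentiable_quad x).const_mul _).add_const _

theorem metric_inv (x : Pt) :
    (metric P.B x)⁻¹ = Matrix.fromBlocks !![quad P.B x, 1; 1, 0] 0 0 1 := by
  refine Matrix.inv_eq_right_inv ?_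
  rw [metric, Matrix.fromBlocks_multiply]
  simp [← Matrix.fromBlocks_one, Matrix.one_fin_two]

theorem christoffel_plus (i j : Idx) (x : Pt) : christoffel (metric P.B) (Sum.inl 0) i j x =
    -((if j = Sum.inl 1 then P.dquad x i else 0)
      + (if i = Sum.inl 1 then P.dquad x j else 0)) / 2 := by
  simp only [christoffel, metric_inv, pderiv_metric, Fintype.sum_sum_type, Fin.sum_univ_two]
  simp [dquad]
  split_ifs <;> simp_all <;> ring

theorem christoffel_minus (i j : Idx) (x : Pt) :
    christoffel (metric P.B) (Sum.inl 1) i j x = 0 := by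
  simp only [christoffel, metric_inv, pderiv_metric, Fintype.sum_sum_type, Fin.sum_univ_two]
  simp [dquad]

theorem christoffel_inr (m : Fin 9) (i j : Idx) (x : Pt) :
    christoffel (metric P.B) (Sum.inr m) i j x =
      if i = Sum.inl 1 ∧ j = Sum.inl 1 then P.bR m * x (Sum.inr m) else 0 := by
  simp only [christoffel, metric_inv, pderiv_metric, Fintype.sum_sum_type, Fin.sum_univ_two]
  simp [Matrix.one_apply, dquad]
  split_ifs <;> simp_all
  ring

theorem covDeriv_plus (μ : Idx) (Y : VField) (x : Pt) :
    covDeriv (metric P.B) μ Y x (Sum.inl 0) = pderiv μ Y x (Sum.inl 0)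
      - (P.dquad x μ : ℂ) / 2 * Y x (Sum.inl 1)
      - if μ = Sum.inl 1 then ∑ i, P.b i * x (Sum.inr i) * Y x (Sum.inr i) else 0 := by
  simp only [covDeriv, christoffel_plus, Fintype.sum_sum_type, Fin.sum_univ_two]
  simp [dquad, ← ofReal_bR]
  split_ifs
  · subst_vars
    simp only [neg_div, neg_mul, Finset.sum_neg_distrib, Complex.ofReal_mul, Complex.ofReal_ofNat]
    rw [Finset.sum_congr rfl
      fun i _ => show 2 * (P.bR i : ℂ) * (x (Sum.inr i)) / 2 * Y x (Sum.inr i)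
      = P.bR i * x (Sum.inr i) * Y x (Sum.inr i) by ring]
    ring
  · simp
    ring

theorem covDeriv_minus (μ : Idx) (Y : VField) (x : Pt) :
    covDeriv (metric P.B) μ Y x (Sum.inl 1) = pderiv μ Y x (Sum.inl 1) := by
  simp only [covDeriv, christoffel_minus]
  simp

theorem covDeriv_inr (μ : Idx) (Y : VField) (x : Pt) (m : Fin 9) :
    covDeriv (metric P.B) μ Y x (Sum.inr m) = pderiv μ Y x (Sum.inr m)
      + if μ = Sum.inl 1 then P.b m * x (Sum.inr m) * Y x (Sum.inl 1) else 0 := by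
  simp only [covDeriv, christoffel_inr]
  by_cases h : μ = Sum.inl 1 <;> simp [h, Fintype.sum_sum_type, ← ofReal_bR]

theorem inner_frame (x : Pt) (a : Idx) (w : Idx → ℂ) :
    inner (metric P.B) x (frame P.B a x) w = Sum.elim
      ![w (Sum.inl 1), w (Sum.inl 0) - (quad P.B x : ℂ) / 2 * w (Sum.inl 1)]
        (fun i => w (Sum.inr i)) a := by
  simp only [inner, frame, Fintype.sum_sum_type, Fin.sum_univ_two]
  rcases a with a | a
  · fin_cases a
    · simp [metric, frameMatrix]
    · simp [metric, frameMatrix]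
      ring
  · simp [metric, frameMatrix, Matrix.one_apply, apply_ite Complex.ofReal]

theorem inner_comm (x : Pt) (v w : Idx → ℂ) :
    inner (metric P.B) x v w = inner (metric P.B) x w v := by
  have hs : ∀ i j, metric P.B x i j = metric P.B x j i := by
    intro i j
    rcases i with i | i <;> rcases j with j | j
    · fin_cases i <;> fin_cases j <;> simp [metric]
    all_goals simp [metric, Matrix.one_apply, eq_comm]
  simp only [inner]
  rw [Finset.sum_comm]
  refine Finset.sum_congr rfl fun i _ => Finset.sum_congr rfl fun j _ => ?_
  rw [hs]
  ring

theorem pderiv_frame (μ b : Idx) (x : Pt) : pderiv μ (frame P.B b) x =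
    if b = Sum.inl 1 then Pi.single (Sum.inl 0) ((P.dquad x μ : ℂ) / 2) else 0 := by
  by_cases h : b = Sum.inl 1
  · subst h
    have e : frame P.B (Sum.inl 1) = fun x => (quad P.B x : ℂ) • Pi.single (Sum.inl 0) (1 / 2 : ℂ)
        + Pi.single (Sum.inl 1) 1 := by
      funext x κ
      rcases κ with κ | κ
      · fin_cases κ <;> simp [frame, frameMatrix, div_eq_mul_inv]
      · simp [frame, frameMatrix]
    have hq : pderiv μ (fun y => (quad P.B y : ℂ)) x = (P.dquad x μ : ℂ) := by
      rw [pderiv_ofReal μ (P.differentiable_quad x), pderiv_quad]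
    rw [if_pos rfl, e]
    have h : DifferentiableAt ℝ (fun y => (quad P.B y : ℂ)) x :=
      (Complex.ofRealCLM.differentiableAt.comp x (P.differentiable_quad x))
    rw [pderiv, fderiv_add_const, fderiv_smul_const h, ContinuousLinearMap.smulRight_apply, ← hq,
      pderiv]
    funext κ
    simp [Pi.single_apply, div_eq_mul_inv]
  · have e : frame P.B b = fun _ => Pi.single b 1 := by
      funext x κ
      rcases κ with κ | κ <;> rcases b with b | b
      · fin_cases κ <;> fin_cases b <;> simp_all [frame, frameMatrix]
      all_goals simp [frame, frameMatrix, Matrix.one_apply, Pi.single_apply,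
        apply_ite Complex.ofReal]
    rw [if_neg h, e, pderiv_const]

/-- The only connection one-forms are `ω_{m-} = -ω_{-m} = b_m x^m dx⁻`. -/
theorem connForm_eq (μ a b : Idx) (x : Pt) : connForm P.B μ a b x =
    if μ = Sum.inl 1 then
      (if b = Sum.inl 1 then Sum.elim (0 : Fin 2 → ℂ) (fun m => P.b m * x (Sum.inr m)) a else 0)
      - (if a = Sum.inl 1 then Sum.elim (0 : Fin 2 → ℂ) (fun m => P.b m * x (Sum.inr m)) b else 0)
    else 0 := by
  rw [connForm, inner_frame]
  rcases a with a | a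
  · fin_cases a
    · simp [covDeriv_minus, pderiv_frame]
      split_ifs <;> simp
    · simp [covDeriv_minus, covDeriv_plus, pderiv_frame]
      rcases b with b | b
      · fin_cases b <;> simp [frame, frameMatrix]
      · simp [frame, frameMatrix, Matrix.one_apply, apply_ite Complex.ofReal]
        split_ifs <;> simp
  · simp [covDeriv_inr, pderiv_frame]
    rcases b with b | b
    · fin_cases b <;> simp [frame, frameMatrix]
    · simp [frame, frameMatrix]

end Params

/-! ### The spin connection -/

theorem GamUp_minus : GamUp (Sum.inl 1) = gPlus ⊗ₖ 1 := by
  simp [GamUp, Gam, eta, Fintype.sum_sum_type]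

theorem GamUp_inr (i : Fin 9) : GamUp (Sum.inr i) = sigmaVol ⊗ₖ gam i := by
  simp [GamUp, Gam, eta, Fintype.sum_sum_type, Matrix.one_apply]

theorem gPlus_mul_sigmaVol : gPlus * sigmaVol = gPlus := by
  ext i j
  fin_cases i <;> fin_cases j <;> simp [gPlus, sigmaVol]

theorem sigmaVol_mul_gPlus : sigmaVol * gPlus = -gPlus := by
  ext i j
  fin_cases i <;> fin_cases j <;> simp [gPlus, sigmaVol]

theorem sigmaVol_mul_sigmaVol : sigmaVol * sigmaVol = 1 := by
  simp [sigmaVol, Matrix.one_fin_two]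

theorem GamUp2_swap (a b : Idx) : GamUp2 b a = -GamUp2 a b := by
  simp only [GamUp2]
  module

theorem GamUp2_inr_minus (m : Fin 9) : GamUp2 (Sum.inr m) (Sum.inl 1) = -(gPlus ⊗ₖ gam m) := by
  rw [GamUp2, GamUp_inr, GamUp_minus, ← mul_kronecker_mul, ← mul_kronecker_mul, gPlus_mul_sigmaVol,
    sigmaVol_mul_gPlus, mul_one, one_mul]
  ext i j
  simp [kroneckerMap_apply]
  ring

theorem GamUp2_inr_inr (i j : Fin 9) : GamUp2 (Sum.inr i) (Sum.inr j) =
    (1 / 2 : ℂ) • ((1 : Matrix (Fin 2) (Fin 2) ℂ) ⊗ₖ (gam i * gam j - gam j * gam i)) := by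
  rw [GamUp2, GamUp_inr, GamUp_inr, ← mul_kronecker_mul, ← mul_kronecker_mul, sigmaVol_mul_sigmaVol]
  ext a b
  simp [kroneckerMap_apply]
  ring

namespace Params
variable (P : Params)

/-- The spin connection is `∂_μ`, plus `½ ∑ b_m x^m γ₊γ_m` for `μ = -`. -/
theorem spinNabla_eq (μ : Idx) (ψ : SField) (x : Pt) : spinNabla P.B μ ψ x = pderiv μ ψ x
    + if μ = Sum.inl 1 then
        (1 / 2 : ℂ) • ∑ m, (P.b m * x (Sum.inr m)) • (gPlus ⊗ₖ gam m) *ᵥ ψ x else 0 := by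
  by_cases h : μ = Sum.inl 1
  · have e1 : ∀ a b, GamUp2 a b *ᵥ ψ x = -(GamUp2 b a *ᵥ ψ x) := fun a b => by
      rw [GamUp2_swap b a, neg_mulVec]
    simp only [spinNabla, connForm_eq, h, if_true]
    simp [Fintype.sum_sum_type, sub_smul, Finset.sum_sub_distrib,
      e1 (Sum.inl 1) (Sum.inr _), GamUp2_inr_minus, neg_mulVec]
    module
  · simp [spinNabla, connForm_eq, h]

/-- The lower component of a spinor, with values in `S⁻`. -/
def lo (v : SW → ℂ) : SV → ℂ := fun s => v (0, s)

/-- The upper component of a spinor, with values in `S⁺`. -/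
def hi (v : SW → ℂ) : SV → ℂ := fun s => v (1, s)

theorem ext_lo_hi {v w : SW → ℂ} (h0 : lo v = lo w) (h1 : hi v = hi w) : v = w := by
  funext ⟨i, s⟩
  fin_cases i
  · exact congrFun h0 s
  · exact congrFun h1 s

@[simp] theorem lo_add (v w : SW → ℂ) : lo (v + w) = lo v + lo w := rfl
@[simp] theorem hi_add (v w : SW → ℂ) : hi (v + w) = hi v + hi w := rfl
@[simp] theorem lo_sub (v w : SW → ℂ) : lo (v - w) = lo v - lo w := rfl
@[simp] theorem hi_sub (v w : SW → ℂ) : hi (v - w) = hi v - hi w := rfl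
@[simp] theorem lo_smul (c : ℂ) (v : SW → ℂ) : lo (c • v) = c • lo v := rfl
@[simp] theorem hi_smul (c : ℂ) (v : SW → ℂ) : hi (c • v) = c • hi v := rfl
@[simp] theorem lo_zero : lo 0 = 0 := rfl
@[simp] theorem hi_zero : hi 0 = 0 := rfl
@[simp] theorem lo_neg (v : SW → ℂ) : lo (-v) = -lo v := rfl
@[simp] theorem hi_neg (v : SW → ℂ) : hi (-v) = -hi v := rfl
@[simp] theorem lo_inMinus (ξ : SV → ℂ) : lo (inMinus ξ) = ξ := rfl
@[simp] theorem hi_inMinus (ξ : SV → ℂ) : hi (inMinus ξ) = 0 := rfl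
@[simp] theorem lo_inPlus (ξ : SV → ℂ) : lo (inPlus ξ) = 0 := rfl
@[simp] theorem hi_inPlus (ξ : SV → ℂ) : hi (inPlus ξ) = ξ := rfl

@[simp] theorem lo_sum {ι : Type*} (s : Finset ι) (f : ι → SW → ℂ) :
    lo (∑ i ∈ s, f i) = ∑ i ∈ s, lo (f i) := by
  funext t; simp [lo]

@[simp] theorem hi_sum {ι : Type*} (s : Finset ι) (f : ι → SW → ℂ) :
    hi (∑ i ∈ s, f i) = ∑ i ∈ s, hi (f i) := by
  funext t; simp [hi]

theorem lo_kronecker (A : Matrix (Fin 2) (Fin 2) ℂ) (N : Matrix SV SV ℂ) (v : SW → ℂ) :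
    lo ((A ⊗ₖ N) *ᵥ v) = A 0 0 • N *ᵥ lo v + A 0 1 • N *ᵥ hi v := by
  funext s
  rw [lo, kronecker_mulVec_apply, Fin.sum_univ_two]
  rfl

theorem hi_kronecker (A : Matrix (Fin 2) (Fin 2) ℂ) (N : Matrix SV SV ℂ) (v : SW → ℂ) :
    hi ((A ⊗ₖ N) *ᵥ v) = A 1 0 • N *ᵥ lo v + A 1 1 • N *ᵥ hi v := by
  funext s
  rw [hi, kronecker_mulVec_apply, Fin.sum_univ_two]
  rfl

@[simp] theorem lo_gPlus (N : Matrix SV SV ℂ) (v : SW → ℂ) :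
    lo ((gPlus ⊗ₖ N) *ᵥ v) = (2 * rt) • N *ᵥ hi v := by
  rw [lo_kronecker, rt, mul_div_cancel₀ _ two_ne_zero]
  simp [gPlus]

@[simp] theorem hi_gPlus (N : Matrix SV SV ℂ) (v : SW → ℂ) : hi ((gPlus ⊗ₖ N) *ᵥ v) = 0 := by
  rw [hi_kronecker]
  simp [gPlus]

@[simp] theorem lo_one_kronecker (N : Matrix SV SV ℂ) (v : SW → ℂ) :
    lo (((1 : Matrix (Fin 2) (Fin 2) ℂ) ⊗ₖ N) *ᵥ v) = N *ᵥ lo v := by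
  rw [lo_kronecker]; simp

@[simp] theorem hi_one_kronecker (N : Matrix SV SV ℂ) (v : SW → ℂ) :
    hi (((1 : Matrix (Fin 2) (Fin 2) ℂ) ⊗ₖ N) *ᵥ v) = N *ᵥ hi v := by
  rw [hi_kronecker]; simp

/-! ### The vector fields in `𝒦₀` -/

/-- The coefficient of `∂_i` in `u_i K₍ᵢ₎ + v_i K₍ᵢ*₎`: a solution of `f'' = -λ_i² f`. -/
noncomputable def osc (c : Coef) (i : Fin 9) (t : ℝ) : ℂ :=
  c.u i * Complex.cos (P.lam i * t) + c.v i * (P.lam i * Complex.sin (P.lam i * t))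

/-- The derivative of `osc`. -/
noncomputable def oscDeriv (c : Coef) (i : Fin 9) (t : ℝ) : ℂ :=
  c.v i * (P.b i * Complex.cos (P.lam i * t)) - c.u i * (P.lam i * Complex.sin (P.lam i * t))

/-- The vector field with coefficients `c`. -/
noncomputable def field (c : Coef) : VField := fun x => Sum.elim
  ![c.p - ∑ i, P.oscDeriv c i (x (Sum.inl 1)) * x (Sum.inr i), c.m]
  (fun i => P.osc c i (x (Sum.inl 1)) + ∑ j, c.R i j * x (Sum.inr j))

theorem hasDerivAt_osc (c : Coef) (i : Fin 9) (t : ℝ) :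
    HasDerivAt (P.osc c i) (P.oscDeriv c i t) t := by
  have h0 : HasDerivAt (fun t : ℝ => P.lam i * (t : ℂ)) (P.lam i) t := by
    simpa using (Complex.ofRealCLM.hasDerivAt (x := t)).const_mul (P.lam i)
  have hc := (Complex.hasDerivAt_cos _).comp t h0
  have hs := (Complex.hasDerivAt_sin _).comp t h0
  refine ((hc.const_mul (c.u i)).add ((hs.const_mul (P.lam i)).const_mul (c.v i))).congr_deriv ?_
  rw [oscDeriv, ← lam_sq]
  ring

theorem hasDerivAt_oscDeriv (c : Coef) (i : Fin 9) (t : ℝ) :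
    HasDerivAt (P.oscDeriv c i) (-P.b i * P.osc c i t) t := by
  have h0 : HasDerivAt (fun t : ℝ => P.lam i * (t : ℂ)) (P.lam i) t := by
    simpa using (Complex.ofRealCLM.hasDerivAt (x := t)).const_mul (P.lam i)
  have hc := (Complex.hasDerivAt_cos _).comp t h0
  have hs := (Complex.hasDerivAt_sin _).comp t h0
  refine ((((hc.const_mul (P.b i)).const_mul (c.v i))).sub
    ((hs.const_mul (P.lam i)).const_mul (c.u i))).congr_deriv ?_
  rw [osc, ← lam_sq]
  ring

theorem osc_zero (c : Coef) (i : Fin 9) : P.osc c i 0 = c.u i := by simp [osc]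

theorem oscDeriv_zero (c : Coef) (i : Fin 9) : P.oscDeriv c i 0 = P.b i * c.v i := by
  simp [oscDeriv, mul_comm]

theorem contDiff_field (c : Coef) : ContDiff ℝ ∞ (P.field c) := by
  have hx : ∀ μ : Idx, ContDiff ℝ ∞ (fun x : Pt => (x μ : ℂ)) := fun μ =>
    Complex.ofRealCLM.contDiff.comp (contDiff_apply ℝ ℝ μ)
  have hcos : ∀ i, ContDiff ℝ ∞ (fun x : Pt => Complex.cos (P.lam i * x (Sum.inl 1))) := fun i =>
    (Complex.contDiff_cos.restrict_scalars ℝ).comp (contDiff_const.mul (hx _))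
  have hsin : ∀ i, ContDiff ℝ ∞ (fun x : Pt => Complex.sin (P.lam i * x (Sum.inl 1))) := fun i =>
    (Complex.contDiff_sin.restrict_scalars ℝ).comp (contDiff_const.mul (hx _))
  refine contDiff_pi.2 fun κ => ?_
  rcases κ with κ | κ
  · fin_cases κ
    · exact contDiff_const.sub (ContDiff.sum fun i _ => (((contDiff_const.mul (contDiff_const.mul
        (hcos i))).sub (contDiff_const.mul (contDiff_const.mul (hsin i)))).mul (hx _)))
    · exact contDiff_const
  · exact ((contDiff_const.mul (hcos κ)).add (contDiff_const.mul (contDiff_const.mul (hsin κ)))).add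
      (ContDiff.sum fun j _ => contDiff_const.mul (hx _))

theorem pderiv_field (c : Coef) (μ : Idx) (x : Pt) : pderiv μ (P.field c) x = Sum.elim
    ![0, Sum.elim ![∑ i, P.b i * P.osc c i (x (Sum.inl 1)) * x (Sum.inr i), 0]
      (fun i => P.oscDeriv c i (x (Sum.inl 1)))]
    (fun j => Sum.elim ![-P.oscDeriv c j (x (Sum.inl 1)), 0] (fun i => c.R i j)) μ := by
  refine pderiv_eq (((P.contDiff_field c).differentiable (by simp)) x) ?_
  have hy : ∀ κ, HasDerivAt (fun t : ℝ => (x + t • (Pi.single μ 1 : Pt)) κ)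
      ((Pi.single μ 1 : Pt) κ) 0 := by
    intro κ
    simpa using ((hasDerivAt_id (0 : ℝ)).mul_const ((Pi.single μ 1 : Pt) κ)).const_add (x κ)
  have hz : ∀ κ, HasDerivAt (fun t : ℝ => ((x + t • (Pi.single μ 1 : Pt)) κ : ℂ))
      (((Pi.single μ 1 : Pt) κ : ℝ) : ℂ) 0 := fun κ => (hy κ).ofReal_comp
  have hf := fun i => HasDerivAt.scomp (0 : ℝ) (P.hasDerivAt_osc c i _) (hy (Sum.inl 1))
  have hf' := fun i => HasDerivAt.scomp (0 : ℝ) (P.hasDerivAt_oscDeriv c i _) (hy (Sum.inl 1))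
  refine hasDerivAt_pi.2 fun κ => ?_
  rcases κ with κ | κ
  · fin_cases κ
    · refine ((HasDerivAt.fun_sum (u := Finset.univ) fun i _ =>
        (hf' i).mul (hz (Sum.inr i))).const_sub c.p).congr_deriv ?_
      rcases μ with μ | μ
      · fin_cases μ <;> simp
      · simp [Pi.single_apply, apply_ite Complex.ofReal]
    · refine (hasDerivAt_const _ c.m).congr_deriv ?_
      rcases μ with μ | μ
      · fin_cases μ <;> simp
      · simp
  · refine ((hf κ).add (HasDerivAt.fun_sum (u := Finset.univ) fun j _ =>
        (hz (Sum.inr j)).const_mul (c.R κ j))).congr_deriv ?_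
    rcases μ with μ | μ
    · fin_cases μ <;> simp
    · simp [Pi.single_apply, apply_ite Complex.ofReal]

end Params
namespace Params
variable (P : Params)

/-! ### The Lie algebra `𝒦₀` of Killing fields -/

theorem field_add (c c' : Coef) : P.field (c + c') = P.field c + P.field c' := by
  funext x κ
  rcases κ with κ | κ
  · fin_cases κ
    · simp [field, oscDeriv, add_mul, sub_mul, Finset.sum_add_distrib, Finset.sum_sub_distrib]
      ring
    · simp [field]
  · simp [field, osc, add_mul, Finset.sum_add_distrib]
    ring

theorem field_smul (t : ℂ) (c : Coef) : P.field (t • c) = t • P.field c := by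
  funext x κ
  rcases κ with κ | κ
  · fin_cases κ
    · simp only [field, oscDeriv, Coef.smul_p, Coef.smul_u, Coef.smul_v, Pi.smul_apply, smul_eq_mul,
        Fin.zero_eta, Sum.elim_inl, cons_val_zero, mul_sub, Finset.mul_sum]
      congr 1
      exact Finset.sum_congr rfl fun i _ => by ring
    · simp [field]
  · simp only [field, osc, Coef.smul_u, Coef.smul_v, Coef.smul_R, Pi.smul_apply, smul_eq_mul,
      Matrix.smul_apply, Sum.elim_inr, mul_add, Finset.mul_sum]
    congr 1
    · ring
    · exact Finset.sum_congr rfl fun i _ => by ring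

theorem field_eq_sum {c : Coef} (h : IsRot c.R) : P.field c = c.p • KPlus + c.m • KMinus
    + ∑ i, c.u i • P.KDir i + ∑ i, c.v i • P.KStar i
    + (1 / 2 : ℂ) • ∑ i, ∑ j, c.R i j • KRot i j := by
  funext x κ
  rcases κ with κ | κ
  · fin_cases κ
    · simp [field, KPlus, KMinus, KDir, KStar, KRot, del, Finset.sum_apply, oscDeriv, lam_sq]
      simp only [sub_eq_add_neg, add_assoc, ← Finset.sum_neg_distrib, ← Finset.sum_add_distrib]
      congr 1
      exact Finset.sum_congr rfl fun i _ => by ring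
    · simp [field, KPlus, KMinus, KDir, KStar, KRot, del, Finset.sum_apply]
  · have hr : ∑ i, ∑ j, c.R i j * KRot i j x (Sum.inr κ) = 2 * ∑ j, c.R κ j * x (Sum.inr j) := by
      simp only [KRot, del, Pi.sub_apply, Pi.smul_apply, smul_eq_mul, Pi.single_apply,
        Sum.inr.injEq, mul_sub, mul_ite, mul_one, mul_zero, Finset.sum_sub_distrib]
      simp only [Finset.sum_ite_eq, Finset.mem_univ, if_true]
      rw [Finset.sum_comm]
      simp only [Finset.sum_ite_eq, Finset.mem_univ, if_true]
      have hn : ∑ i, c.R i κ * (x (Sum.inr i) : ℂ) = -∑ i, c.R κ i * (x (Sum.inr i) : ℂ) := by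
        rw [← Finset.sum_neg_distrib]
        exact Finset.sum_congr rfl fun i _ => by rw [h.skew κ i, neg_mul]
      rw [hn]
      ring
    simp [field, KPlus, KMinus, KDir, KStar, del, Finset.sum_apply, osc, hr, Pi.single_apply,
      mul_ite, Finset.sum_ite_eq]

/-- The even part consists of the vector fields `field c`. -/
theorem mem_K0 {X : VField} : X ∈ P.K0 ↔ ∃ c : Coef, IsRot c.R ∧ X = P.field c := by
  have rot0 : IsRot 0 := ⟨by simp, by simp⟩
  constructor
  · intro hX
    induction hX using Submodule.span_induction with
    | mem X hX =>
      rcases hX with (((rfl | rfl) | ⟨i, rfl⟩) | ⟨i, rfl⟩) | ⟨i, j, hb, rfl⟩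
      · exact ⟨⟨1, 0, 0, 0, 0⟩, rot0, by rw [field_eq_sum _ rot0]; simp⟩
      · exact ⟨⟨0, 1, 0, 0, 0⟩, rot0, by rw [field_eq_sum _ rot0]; simp⟩
      · exact ⟨⟨0, 0, Pi.single i 1, 0, 0⟩, rot0, by
          rw [field_eq_sum _ rot0]; simp [Pi.single_apply]⟩
      · exact ⟨⟨0, 0, 0, Pi.single i 1, 0⟩, rot0, by
          rw [field_eq_sum _ rot0]; simp [Pi.single_apply]⟩
      · have hR : IsRot (Matrix.single i j (1 : ℂ) - Matrix.single j i 1) := by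
          refine ⟨fun k l => ?_, fun k l hkl => ?_⟩
          · simp [Matrix.single_apply, and_comm]
          · simp only [Matrix.sub_apply, Matrix.single_apply]
            rw [if_neg (by rintro ⟨rfl, rfl⟩; exact hkl hb),
              if_neg (by rintro ⟨rfl, rfl⟩; exact hkl hb.symm), sub_zero]
        refine ⟨⟨0, 0, 0, 0, _⟩, hR, ?_⟩
        have hs : KRot j i = -KRot i j := by
          funext x
          simp [KRot]
        rw [field_eq_sum _ hR]
        simp [Matrix.single_apply, sub_smul, Finset.sum_sub_distrib, ite_and, hs]
        module
    | zero => exact ⟨⟨0, 0, 0, 0, 0⟩, rot0, by rw [field_eq_sum _ rot0]; simp⟩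
    | add X Y _ _ hX hY =>
      obtain ⟨c, hc, rfl⟩ := hX
      obtain ⟨c', hc', rfl⟩ := hY
      exact ⟨c + c', hc.add hc', (P.field_add c c').symm⟩
    | smul t X _ hX =>
      obtain ⟨c, hc, rfl⟩ := hX
      exact ⟨t • c, hc.smul t, (P.field_smul t c).symm⟩
  · rintro ⟨c, hc, rfl⟩
    rw [field_eq_sum _ hc]
    have hm : ∀ X ∈ ({KPlus, KMinus} ∪ Set.range P.KDir ∪ Set.range P.KStar
        ∪ {X | ∃ i j, block i = block j ∧ X = KRot i j} : Set VField), X ∈ P.K0 :=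
      fun X hX => Submodule.subset_span hX
    refine Submodule.add_mem _ (Submodule.add_mem _ (Submodule.add_mem _ (Submodule.add_mem _
      (Submodule.smul_mem _ _ (hm _ (by simp))) (Submodule.smul_mem _ _ (hm _ (by simp))))
      (Submodule.sum_mem _ fun i _ => Submodule.smul_mem _ _ (hm _ (by simp))))
      (Submodule.sum_mem _ fun i _ => Submodule.smul_mem _ _ (hm _ (by simp))))
      (Submodule.smul_mem _ _ (Submodule.sum_mem _ fun i _ => Submodule.sum_mem _ fun j _ => ?_))
    by_cases hb : block i = block j
    · exact Submodule.smul_mem _ _ (hm _ (Or.inr ⟨i, j, hb, rfl⟩))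
    · rw [hc.eq_zero i j hb, zero_smul]
      exact Submodule.zero_mem _

theorem lam_eq_of_block {i j : Fin 9} (h : block i = block j) : P.lam i = P.lam j := by
  have : P.kap i = P.kap j := by
    fin_cases i <;> fin_cases j <;> first | rfl | exact absurd h (by decide)
  rw [lam, lam, this]

theorem sum_mul_osc {R : Matrix (Fin 9) (Fin 9) ℂ} (hR : IsRot R) (c : Coef) (i : Fin 9) (t : ℝ) :
    ∑ j, R i j * P.osc c j t = P.osc ⟨0, 0, R *ᵥ c.u, R *ᵥ c.v, 0⟩ i t := by
  simp only [osc, mulVec, dotProduct, Finset.sum_mul, ← Finset.sum_add_distrib]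
  refine Finset.sum_congr rfl fun j _ => ?_
  by_cases h : block i = block j
  · rw [P.lam_eq_of_block h]; ring
  · rw [hR.eq_zero i j h]; ring

theorem sum_mul_oscDeriv {R : Matrix (Fin 9) (Fin 9) ℂ} (hR : IsRot R) (c : Coef) (i : Fin 9)
    (t : ℝ) : ∑ j, R i j * P.oscDeriv c j t = P.oscDeriv ⟨0, 0, R *ᵥ c.u, R *ᵥ c.v, 0⟩ i t := by
  simp only [oscDeriv, mulVec, dotProduct, Finset.sum_mul, ← Finset.sum_sub_distrib]
  refine Finset.sum_congr rfl fun j _ => ?_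
  by_cases h : block i = block j
  · rw [P.lam_eq_of_block h, P.b_eq_of_block h]; ring
  · rw [hR.eq_zero i j h]; ring

/-- The commutator of two fields of `𝒦₀` in terms of the solutions `osc`; together with
`oscDeriv_br` and `wronskian` this is the content of `lieBr_field`. -/
theorem osc_br {c c' : Coef} (h : IsRot c.R) (h' : IsRot c'.R) (i : Fin 9) (t : ℝ) :
    P.osc (P.br c c') i t = c.m * P.oscDeriv c' i t - c'.m * P.oscDeriv c i t
      + ∑ j, c'.R i j * P.osc c j t - ∑ j, c.R i j * P.osc c' j t := by
  rw [sum_mul_osc P h', sum_mul_osc P h]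
  simp [osc, oscDeriv, br]
  ring

theorem oscDeriv_br {c c' : Coef} (h : IsRot c.R) (h' : IsRot c'.R) (i : Fin 9) (t : ℝ) :
    P.oscDeriv (P.br c c') i t = -c.m * P.b i * P.osc c' i t + c'.m * P.b i * P.osc c i t
      + ∑ j, c'.R i j * P.oscDeriv c j t - ∑ j, c.R i j * P.oscDeriv c' j t := by
  rw [sum_mul_oscDeriv P h', sum_mul_oscDeriv P h]
  simp [osc, oscDeriv, br]
  ring

/-- The Wronskian of two solutions is constant. -/
theorem wronskian (c c' : Coef) (t : ℝ) :
    ∑ i, (P.oscDeriv c i t * P.osc c' i t - P.osc c i t * P.oscDeriv c' i t) = (P.br c c').p := by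
  simp only [br, dotProduct, ← Finset.sum_sub_distrib, Pi.mul_apply]
  refine Finset.sum_congr rfl fun i _ => ?_
  simp only [osc, oscDeriv, ← lam_sq]
  linear_combination (P.lam i ^ 2 * (c.v i * c'.u i - c.u i * c'.v i))
    * Complex.sin_sq_add_cos_sq (P.lam i * t)

/-- The skew-symmetry of an infinitesimal rotation, written with sums. -/
theorem IsRot_sum {R : Matrix (Fin 9) (Fin 9) ℂ} (hR : IsRot R) (x y : Fin 9 → ℂ) :
    ∑ j, (∑ l, R j l * x l) * y j = -∑ j, (∑ l, R j l * y l) * x j := by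
  have := hR.dotProduct_mulVec x y
  rw [dotProduct_comm x] at this
  exact this

/-- The commutator of vector fields in `𝒦₀`. -/
theorem lieBr_field {c c' : Coef} (h : IsRot c.R) (h' : IsRot c'.R) :
    lieBr (P.field c) (P.field c') = P.field (P.br c c') := by
  funext x κ
  simp only [lieBr, pderiv_field, Fintype.sum_sum_type, Fin.sum_univ_two]
  rcases κ with κ | κ
  · fin_cases κ
    · have e1 := P.wronskian c c' (x (Sum.inl 1))
      have e2 := IsRot_sum h (fun i => (x (Sum.inr i) : ℂ))
        (fun i => P.oscDeriv c' i (x (Sum.inl 1)))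
      have e3 := IsRot_sum h' (fun i => (x (Sum.inr i) : ℂ))
        (fun i => P.oscDeriv c i (x (Sum.inl 1)))
      simp [field, oscDeriv_br P h h', ← e1, add_mul, sub_mul, Finset.sum_add_distrib,
        Finset.sum_sub_distrib, mul_assoc, Finset.mul_sum] at e2 e3 ⊢
      have hE : ∑ i, P.osc c' i (x (Sum.inl 1)) * P.oscDeriv c i (x (Sum.inl 1))
          = ∑ i, P.oscDeriv c i (x (Sum.inl 1)) * P.osc c' i (x (Sum.inl 1)) :=
        Finset.sum_congr rfl fun i _ => mul_comm _ _
      linear_combination hE - e2 + e3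
    · simp [field, br]
  · simp [field, osc_br P h h']
    simp [br, Matrix.mul_apply, sub_mul, Finset.sum_sub_distrib, add_mul, Finset.sum_add_distrib]
    have hm : ∀ R S : Matrix (Fin 9) (Fin 9) ℂ,
        ∑ i, (∑ j, R i j * (x (Sum.inr j) : ℂ)) * S κ i
          = ∑ j, (∑ i, S κ i * R i j) * (x (Sum.inr j) : ℂ) := by
      intro R S
      simp only [Finset.sum_mul]
      rw [Finset.sum_comm]
      exact Finset.sum_congr rfl fun j _ => Finset.sum_congr rfl fun i _ => by ring
    simp only [hm, mul_comm (P.osc _ _ _)]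
    ring

/-- The quadratic form `∑ b_k (x^k)²` is invariant under rotations that preserve the blocks. -/
theorem sum_b_rot {R : Matrix (Fin 9) (Fin 9) ℂ} (hR : IsRot R) (x : Fin 9 → ℂ) :
    ∑ k, P.b k * x k * ∑ l, R k l * x l = 0 := by
  have h1 := IsRot_sum hR x (P.b * x)
  have h2 : ∀ k, ∑ l, R k l * (P.b * x) l = P.b k * ∑ l, R k l * x l := fun k => congrFun
    (hR.mulVec_mul (fun _ _ e => P.b_eq_of_block e) x) k
  simp only [h2] at h1
  have h3 : ∑ k, P.b k * (∑ l, R k l * x l) * x k = ∑ k, P.b k * x k * ∑ l, R k l * x l :=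
    Finset.sum_congr rfl fun k _ => by ring
  have h4 : ∑ k, (∑ l, R k l * x l) * (P.b * x) k = ∑ k, P.b k * x k * ∑ l, R k l * x l :=
    Finset.sum_congr rfl fun k _ => by rw [Pi.mul_apply]; ring
  linear_combination (h1 - h3 - h4) / 2

/-- The vector fields in `𝒦₀` are Killing fields. -/
theorem isKilling_field {c : Coef} (h : IsRot c.R) : IsKilling P.B (P.field c) := by
  refine ⟨P.contDiff_field c, fun x i j => ?_⟩
  have hr := P.sum_b_rot h fun l => (x (Sum.inr l) : ℂ)
  simp only [pderiv_ofReal_metric, pderiv_field]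
  simp only [metric, Fintype.sum_sum_type, Fin.sum_univ_two]
  rcases i with i | i <;> rcases j with j | j
  · fin_cases i <;> fin_cases j <;> simp
    have e : ∑ k, P.field c x (Sum.inr k) * (P.dquad x (Sum.inr k) : ℂ)
        = 2 * ∑ k, P.b k * P.osc c k (x (Sum.inl 1)) * x (Sum.inr k) := by
      rw [← add_zero (2 * _), ← mul_zero (2 : ℂ), ← hr, ← mul_add, ← Finset.sum_add_distrib,
        Finset.mul_sum]
      refine Finset.sum_congr rfl fun k _ => ?_
      simp [field, dquad, ← ofReal_bR]
      ring
    have e' : (P.dquad x (Sum.inl 0) : ℂ) = 0 ∧ (P.dquad x (Sum.inl 1) : ℂ) = 0 := by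
      simp [dquad]
    rw [e, e'.1, e'.2]
    ring
  · fin_cases i <;> simp [Matrix.one_apply, apply_ite Complex.ofReal]
  · fin_cases j <;> simp [Matrix.one_apply, apply_ite Complex.ofReal]
  · simp [Matrix.one_apply, apply_ite Complex.ofReal, Finset.sum_add_distrib, h.skew i j]

theorem covDeriv_field {c : Coef} (h : IsRot c.R) (μ : Idx) (x : Pt) :
    covDeriv (metric P.B) μ (P.field c) x = Sum.elim
      ![0, Sum.elim (0 : Fin 2 → ℂ)
        fun i => P.oscDeriv c i (x (Sum.inl 1)) + P.b i * x (Sum.inr i) * c.m]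
      (fun j => Sum.elim ![-(P.oscDeriv c j (x (Sum.inl 1)) + P.b j * x (Sum.inr j) * c.m), 0]
        (fun i => c.R i j)) μ := by
  funext κ
  rcases κ with κ | κ
  · fin_cases κ
    · rw [Fin.zero_eta, covDeriv_plus, pderiv_field]
      rcases μ with μ | μ
      · fin_cases μ
        · simp [dquad]
        · have hr := P.sum_b_rot h fun l => (x (Sum.inr l) : ℂ)
          simp [dquad, field, mul_add, Finset.sum_add_distrib, hr]
          rw [← Finset.sum_sub_distrib]
          exact Finset.sum_eq_zero fun i _ => by ring
      · simp [dquad, field, ← ofReal_bR]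
        ring
    · rw [Fin.mk_one, covDeriv_minus, pderiv_field]
      rcases μ with μ | μ
      · fin_cases μ <;> simp
      · simp
  · rw [covDeriv_inr, pderiv_field]
    rcases μ with μ | μ
    · fin_cases μ <;> simp [field]
    · simp

end Params
namespace Params
variable (P : Params)

/-! ### The spinorial Lie derivative -/

/-- The spin representation of a rotation acts on both components of a spinor separately. -/
theorem rot_lo {R : Matrix (Fin 9) (Fin 9) ℂ} (v : SW → ℂ) :
    (1 / 4 : ℂ) • ∑ i, ∑ j, R i j • ((1 : Matrix (Fin 2) (Fin 2) ℂ) ⊗ₖ (gam i * gam j)) *ᵥ v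
      = inMinus (rot R (lo v)) + inPlus (rot R (hi v)) := by
  refine ext_lo_hi ?_ ?_ <;> simp [rot, mulVec_mulVec]

/-- The components of the covariant derivative of a vector field in `𝒦₀` with respect to the
frame. -/
theorem inner_covDeriv_field {c : Coef} (h : IsRot c.R) (a b : Idx) (x : Pt) :
    inner (metric P.B) x (∑ μ, frame P.B a x μ • covDeriv (metric P.B) μ (P.field c) x)
      (frame P.B b x) = Sum.elim
      ![0, Sum.elim (0 : Fin 2 → ℂ)
        fun i => P.oscDeriv c i (x (Sum.inl 1)) + P.b i * x (Sum.inr i) * c.m]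
      (fun j => Sum.elim ![0, -(P.oscDeriv c j (x (Sum.inl 1)) + P.b j * x (Sum.inr j) * c.m)]
        (fun i => c.R i j)) a b := by
  rw [inner_comm, inner_frame]
  have e : ∑ μ, frame P.B a x μ • covDeriv (metric P.B) μ (P.field c) x
      = covDeriv (metric P.B) a (P.field c) x := by
    have h0 : covDeriv (metric P.B) (Sum.inl 0) (P.field c) x = 0 := by
      rw [P.covDeriv_field h]; rfl
    rcases a with a | a
    · fin_cases a <;> simp [Fintype.sum_sum_type, frame, frameMatrix, h0]
    · simp [Fintype.sum_sum_type, frame, frameMatrix, Matrix.one_apply]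
  rw [e, P.covDeriv_field h]
  rcases a with a | a <;> rcases b with b | b
  · fin_cases a <;> fin_cases b <;> simp
  · fin_cases a <;> simp
  · fin_cases b <;> simp
  · simp

/-- The spinorial Lie derivative along a field of `𝒦₀`: the `b_i x^i`-terms of `∇` and of `∇K`
cancel. -/
theorem spinLie_field {c : Coef} (h : IsRot c.R) (ψ : SField) (x : Pt) :
    spinLie P.B (P.field c) ψ x = ∑ μ, P.field c x μ • pderiv μ ψ x
      - (1 / 2 : ℂ) • ∑ j, P.oscDeriv c j (x (Sum.inl 1)) • (gPlus ⊗ₖ gam j) *ᵥ ψ x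
      + (inMinus (rot c.R (lo (ψ x))) + inPlus (rot c.R (hi (ψ x)))) := by
  have e1 : ∀ a b, GamUp2 a b *ᵥ ψ x = -(GamUp2 b a *ᵥ ψ x) := fun a b => by
    rw [GamUp2_swap b a, neg_mulVec]
  have e2 : ∑ i, ∑ j, c.R j i • GamUp2 (Sum.inr i) (Sum.inr j) *ᵥ ψ x
      = -∑ i, ∑ j, c.R i j • ((1 : Matrix (Fin 2) (Fin 2) ℂ) ⊗ₖ (gam i * gam j)) *ᵥ ψ x := by
    have e3 : ∀ i j : Fin 9, ((1 : Matrix (Fin 2) (Fin 2) ℂ) ⊗ₖ (gam i * gam j - gam j * gam i))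
        = ((1 : Matrix (Fin 2) (Fin 2) ℂ) ⊗ₖ (gam i * gam j))
          - ((1 : Matrix (Fin 2) (Fin 2) ℂ) ⊗ₖ (gam j * gam i)) := by
      intro i j
      ext a b
      simp [kroneckerMap_apply]
      ring
    have e4 : ∑ i, ∑ j, c.R j i • ((1 : Matrix (Fin 2) (Fin 2) ℂ) ⊗ₖ (gam i * gam j)) *ᵥ ψ x
      = -∑ i, ∑ j, c.R i j • ((1 : Matrix (Fin 2) (Fin 2) ℂ) ⊗ₖ (gam i * gam j)) *ᵥ ψ x := by
      simp only [← Finset.sum_neg_distrib]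
      exact Finset.sum_congr rfl fun i _ => Finset.sum_congr rfl fun j _ => by
        rw [h.skew i j, neg_smul]
    have e5 : ∑ i, ∑ j, c.R j i • ((1 : Matrix (Fin 2) (Fin 2) ℂ) ⊗ₖ (gam j * gam i)) *ᵥ ψ x
      = ∑ i, ∑ j, c.R i j • ((1 : Matrix (Fin 2) (Fin 2) ℂ) ⊗ₖ (gam i * gam j)) *ᵥ ψ x :=
      Finset.sum_comm
    simp only [GamUp2_inr_inr, e3, smul_sub, smul_mulVec, sub_mulVec, Finset.sum_sub_distrib,
      smul_comm _ (1 / 2 : ℂ), ← Finset.smul_sum, e4, e5]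
    module
  have e6 : ∑ i, (P.oscDeriv c i (x (Sum.inl 1))
    + P.b i * x (Sum.inr i) * c.m) • (gPlus ⊗ₖ gam i) *ᵥ ψ x
      = ∑ i, P.oscDeriv c i (x (Sum.inl 1)) • (gPlus ⊗ₖ gam i) *ᵥ ψ x
        + c.m • ∑ i, (P.b i * x (Sum.inr i)) • (gPlus ⊗ₖ gam i) *ᵥ ψ x := by
    rw [Finset.smul_sum, ← Finset.sum_add_distrib]
    exact Finset.sum_congr rfl fun i _ => by module
  have e7 : ∑ μ, P.field c x μ • spinNabla P.B μ ψ x = ∑ μ, P.field c x μ • pderiv μ ψ x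
      + c.m • (1 / 2 : ℂ) • ∑ m, (P.b m * x (Sum.inr m)) • (gPlus ⊗ₖ gam m) *ᵥ ψ x := by
    simp only [spinNabla_eq, smul_add, Finset.sum_add_distrib, smul_ite, smul_zero,
      Finset.sum_ite_eq', Finset.mem_univ, if_true]
    rfl
  rw [spinLie, e7, ← rot_lo]
  simp only [inner_covDeriv_field P h]
  simp only [Fintype.sum_sum_type, Fin.sum_univ_two]
  simp only [Sum.elim_inl, Sum.elim_inr, cons_val_zero, cons_val_one, Pi.zero_apply, zero_smul,
    neg_smul, e1 (Sum.inl 1) (Sum.inr _),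
    GamUp2_inr_minus, e2, Finset.sum_add_distrib, neg_mulVec, neg_neg, smul_neg, e6,
      Finset.sum_const_zero, zero_add, add_zero]
  module

end Params

/-! ### Exponentials of Clifford elements -/

/-- The curve `t ↦ exp(-tA) ξ`. -/
noncomputable def expVec (A : Matrix SV SV ℂ) (ξ : SV → ℂ) (t : ℝ) : SV → ℂ :=
  NormedSpace.exp ((-(t : ℂ)) • A) *ᵥ ξ

theorem expVec_zero (A : Matrix SV SV ℂ) (ξ : SV → ℂ) : expVec A ξ 0 = ξ := by
  simp [expVec, NormedSpace.exp_zero]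

section

attribute [local instance] Matrix.linftyOpNormedRing Matrix.linftyOpNormedAlgebra

theorem hasDerivAt_expVec (A : Matrix SV SV ℂ) (ξ : SV → ℂ) (t : ℝ) :
    HasDerivAt (expVec A ξ) (-(A *ᵥ expVec A ξ t)) t := by
  have h1 := hasDerivAt_exp_smul_const' (𝕂 := ℂ) A (-(t : ℂ))
  let L : Matrix SV SV ℂ →L[ℂ] (SV → ℂ) :=
    LinearMap.toContinuousLinearMap ((Matrix.mulVecBilin ℂ ℂ).flip ξ)
  have h2 : HasDerivAt (fun u : ℂ => NormedSpace.exp (u • A) *ᵥ ξ)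
      ((A * NormedSpace.exp ((-(t : ℂ)) • A)) *ᵥ ξ) (-(t : ℂ)) := L.hasFDerivAt.comp_hasDerivAt _ h1
  have h3 : HasDerivAt (fun t : ℝ => -(t : ℂ)) (-1) t := (Complex.ofRealCLM.hasDerivAt (x := t)).neg
  refine (HasDerivAt.scomp t h2 h3).congr_deriv ?_
  rw [neg_one_smul, ← mulVec_mulVec]
  rfl

end

/-- Uniqueness for the linear differential equation `f' = -A f`. -/
theorem eq_of_hasDerivAt {n : Type*} [Fintype n] (A : Matrix n n ℂ) {f g : ℝ → n → ℂ}
    (hf : ∀ t, HasDerivAt f (-(A *ᵥ f t)) t) (hg : ∀ t, HasDerivAt g (-(A *ᵥ g t)) t)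
    (h0 : f 0 = g 0) : f = g := by
  let L : (n → ℂ) →L[ℂ] (n → ℂ) := LinearMap.toContinuousLinearMap (-(Matrix.mulVecLin A))
  have hL : ∀ v, L v = -(A *ᵥ v) := fun v => rfl
  refine ODE_solution_unique_univ (v := fun _ v => L v) (s := fun _ => Set.univ) (K := ‖L‖₊)
    (t₀ := 0) (fun _ => L.lipschitz.lipschitzOnWith) (fun t => ⟨?_, trivial⟩)
    (fun t => ⟨?_, trivial⟩) h0
  · rw [hL]; exact hf t
  · rw [hL]; exact hg t

theorem eq_expVec {A : Matrix SV SV ℂ} {f : ℝ → SV → ℂ}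
    (hf : ∀ t, HasDerivAt f (-(A *ᵥ f t)) t) (t : ℝ) : f t = expVec A (f 0) t :=
  congrFun (eq_of_hasDerivAt A hf (hasDerivAt_expVec A _) (expVec_zero A _).symm) t

theorem contDiff_expVec (A : Matrix SV SV ℂ) (ξ : SV → ℂ) : ContDiff ℝ ∞ (expVec A ξ) := by
  let L : (SV → ℂ) →L[ℝ] (SV → ℂ) :=
    (LinearMap.toContinuousLinearMap (-(Matrix.mulVecLin A))).restrictScalars ℝ
  have hd : deriv (expVec A ξ) = fun t => L (expVec A ξ t) :=
    funext fun t => (hasDerivAt_expVec A ξ t).deriv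
  have hn : ∀ n : ℕ, ContDiff ℝ n (expVec A ξ) := by
    intro n
    induction n with
    | zero =>
      exact contDiff_zero.2 (continuous_iff_continuousAt.2 fun t =>
        (hasDerivAt_expVec A ξ t).continuousAt)
    | succ n ih =>
      push_cast
      refine contDiff_succ_iff_deriv.2 ⟨fun t => (hasDerivAt_expVec A ξ t).differentiableAt,
        by simp, ?_⟩
      rw [hd]
      exact L.contDiff.comp ih
  exact contDiff_infty.2 hn

/-- Linear maps that intertwine `A` and `A'` intertwine their exponentials. -/
theorem map_expVec {A A' : Matrix SV SV ℂ} (Φ : (SV → ℂ) →ₗ[ℂ] (SV → ℂ))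
    (h : ∀ v, Φ (A *ᵥ v) = A' *ᵥ Φ v) (ξ : SV → ℂ) (t : ℝ) :
    Φ (expVec A ξ t) = expVec A' (Φ ξ) t := by
  have hf : ∀ t, HasDerivAt (fun t => Φ (expVec A ξ t)) (-(A' *ᵥ Φ (expVec A ξ t))) t := by
    intro t
    have h1 := ((LinearMap.toContinuousLinearMap Φ).restrictScalars ℝ).hasFDerivAt.comp_hasDerivAt t
      (hasDerivAt_expVec A ξ t)
    refine h1.congr_deriv ?_
    rw [← h, ← map_neg]
    rfl
  simpa [expVec_zero] using eq_expVec hf t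

theorem mulVec_expVec {A A' M : Matrix SV SV ℂ} (h : ∀ v, M *ᵥ A *ᵥ v = A' *ᵥ M *ᵥ v)
    (ξ : SV → ℂ) (t : ℝ) : M *ᵥ expVec A ξ t = expVec A' (M *ᵥ ξ) t :=
  map_expVec (Matrix.mulVecLin M) h ξ t

theorem expVec_add (A : Matrix SV SV ℂ) (ξ η : SV → ℂ) (t : ℝ) :
    expVec A (ξ + η) t = expVec A ξ t + expVec A η t := by
  simp [expVec, mulVec_add]

theorem expVec_smul (A : Matrix SV SV ℂ) (c : ℂ) (ξ : SV → ℂ) (t : ℝ) :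
    expVec A (c • ξ) t = c • expVec A ξ t := by
  simp [expVec, mulVec_smul]

theorem expVec_sum (A : Matrix SV SV ℂ) {ι : Type*} (s : Finset ι) (f : ι → SV → ℂ) (t : ℝ) :
    expVec A (∑ i ∈ s, f i) t = ∑ i ∈ s, expVec A (f i) t := by
  simp [expVec, Matrix.mulVec_sum]

theorem rot_expVec {A : Matrix SV SV ℂ} {R : Matrix (Fin 9) (Fin 9) ℂ}
    (h : ∀ v, A *ᵥ rot R v = rot R (A *ᵥ v)) (ξ : SV → ℂ) (t : ℝ) :
    rot R (expVec A ξ t) = expVec A (rot R ξ) t :=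
  map_expVec ⟨⟨rot R, rot_add R⟩, fun c v => rot_smul c R v⟩ (fun v => (h v).symm) ξ t

theorem hasDerivAt_mulVec {n : Type*} [Fintype n] {M : Matrix n n ℂ} {f : ℝ → n → ℂ} {f' : n → ℂ}
    {t : ℝ} (h : HasDerivAt f f' t) : HasDerivAt (fun t => M *ᵥ f t) (M *ᵥ f') t :=
  ((LinearMap.toContinuousLinearMap
    (Matrix.mulVecLin M)).restrictScalars ℝ).hasFDerivAt.comp_hasDerivAt t h

theorem contDiff_mulVec {n E : Type*} [Fintype n] [NormedAddCommGroup E] [NormedSpace ℝ E]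
    {k : WithTop ℕ∞} (M : Matrix n n ℂ) {f : E → n → ℂ} (h : ContDiff ℝ k f) :
    ContDiff ℝ k fun x => M *ᵥ f x :=
  ((LinearMap.toContinuousLinearMap (Matrix.mulVecLin M)).restrictScalars ℝ).contDiff.comp h

namespace Params
variable (P : Params)

/-! ### The spinor fields in `𝒦₁` -/

theorem d_gam1234 (v : SV → ℂ) : gam1234 *ᵥ P.d *ᵥ v = P.d *ᵥ gam1234 *ᵥ v := by
  simp only [d_mulVec, mulVec_add, mulVec_smul, gam1234_gam125]

variable {P} in
theorem chi_expVec {ξ : SV → ℂ} {σ : ℂ} (h : gam1234 *ᵥ ξ = σ • ξ) (t : ℝ) :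
    gam1234 *ᵥ expVec P.d ξ t = σ • expVec P.d ξ t := by
  rw [mulVec_expVec (A' := P.d) P.d_gam1234, h, expVec_smul]

/-- A solution of the oscillator equation intertwines the two exponentials. -/
theorem osc_expVec {ξ : SV → ℂ} (h : gam1234 *ᵥ ξ = ξ) (c : Coef) (i : Fin 9) (t : ℝ) :
    P.osc c i t • P.s i *ᵥ expVec P.d ξ t - P.oscDeriv c i t • gam i *ᵥ expVec P.d ξ t
      = expVec P.cbar (c.u i • P.s i *ᵥ ξ - (P.b i * c.v i) • gam i *ᵥ ξ) t := by
  have h1 : gam1234 *ᵥ ξ = (1 : ℂ) • ξ := by rw [h, one_smul]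
  have hf : ∀ t, HasDerivAt (fun t => P.osc c i t • P.s i *ᵥ expVec P.d ξ t
      - P.oscDeriv c i t • gam i *ᵥ expVec P.d ξ t)
      (-(P.cbar *ᵥ (P.osc c i t • P.s i *ᵥ expVec P.d ξ t
      - P.oscDeriv c i t • gam i *ᵥ expVec P.d ξ t))) t := by
    intro t
    have hE := hasDerivAt_expVec P.d ξ t
    refine (((P.hasDerivAt_osc c i t).smul (hasDerivAt_mulVec hE)).sub
      ((P.hasDerivAt_oscDeriv c i t).smul (hasDerivAt_mulVec hE))).congr_deriv ?_
    have e := P.cbar_s_sub_s_d (chi_expVec (P := P) h1 t) i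
    have e2 := P.s_mulVec i (expVec P.d ξ t)
    have e3 : P.cbar *ᵥ gam i *ᵥ expVec P.d ξ t = P.s i *ᵥ expVec P.d ξ t
      + gam i *ᵥ P.d *ᵥ expVec P.d ξ t := by rw [e2]; abel
    have e4 : P.cbar *ᵥ P.s i *ᵥ expVec P.d ξ t = P.s i *ᵥ P.d *ᵥ expVec P.d ξ t
      - P.b i • gam i *ᵥ expVec P.d ξ t := by
      rw [P.b_eq i, neg_smul, ← e]; abel
    simp only [mulVec_sub, mulVec_smul, mulVec_neg, e3, e4]
    module
  have := eq_expVec hf t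
  rw [this]
  simp only [expVec_zero, osc_zero, oscDeriv_zero]

theorem hi_spinor (ξ₁ ξ₂ : SV → ℂ) (x : Pt) :
    hi (P.spinor ξ₁ ξ₂ x) = expVec P.d ξ₂ (x (Sum.inl 1)) := by
  simp only [spinor, add_mulVec, smul_mulVec, Matrix.sum_mulVec, one_mulVec, hi_add, hi_inMinus,
    hi_inPlus, hi_smul, hi_sum, hi_gPlus]
  simp [expVec]

theorem lo_spinor (ξ₁ ξ₂ : SV → ℂ) (x : Pt) :
    lo (P.spinor ξ₁ ξ₂ x) = expVec P.cbar ξ₁ (x (Sum.inl 1))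
      + rt • ∑ i, (x (Sum.inr i) : ℂ) • P.s i *ᵥ expVec P.d ξ₂ (x (Sum.inl 1)) := by
  simp only [spinor, add_mulVec, smul_mulVec, Matrix.sum_mulVec, one_mulVec, lo_add, lo_inMinus,
    lo_inPlus, lo_smul, lo_sum, lo_gPlus, hi_inPlus, smul_comm _ (2 * rt), ← Finset.smul_sum]
  simp only [expVec]
  module

theorem spinor_zero (ξ₁ ξ₂ : SV → ℂ) : P.spinor ξ₁ ξ₂ 0 = inMinus ξ₁ + inPlus ξ₂ := by
  refine ext_lo_hi ?_ ?_
  · simp [lo_spinor, expVec_zero]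
  · simp [hi_spinor, expVec_zero]

theorem contDiff_of_lo_hi {n : WithTop ℕ∞} {ψ : SField} (h0 : ContDiff ℝ n fun x => lo (ψ x))
    (h1 : ContDiff ℝ n fun x => hi (ψ x)) : ContDiff ℝ n ψ := by
  refine contDiff_pi.2 fun ⟨i, s⟩ => ?_
  fin_cases i
  · exact contDiff_pi.1 h0 s
  · exact contDiff_pi.1 h1 s

theorem hasDerivAt_of_lo_hi {f : ℝ → SW → ℂ} {v : SW → ℂ} {t : ℝ}
    (h0 : HasDerivAt (fun x => lo (f x)) (lo v) t)
    (h1 : HasDerivAt (fun x => hi (f x)) (hi v) t) : HasDerivAt f v t := by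
  refine hasDerivAt_pi.2 fun ⟨i, s⟩ => ?_
  fin_cases i
  · exact hasDerivAt_pi.1 h0 s
  · exact hasDerivAt_pi.1 h1 s

theorem contDiff_spinor (ξ₁ ξ₂ : SV → ℂ) : ContDiff ℝ ∞ (P.spinor ξ₁ ξ₂) := by
  have hx : ∀ μ : Idx, ContDiff ℝ ∞ (fun x : Pt => (x μ : ℂ)) := fun μ =>
    Complex.ofRealCLM.contDiff.comp (contDiff_apply ℝ ℝ μ)
  have hE : ∀ A ξ, ContDiff ℝ ∞ (fun x : Pt => expVec A ξ (x (Sum.inl 1))) := fun A ξ =>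
    (contDiff_expVec A ξ).comp (contDiff_apply ℝ ℝ _)
  refine contDiff_of_lo_hi ?_ ?_
  · simp only [lo_spinor]
    exact (hE _ _).add (ContDiff.const_smul _ (ContDiff.sum fun i _ =>
      (hx _).smul (contDiff_mulVec _ (hE _ _))))
  · simp only [hi_spinor]
    exact hE _ _

theorem pderiv_spinor (ξ₁ ξ₂ : SV → ℂ) (μ : Idx) (x : Pt) : pderiv μ (P.spinor ξ₁ ξ₂) x = Sum.elim
    ![0, inMinus (-(P.cbar *ᵥ expVec P.cbar ξ₁ (x (Sum.inl 1)))
        - rt • ∑ i, (x (Sum.inr i) : ℂ) • P.s i *ᵥ P.d *ᵥ expVec P.d ξ₂ (x (Sum.inl 1)))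
      + inPlus (-(P.d *ᵥ expVec P.d ξ₂ (x (Sum.inl 1))))]
    (fun i => inMinus (rt • P.s i *ᵥ expVec P.d ξ₂ (x (Sum.inl 1)))) μ := by
  refine pderiv_eq (((P.contDiff_spinor ξ₁ ξ₂).differentiable (by simp)) x) ?_
  have hy : ∀ κ, HasDerivAt (fun t : ℝ => (x + t • (Pi.single μ 1 : Pt)) κ)
      ((Pi.single μ 1 : Pt) κ) 0 := by
    intro κ
    simpa using ((hasDerivAt_id (0 : ℝ)).mul_const ((Pi.single μ 1 : Pt) κ)).const_add (x κ)
  have hz : ∀ κ, HasDerivAt (fun t : ℝ => ((x + t • (Pi.single μ 1 : Pt)) κ : ℂ))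
      (((Pi.single μ 1 : Pt) κ : ℝ) : ℂ) 0 := fun κ => (hy κ).ofReal_comp
  have hE := fun A ξ => HasDerivAt.scomp (0 : ℝ) (hasDerivAt_expVec A ξ _) (hy (Sum.inl 1))
  refine hasDerivAt_of_lo_hi ?_ ?_
  · simp only [lo_spinor]
    refine ((hE P.cbar ξ₁).add ((HasDerivAt.fun_sum (u := Finset.univ) fun i _ =>
      (hz (Sum.inr i)).smul (hasDerivAt_mulVec
        (M := P.s i) (hE P.d ξ₂))).const_smul rt)).congr_deriv ?_
    rcases μ with μ | μ
    · fin_cases μ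
      · simp
      · simp [mulVec_neg, Finset.sum_neg_distrib, sub_eq_add_neg]
    · simp [Pi.single_apply]
  · simp only [hi_spinor]
    refine (hE P.d ξ₂).congr_deriv ?_
    rcases μ with μ | μ
    · fin_cases μ <;> simp
    · simp

end Params

/-! ### The action of `𝒦₀` on `𝒦₁` -/

theorem sum_smul_smul {ι M : Type*} [Fintype ι] [AddCommGroup M] [Module ℂ M] (r : ℂ) (a : ι → ℂ)
    (f : ι → M) : ∑ i, a i • r • f i = r • ∑ i, a i • f i := by
  rw [Finset.smul_sum]
  exact Finset.sum_congr rfl fun i _ => smul_comm _ _ _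

namespace Params
variable (P : Params)

theorem rot_s {R : Matrix (Fin 9) (Fin 9) ℂ} (hR : IsRot R) (i : Fin 9) (ξ : SV → ℂ) :
    rot R (P.s i *ᵥ ξ) = P.s i *ᵥ rot R ξ - ∑ k, R k i • P.s k *ᵥ ξ := by
  simp only [s_mulVec, rot_sub, ← cbar_rot P hR, rot_gam hR, d_rot P hR, mulVec_sub,
    Matrix.mulVec_sum, mulVec_smul, smul_sub, Finset.sum_sub_distrib]
  abel

theorem Xminus_mulVec (ξ : SV → ℂ) : Xminus *ᵥ ξ = (1 / 2 : ℂ) • (ξ - gam1234 *ᵥ ξ) := by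
  rw [Xminus, smul_mulVec, sub_mulVec, one_mulVec, gam1234]

theorem Xminus_eq_zero_iff {ξ : SV → ℂ} : Xminus *ᵥ ξ = 0 ↔ gam1234 *ᵥ ξ = ξ := by
  rw [Xminus_mulVec, smul_eq_zero, sub_eq_zero, eq_comm (a := ξ)]
  norm_num

/-- The odd part consists of the spinor fields of the pairs `(ξ₁, ξ₂)` with `γ₁γ₂γ₃γ₄ ξ₂ = ξ₂`. -/
theorem mem_K1 {ψ : SField} : ψ ∈ P.K1 ↔ ∃ ξ : (SV → ℂ) × (SV → ℂ), gam1234 *ᵥ ξ.2 = ξ.2 ∧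
    ψ = P.spinor ξ.1 ξ.2 := by
  constructor
  · rintro ⟨a, b, h, rfl⟩
    exact ⟨(a, b), Xminus_eq_zero_iff.1 h, rfl⟩
  · rintro ⟨ξ, h, rfl⟩
    exact ⟨ξ.1, ξ.2, Xminus_eq_zero_iff.2 h, rfl⟩

/-- The spinorial Lie derivative on `𝒦₁` is given by `act`. -/
theorem spinLie_spinor {c : Coef} (hc : IsRot c.R) {ξ : (SV → ℂ) × (SV → ℂ)}
    (hξ : gam1234 *ᵥ ξ.2 = ξ.2) : spinLie P.B (P.field c) (P.spinor ξ.1 ξ.2)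
      = P.spinor (P.act c ξ).1 (P.act c ξ).2 := by
  funext x
  obtain ⟨ξ₁, ξ₂⟩ := ξ
  simp only at hξ
  have h1 : gam1234 *ᵥ ξ₂ = (1 : ℂ) • ξ₂ := by rw [hξ, one_smul]
  set t := x (Sum.inl 1) with ht
  have hm : ∀ v, P.d *ᵥ expVec P.d v t = expVec P.d (P.d *ᵥ v) t :=
    fun v => mulVec_expVec (fun _ => rfl) v t
  have hm' : ∀ v, P.cbar *ᵥ expVec P.cbar v t = expVec P.cbar (P.cbar *ᵥ v) t :=
    fun v => mulVec_expVec (fun _ => rfl) v t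
  have hr := rot_expVec (d_rot P hc) ξ₂ t
  have hr' := rot_expVec (cbar_rot P hc) ξ₁ t
  rw [P.spinLie_field hc]
  refine ext_lo_hi ?_ ?_
  -- In `S⁻`, the coefficients `osc` and `oscDeriv` of the field combine with `exp(-x⁻ d)` into a
  -- single curve `exp(-x⁻ c̄)` by `osc_expVec`; the terms linear in the `x^i` match by `rot_s`.
  · have e1 : expVec P.cbar (cl (P.k * c.u) (gam125 *ᵥ ξ₂) - cl (P.b * c.v) ξ₂) t
        = ∑ i, P.osc c i t • P.s i *ᵥ expVec P.d ξ₂ t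
          - ∑ i, P.oscDeriv c i t • gam i *ᵥ expVec P.d ξ₂ t := by
      rw [← Finset.sum_sub_distrib, Finset.sum_congr rfl fun i _ => P.osc_expVec hξ c i t,
        ← expVec_sum]
      simp only [cl, P.s_of_chi h1, Finset.sum_sub_distrib, Pi.mul_apply, smul_smul,
        mul_comm (c.u _),
        k]
    have e2 : ∑ i, (∑ j, c.R i j * (x (Sum.inr j) : ℂ)) • P.s i *ᵥ expVec P.d ξ₂ t
        = ∑ i, (x (Sum.inr i) : ℂ) • ∑ j, c.R j i • P.s j *ᵥ expVec P.d ξ₂ t := by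
      simp only [Finset.sum_smul, Finset.smul_sum]
      rw [Finset.sum_comm]
      exact Finset.sum_congr rfl fun i _ => Finset.sum_congr rfl fun j _ => by module
    simp only [lo_add, lo_sub, lo_smul, lo_sum, lo_gPlus, Fintype.sum_sum_type, Fin.sum_univ_two,
      pderiv_spinor, Sum.elim_inl, Sum.elim_inr, cons_val_zero, cons_val_one, lo_inMinus, lo_inPlus,
      hi_spinor, lo_spinor, lo_zero, ← ht]
    rw [act]
    simp only [expVec_add, expVec_smul, e1]
    simp only [rot_add, rot_smul, rot_sum, hr', P.rot_s hc, ← hm',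
      mulVec_add, mulVec_smul, smul_add, Finset.sum_add_distrib, smul_sub, Finset.sum_sub_distrib,
      ← hr, ← hm]
    simp only [field, Sum.elim_inl, Sum.elim_inr, cons_val_zero, cons_val_one, add_smul,
      Finset.sum_add_distrib, sum_smul_smul, e2, ← ht]
    module
  · simp only [hi_add, hi_sub, hi_smul, hi_sum, hi_gPlus, Fintype.sum_sum_type, Fin.sum_univ_two,
      pderiv_spinor, Sum.elim_inl, Sum.elim_inr, cons_val_zero, cons_val_one, hi_inMinus, hi_inPlus,
      hi_spinor, hi_zero, ← ht, act, expVec_add, expVec_smul, hr, ← hm, field]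
    simp

/-! ### The connection `D` -/

theorem D_plus (ψ : SField) (x : Pt) : P.D (Sum.inl 0) ψ x = pderiv (Sum.inl 0) ψ x := by
  simp [D, spinNabla_eq, coframeMatrix, rho, Fintype.sum_sum_type]

theorem D_inr (i : Fin 9) (ψ : SField) (x : Pt) : P.D (Sum.inr i) ψ x = pderiv (Sum.inr i) ψ x
    - (1 / 2 : ℂ) • (gPlus ⊗ₖ P.s i) *ᵥ ψ x := by
  simp [D, spinNabla_eq, coframeMatrix, rho, Fintype.sum_sum_type, Matrix.one_apply,
    smul_mulVec, sub_eq_add_neg, neg_mulVec]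

theorem D_minus (ψ : SField) (x : Pt) : P.D (Sum.inl 1) ψ x = pderiv (Sum.inl 1) ψ x
    + (1 / 2 : ℂ) • ∑ m, (P.b m * x (Sum.inr m)) • (gPlus ⊗ₖ gam m) *ᵥ ψ x
    + (inMinus (P.cbar *ᵥ lo (ψ x)) + inPlus (P.d *ᵥ hi (ψ x))) := by
  have e : (projMinus ⊗ₖ P.cbar + projPlus ⊗ₖ P.d) *ᵥ ψ x
      = inMinus (P.cbar *ᵥ lo (ψ x)) + inPlus (P.d *ᵥ hi (ψ x)) := by
    refine ext_lo_hi ?_ ?_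
    · simp [add_mulVec, lo_kronecker, projMinus, projPlus]
    · simp [add_mulVec, hi_kronecker, projMinus, projPlus]
  simp [D, spinNabla_eq, coframeMatrix, rho, Fintype.sum_sum_type, e]

/-- The spinor fields of `𝒦₁` are `D`-parallel. Only the equation in direction `-` uses
`γ₁γ₂γ₃γ₄ ξ₂ = ξ₂`, through `cbar_s_sub_s_d` and `k_i² = -b_i`. -/
theorem isParallel_spinor {ξ₁ ξ₂ : SV → ℂ} (h : gam1234 *ᵥ ξ₂ = ξ₂) :
    P.IsParallel (P.spinor ξ₁ ξ₂) := by
  have h1 : gam1234 *ᵥ ξ₂ = (1 : ℂ) • ξ₂ := by rw [h, one_smul]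
  refine ⟨P.contDiff_spinor _ _, fun μ x => ?_⟩
  rcases μ with μ | i
  · fin_cases μ
    · rw [Fin.zero_eta, D_plus, pderiv_spinor]; rfl
    · rw [Fin.mk_one, D_minus, pderiv_spinor]
      refine ext_lo_hi ?_ ?_
      · have e : ∀ i, P.cbar *ᵥ P.s i *ᵥ expVec P.d ξ₂ (x (Sum.inl 1))
            = P.s i *ᵥ P.d *ᵥ expVec P.d ξ₂ (x (Sum.inl 1))
              - P.b i • gam i *ᵥ expVec P.d ξ₂ (x (Sum.inl 1)) := by
          intro i
          rw [P.b_eq i, neg_smul, ← P.cbar_s_sub_s_d (chi_expVec (P := P) h1 _) i]; abel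
        simp only [Sum.elim_inl, cons_val_one, lo_add, lo_smul, lo_sum, lo_gPlus, lo_inMinus,
          lo_inPlus, hi_spinor, lo_spinor, mulVec_add, mulVec_smul, Matrix.mulVec_sum, e, smul_sub,
          Finset.sum_sub_distrib, lo_zero, sum_smul_smul, cons_val_zero]
        simp only [mul_smul, smul_comm (x _ : ℂ) (P.b _)]
        module
      · simp [hi_spinor]
  · rw [D_inr, pderiv_spinor]
    refine ext_lo_hi ?_ ?_
    · simp only [Sum.elim_inr, lo_sub, lo_smul, lo_gPlus, lo_inMinus, hi_spinor, lo_zero]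
      module
    · simp
end Params

/-! ### The curvature of `D` -/

theorem hasDerivAt_line {E : Type*} [NormedAddCommGroup E] [NormedSpace ℝ E] {ψ : Pt → E}
    (h : Differentiable ℝ ψ) (z v : Pt) (t : ℝ) :
    HasDerivAt (fun t : ℝ => ψ (z + t • v)) (∑ μ, v μ • pderiv μ ψ (z + t • v)) t := by
  have h1 : HasDerivAt (fun t : ℝ => z + t • v) v t := by
    simpa using ((hasDerivAt_id t).smul_const v).const_add z
  refine ((h _).hasFDerivAt.comp_hasDerivAt t h1).congr_deriv ?_
  simp only [pderiv]
  generalize fderiv ℝ ψ (z + t • v) = L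
  conv_lhs => rw [pi_eq_sum_univ' v, map_sum]
  exact Finset.sum_congr rfl fun μ _ => map_smul _ _ _

theorem pderiv_comm {E : Type*} [NormedAddCommGroup E] [NormedSpace ℝ E] {ψ : Pt → E}
    (h : ContDiff ℝ ∞ ψ) (μ ν : Idx) (x : Pt) :
    pderiv μ (pderiv ν ψ) x = pderiv ν (pderiv μ ψ) x := by
  have hs : IsSymmSndFDerivAt ℝ ψ x := by
    refine ContDiffAt.isSymmSndFDerivAt (n := ∞) h.contDiffAt ?_
    simpa using WithTop.coe_le_coe.2 (le_top : (2 : ℕ∞) ≤ ⊤)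
  have hd : DifferentiableAt ℝ (fderiv ℝ ψ) x :=
    ((h.fderiv_right (m := ∞) (by simp)).differentiable (by simp)) x
  have e : ∀ μ ν, pderiv μ (pderiv ν ψ) x
      = fderiv ℝ (fderiv ℝ ψ) x (Pi.single μ 1) (Pi.single ν 1) := by
    intro μ ν
    have : pderiv ν ψ = fun y => fderiv ℝ ψ y (Pi.single ν 1) := rfl
    rw [pderiv, this, fderiv_clm_apply hd (differentiableAt_const _)]
    simp
  rw [e, e, hs]

theorem contDiff_pderiv {E : Type*} [NormedAddCommGroup E] [NormedSpace ℝ E] {ψ : Pt → E}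
    (h : ContDiff ℝ ∞ ψ) (μ : Idx) : ContDiff ℝ ∞ (pderiv μ ψ) :=
  (h.fderiv_right (m := ∞) (by simp)).clm_apply contDiff_const

namespace Params
variable (P : Params)

/-- The curvature component `c̄ s_i - s_i d + b_i γ_i` of `D` vanishes on `ker X⁻` and is a
multiple of `γ_i` on the image of `X⁻`. -/
theorem curvature_eq (i : Fin 9) (ξ : SV → ℂ) :
    P.cbar *ᵥ P.s i *ᵥ ξ - P.s i *ᵥ P.d *ᵥ ξ + P.b i • gam i *ᵥ ξ
      = (P.sEig (-1) i ^ 2 + P.b i) • gam i *ᵥ Xminus *ᵥ ξ := by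
  set a := Xminus *ᵥ ξ with ha
  have e : ξ = (ξ - a) + a := by abel
  have h1 : gam1234 *ᵥ (ξ - a) = (1 : ℂ) • (ξ - a) := by
    rw [ha, Xminus_mulVec]
    simp only [mulVec_sub, mulVec_smul, gam1234_gam1234]
    module
  have h2 : gam1234 *ᵥ a = (-1 : ℂ) • a := by
    rw [ha, Xminus_mulVec]
    simp only [mulVec_sub, mulVec_smul, gam1234_gam1234]
    module
  have e1 := P.cbar_s_sub_s_d h1 i
  have e2 := P.cbar_s_sub_s_d h2 i
  rw [show P.sEig 1 i ^ 2 = -P.b i by rw [b_eq, neg_neg]] at e1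
  rw [e]
  simp only [mulVec_add]
  linear_combination (norm := module) e1 + e2

/-- The matrices `A_μ` with `D_μ = ∂_μ + A_μ`. -/
noncomputable def connMat (μ : Idx) (x : Pt) : Matrix SW SW ℂ := Sum.elim
  ![0, (1 / 2 : ℂ) • ∑ m, (P.b m * x (Sum.inr m)) • (gPlus ⊗ₖ gam m)
    + (projMinus ⊗ₖ P.cbar + projPlus ⊗ₖ P.d)]
  (fun i => -(1 / 2 : ℂ) • (gPlus ⊗ₖ P.s i)) μ

/-- The derivative `∂_μ A_ν`. -/
noncomputable def dconnMat (μ ν : Idx) : Matrix SW SW ℂ :=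
  if ν = Sum.inl 1 then Sum.elim (0 : Fin 2 → Matrix SW SW ℂ)
    (fun i => (1 / 2 : ℂ) • P.b i • (gPlus ⊗ₖ gam i)) μ else 0

theorem lo_connMat_inr (i : Fin 9) (x : Pt) (v : SW → ℂ) :
    lo (P.connMat (Sum.inr i) x *ᵥ v) = -rt • P.s i *ᵥ hi v := by
  simp only [connMat, Sum.elim_inr, smul_mulVec, lo_smul, lo_gPlus]
  module

theorem lo_connMat_minus (x : Pt) (v : SW → ℂ) : lo (P.connMat (Sum.inl 1) x *ᵥ v) =
    rt • ∑ m, (P.b m * x (Sum.inr m)) • gam m *ᵥ hi v + P.cbar *ᵥ lo v := by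
  simp only [connMat, Sum.elim_inl, cons_val_one, cons_val_zero, add_mulVec, smul_mulVec,
    Matrix.sum_mulVec, lo_add, lo_smul, lo_sum, lo_gPlus, sum_smul_smul]
  simp [lo_kronecker, projMinus, projPlus, smul_smul]

theorem hi_connMat_inr (i : Fin 9) (x : Pt) (v : SW → ℂ) :
    hi (P.connMat (Sum.inr i) x *ᵥ v) = 0 := by
  simp [connMat, smul_mulVec, neg_mulVec]

theorem hi_connMat_minus (x : Pt) (v : SW → ℂ) :
    hi (P.connMat (Sum.inl 1) x *ᵥ v) = P.d *ᵥ hi v := by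
  simp only [connMat, Sum.elim_inl, cons_val_one, cons_val_zero, add_mulVec, smul_mulVec,
    Matrix.sum_mulVec, hi_add, hi_smul, hi_sum, hi_gPlus]
  simp [hi_kronecker, projMinus, projPlus]

theorem D_eq (μ : Idx) (ψ : SField) (x : Pt) :
    P.D μ ψ x = pderiv μ ψ x + P.connMat μ x *ᵥ ψ x := by
  simp only [D, spinNabla_eq]
  rcases μ with μ | i
  · fin_cases μ
    · simp [coframeMatrix, rho, Fintype.sum_sum_type, connMat]
    · simp [coframeMatrix, rho, Fintype.sum_sum_type, connMat, add_mulVec, smul_mulVec,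
        Matrix.sum_mulVec, add_assoc]
  · simp [coframeMatrix, rho, Fintype.sum_sum_type, Matrix.one_apply, connMat]

/-- The matrices `A_ν` are affine functions of the coordinates. -/
theorem connMat_add (μ ν : Idx) (x : Pt) (t : ℝ) :
    P.connMat ν (x + t • Pi.single μ 1) = P.connMat ν x + (t : ℂ) • P.dconnMat μ ν := by
  rcases ν with ν | i
  · fin_cases ν
    · simp [connMat, dconnMat]
    · rcases μ with μ | i
      · simp [connMat, dconnMat]
      · simp [connMat, dconnMat, Pi.single_apply, mul_add, add_smul, Finset.sum_add_distrib,
          apply_ite Complex.ofReal]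
        module
  · simp [connMat, dconnMat]

theorem contDiff_connMat_mulVec (ν : Idx) {ψ : SField} (h : ContDiff ℝ ∞ ψ) :
    ContDiff ℝ ∞ fun x => P.connMat ν x *ᵥ ψ x := by
  have hx : ∀ μ : Idx, ContDiff ℝ ∞ (fun x : Pt => (x μ : ℂ)) := fun μ =>
    Complex.ofRealCLM.contDiff.comp (contDiff_apply ℝ ℝ μ)
  rcases ν with ν | i
  · fin_cases ν
    · simpa [connMat] using contDiff_const
    · have e : (fun x => P.connMat (Sum.inl 1) x *ᵥ ψ x) = fun x =>
          (1 / 2 : ℂ) • ∑ m, (P.b m * x (Sum.inr m)) • (gPlus ⊗ₖ gam m) *ᵥ ψ x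
          + (projMinus ⊗ₖ P.cbar + projPlus ⊗ₖ P.d) *ᵥ ψ x := by
        funext x
        simp only [connMat, Sum.elim_inl, cons_val_one, cons_val_zero, add_mulVec, smul_mulVec,
          Matrix.sum_mulVec]
      rw [Fin.mk_one, e]
      exact (ContDiff.const_smul _ (ContDiff.sum fun m _ => (contDiff_const.mul (hx _)).smul
        (contDiff_mulVec _ h))).add (contDiff_mulVec _ h)
  · exact contDiff_mulVec _ h

theorem pderiv_connMat_mulVec (μ ν : Idx) {ψ : SField} (h : ContDiff ℝ ∞ ψ) (x : Pt) :
    pderiv μ (fun x => P.connMat ν x *ᵥ ψ x) x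
      = P.dconnMat μ ν *ᵥ ψ x + P.connMat ν x *ᵥ pderiv μ ψ x := by
  refine pderiv_eq ((P.contDiff_connMat_mulVec ν h).differentiable (by simp) x) ?_
  simp only [connMat_add, add_mulVec, smul_mulVec]
  have h1 := hasDerivAt_line (h.differentiable (by simp)) x (Pi.single μ 1) 0
  have h2 : HasDerivAt (fun t : ℝ => (t : ℂ)) 1 (0 : ℝ) := Complex.ofRealCLM.hasDerivAt
  refine ((hasDerivAt_mulVec h1).add (h2.smul (hasDerivAt_mulVec h1))).congr_deriv ?_
  simp [Pi.single_apply, add_comm]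

/-- If the numbers in `curvature_eq` vanish, so does the curvature
`∂_μ A_ν - ∂_ν A_μ + [A_μ, A_ν]`. -/
theorem curvature_zero (h : ∀ i, P.sEig (-1) i ^ 2 + P.b i = 0) (μ ν : Idx) (x : Pt) (v : SW → ℂ) :
    P.dconnMat μ ν *ᵥ v + P.connMat μ x *ᵥ P.connMat ν x *ᵥ v
      = P.dconnMat ν μ *ᵥ v + P.connMat ν x *ᵥ P.connMat μ x *ᵥ v := by
  have hc : ∀ i ξ, P.cbar *ᵥ P.s i *ᵥ ξ - P.s i *ᵥ P.d *ᵥ ξ + P.b i • gam i *ᵥ ξ = 0 := by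
    intro i ξ
    rw [curvature_eq, h, zero_smul]
  have key : ∀ i, P.dconnMat (Sum.inr i) (Sum.inl 1) *ᵥ v
      + P.connMat (Sum.inr i) x *ᵥ P.connMat (Sum.inl 1) x *ᵥ v
      = P.dconnMat (Sum.inl 1) (Sum.inr i) *ᵥ v
      + P.connMat (Sum.inl 1) x *ᵥ P.connMat (Sum.inr i) x *ᵥ v := by
    intro i
    have := hc i (hi v)
    refine ext_lo_hi ?_ ?_
    · simp only [lo_add, lo_connMat_inr, lo_connMat_minus, hi_connMat_inr, hi_connMat_minus,
        dconnMat,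
        if_true, Sum.elim_inr, smul_mulVec, lo_smul, lo_gPlus, mulVec_smul, mulVec_zero, smul_zero,
        Finset.sum_const_zero, reduceCtorEq, if_false, zero_mulVec, lo_zero]
      linear_combination (norm := module) rt • this
    · simp [dconnMat, smul_mulVec, hi_connMat_inr, hi_connMat_minus, -mulVec_mulVec]
  rcases μ with μ | i <;> rcases ν with ν | j
  · fin_cases μ <;> fin_cases ν <;> simp [dconnMat, connMat]
  · fin_cases μ
    · simp [dconnMat, connMat]
    · exact (key j).symm
  · fin_cases ν
    · simp [dconnMat, connMat]
    · exact key i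
  · refine ext_lo_hi ?_ ?_ <;>
      simp [dconnMat, lo_connMat_inr, hi_connMat_inr, -mulVec_mulVec]

/-- The connection is flat if the numbers in `curvature_eq` vanish. -/
theorem isFlat_of (h : ∀ i, P.sEig (-1) i ^ 2 + P.b i = 0) : P.IsFlat := by
  have hD : ∀ ψ : SField, ∀ μ, P.D μ ψ = fun x => pderiv μ ψ x + P.connMat μ x *ᵥ ψ x :=
    fun ψ μ => funext (P.D_eq μ ψ)
  intro ψ hψ μ ν
  have key : ∀ μ ν x, P.D μ (P.D ν ψ) x = pderiv μ (pderiv ν ψ) x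
      + (P.connMat ν x *ᵥ pderiv μ ψ x + P.connMat μ x *ᵥ pderiv ν ψ x)
      + (P.dconnMat μ ν *ᵥ ψ x + P.connMat μ x *ᵥ P.connMat ν x *ᵥ ψ x) := by
    intro μ ν x
    rw [D_eq, hD ψ ν]
    have e : pderiv μ (fun x => pderiv ν ψ x + P.connMat ν x *ᵥ ψ x) x
        = pderiv μ (pderiv ν ψ) x + pderiv μ (fun x => P.connMat ν x *ᵥ ψ x) x := by
      rw [pderiv, fderiv_fun_add ((contDiff_pderiv hψ ν).differentiable (by simp) x)
        ((P.contDiff_connMat_mulVec ν hψ).differentiable (by simp) x)]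
      rfl
    rw [e, P.pderiv_connMat_mulVec μ ν hψ, mulVec_add]
    abel
  funext x
  rw [key, key, pderiv_comm hψ, curvature_zero P h μ ν, add_comm (P.connMat ν x *ᵥ _)]

end Params
namespace Params
variable {P : Params}

/-! ### Parallel spinor fields -/

theorem hasDerivAt_lo {f : ℝ → SW → ℂ} {v : SW → ℂ} {t : ℝ} (h : HasDerivAt f v t) :
    HasDerivAt (fun t => lo (f t)) (lo v) t :=
  hasDerivAt_pi.2 fun s => hasDerivAt_pi.1 h (0, s)

theorem hasDerivAt_hi {f : ℝ → SW → ℂ} {v : SW → ℂ} {t : ℝ} (h : HasDerivAt f v t) :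
    HasDerivAt (fun t => hi (f t)) (hi v) t :=
  hasDerivAt_pi.2 fun s => hasDerivAt_pi.1 h (1, s)

theorem IsParallel.hasDerivAt {ψ : SField} (h : P.IsParallel ψ) (z v : Pt) (t : ℝ) :
    HasDerivAt (fun t : ℝ => ψ (z + t • v))
      (-∑ μ, (v μ : ℂ) • P.connMat μ (z + t • v) *ᵥ ψ (z + t • v)) t := by
  refine (hasDerivAt_line (h.1.differentiable (by simp)) z v t).congr_deriv ?_
  rw [← Finset.sum_neg_distrib]
  refine Finset.sum_congr rfl fun μ _ => ?_
  have := h.2 μ (z + t • v)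
  rw [D_eq, add_eq_zero_iff_eq_neg] at this
  rw [this, smul_neg]
  rfl

theorem connMat_plus (x : Pt) : P.connMat (Sum.inl 0) x = 0 := by simp [connMat]

/-- The `S⁺`-component of a parallel spinor field depends only on `x⁻`. -/
theorem IsParallel.hi_add {ψ : SField} (h : P.IsParallel ψ) (z : Pt) {y : Pt}
    (hy : y (Sum.inl 1) = 0) : hi (ψ (z + y)) = hi (ψ z) := by
  have h1 : ∀ t : ℝ, HasDerivAt (fun t : ℝ => hi (ψ (z + t • y))) 0 t := by
    intro t
    refine (hasDerivAt_hi (h.hasDerivAt z y t)).congr_deriv ?_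
    simp only [hi_neg, hi_sum, hi_smul, Fintype.sum_sum_type, Fin.sum_univ_two, hy, connMat_plus,
      Complex.ofReal_zero, zero_smul, zero_mulVec, hi_connMat_inr, smul_zero,
      Finset.sum_const_zero, zero_add, add_zero, neg_zero]
  simpa using is_const_of_deriv_eq_zero (fun t => (h1 t).differentiableAt)
    (fun t => (h1 t).deriv) 1 0

/-- The `S⁻`-component of a parallel spinor field is affine on the hypersurfaces `x⁻ = const`. -/
theorem IsParallel.lo_add {ψ : SField} (h : P.IsParallel ψ) (z : Pt) {y : Pt}
    (hy : y (Sum.inl 1) = 0) : lo (ψ (z + y)) = lo (ψ z)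
      + rt • ∑ i, (y (Sum.inr i) : ℂ) • P.s i *ᵥ hi (ψ z) := by
  set w := rt • ∑ i, (y (Sum.inr i) : ℂ) • P.s i *ᵥ hi (ψ z) with hw
  have h1 : ∀ t : ℝ, HasDerivAt (fun t : ℝ => lo (ψ (z + t • y)) - t • w) 0 t := by
    intro t
    refine ((hasDerivAt_lo (h.hasDerivAt z y t)).sub ((hasDerivAt_id t).smul_const w)).congr_deriv
      ?_
    have hz : hi (ψ (z + t • y)) = hi (ψ z) := h.hi_add z (by simp [hy])
    rw [sub_eq_zero, one_smul, hw]
    simp only [lo_neg, lo_sum, lo_smul, Fintype.sum_sum_type, Fin.sum_univ_two, hy, connMat_plus,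
      Complex.ofReal_zero, zero_smul, zero_mulVec, lo_connMat_inr, smul_zero, add_zero,
      zero_add, hz, sum_smul_smul, neg_smul, neg_neg, smul_neg, Finset.sum_neg_distrib]
  have h2 := is_const_of_deriv_eq_zero (fun t => (h1 t).differentiableAt)
    (fun t => (h1 t).deriv) 1 0
  simp only [one_smul, zero_smul, add_zero, sub_zero] at h2
  exact sub_eq_iff_eq_add.1 h2

theorem IsParallel.hasDerivAt_minus {ψ : SField} (h : P.IsParallel ψ) (z : Pt) (t : ℝ) :
    HasDerivAt (fun t : ℝ => ψ (z + t • Pi.single (Sum.inl 1) 1))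
      (-(P.connMat (Sum.inl 1) z *ᵥ ψ (z + t • Pi.single (Sum.inl 1) 1))) t := by
  refine (h.hasDerivAt z _ t).congr_deriv ?_
  have e := P.connMat_add (Sum.inl 1) (Sum.inl 1) z t
  rw [show P.dconnMat (Sum.inl 1) (Sum.inl 1) = 0 by simp [dconnMat], smul_zero, add_zero] at e
  rw [← e, Finset.sum_eq_single (Sum.inl 1) (fun μ _ hμ => by simp [hμ]) (by simp)]
  simp

/-- A parallel spinor field is determined by its value at the origin. -/
theorem IsParallel.ext {ψ φ : SField} (hψ : P.IsParallel ψ) (hφ : P.IsParallel φ)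
    (h0 : ψ 0 = φ 0) : ψ = φ := by
  funext x
  -- Move from the origin within the hypersurface `x⁻ = 0` to `y`, then along the `x⁻`-line to `x`.
  set y : Pt := x - x (Sum.inl 1) • Pi.single (Sum.inl 1) 1 with hy
  have hy0 : y (Sum.inl 1) = 0 := by simp [hy]
  have e : ψ y = φ y := by
    rw [← zero_add y]
    refine ext_lo_hi ?_ ?_
    · rw [hψ.lo_add 0 hy0, hφ.lo_add 0 hy0, h0]
    · rw [hψ.hi_add 0 hy0, hφ.hi_add 0 hy0, h0]
  have := congrFun (eq_of_hasDerivAt _ (hψ.hasDerivAt_minus y) (hφ.hasDerivAt_minus y)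
    (by simpa using e)) (x (Sum.inl 1))
  simpa [hy] using this

/-- The value at the origin of a parallel spinor field is annihilated by the curvature. -/
theorem IsParallel.curvature {ψ : SField} (h : P.IsParallel ψ) (i : Fin 9) :
    P.cbar *ᵥ P.s i *ᵥ hi (ψ 0) - P.s i *ᵥ P.d *ᵥ hi (ψ 0) + P.b i • gam i *ᵥ hi (ψ 0) = 0 := by
  -- The derivative in `x⁻` of `ψ(z + e_i)` at `x⁻ = 0` is computed in two ways: from the
  -- equation at `z + e_i`, and by differentiating the affine expression of `ψ(z + e_i)` in terms
  -- of `ψ(z)`.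
  set y : Pt := Pi.single (Sum.inr i) 1 with hy
  have hy0 : y (Sum.inl 1) = 0 := by simp [hy]
  have e : ∀ z, lo (ψ (z + y)) = lo (ψ z) + rt • P.s i *ᵥ hi (ψ z) := by
    intro z
    rw [h.lo_add z hy0]
    simp [hy, Pi.single_apply]
  have h1 := hasDerivAt_lo (h.hasDerivAt_minus y 0)
  have h2 := (hasDerivAt_lo (h.hasDerivAt_minus 0 0)).add
    ((hasDerivAt_mulVec (M := P.s i) (hasDerivAt_hi (h.hasDerivAt_minus 0 0))).const_smul rt)
  have e2 : (fun t : ℝ => lo (ψ (y + t • Pi.single (Sum.inl 1) 1)))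
      = (fun t : ℝ => lo (ψ (0 + t • Pi.single (Sum.inl 1) 1)))
        + (rt • fun t : ℝ => P.s i *ᵥ hi (ψ (0 + t • Pi.single (Sum.inl 1) 1))) := by
    funext t
    rw [add_comm y, e, Pi.add_apply, Pi.smul_apply, zero_add]
  rw [← e2] at h2
  have h3 := h1.unique h2
  have e0 := e 0
  have e1 := h.hi_add 0 hy0
  rw [zero_add] at e0 e1
  simp only [lo_neg, hi_neg, lo_connMat_minus, hi_connMat_minus, zero_smul, add_zero, e0, e1,
    mulVec_neg, mulVec_add, mulVec_smul] at h3
  have e3 : ∑ m, (P.b m * (y (Sum.inr m) : ℂ)) • gam m *ᵥ hi (ψ 0) = P.b i • gam i *ᵥ hi (ψ 0) := by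
    rw [Finset.sum_eq_single i (fun m _ hm => by simp [hy, hm]) (by simp)]
    simp [hy]
  have e4 : ∑ m, (P.b m * ((0 : Pt) (Sum.inr m) : ℂ)) • gam m *ᵥ hi (ψ 0) = 0 := by simp
  rw [e3, e4] at h3
  have hr : rt ≠ 0 := fun h0 => by simpa [h0] using rt_sq
  refine (smul_eq_zero.1 ?_).resolve_left hr
  linear_combination (norm := module) -h3

/-- If `D` is not flat, some component of the curvature is a non-zero multiple of `γ_i X⁻`, so
that the value at the origin of a parallel spinor field satisfies `X⁻ ξ₂ = 0`. -/
theorem isNonRestricted_of_not_isFlat (h : ¬ P.IsFlat) : P.IsNonRestricted := by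
  intro ψ
  constructor
  · intro hψ
    obtain ⟨ξ, hξ, rfl⟩ := P.mem_K1.1 hψ
    exact P.isParallel_spinor hξ
  · intro hψ
    obtain ⟨i, hi⟩ : ∃ i, P.sEig (-1) i ^ 2 + P.b i ≠ 0 := by
      by_contra! h'
      exact h (P.isFlat_of h')
    have h1 := hψ.curvature i
    rw [curvature_eq, smul_eq_zero, or_iff_right hi] at h1
    have h2 : Xminus *ᵥ Params.hi (ψ 0) = 0 := by
      have := gam_gam_self i (Xminus *ᵥ Params.hi (ψ 0))
      rw [h1, mulVec_zero] at this
      exact neg_eq_zero.1 this.symm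
    refine P.mem_K1.2 ⟨(lo (ψ 0), Params.hi (ψ 0)), Xminus_eq_zero_iff.1 h2, ?_⟩
    refine hψ.ext (P.isParallel_spinor (Xminus_eq_zero_iff.1 h2)) ?_
    rw [spinor_zero]
    exact ext_lo_hi (by simp) (by simp)

end Params
namespace Params
variable {P : Params}

/-! ### Indecomposability -/

/-- If `κ_i = 0`, the line spanned by `e_i` is a non-degenerate invariant subspace. -/
theorem kap_ne_zero (h : IsIndecomposable P.B) (i : Fin 9) : P.kap i ≠ 0 := by
  intro hi
  refine h ⟨Submodule.span ℝ {Pi.single (Sum.inr i) 1}, ?_, ?_, ?_, ?_⟩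
  · rw [Ne, Submodule.span_singleton_eq_bot]
    intro e
    simpa using congrFun e (Sum.inr i)
  · intro e
    have h1 : (Pi.single (Sum.inl 0) 1 : Idx → ℝ) ∈
        Submodule.span ℝ {(Pi.single (Sum.inr i) 1 : Idx → ℝ)} := by
      rw [e]; trivial
    obtain ⟨a, ha⟩ := Submodule.mem_span_singleton.1 h1
    simpa using congrFun ha (Sum.inl 0)
  · intro v w hw
    obtain ⟨a, rfl⟩ := Submodule.mem_span_singleton.1 hw
    have e : vstarAct P.B v (a • Pi.single (Sum.inr i) 1) = 0 := by
      simp [vstarAct, eta, Matrix.mulVec_smul, B, Matrix.mulVec_diagonal, hi, Fintype.sum_sum_type,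
        dotProduct, Matrix.one_apply]
    rw [e]
    exact Submodule.zero_mem _
  · intro u hu hw
    obtain ⟨a, rfl⟩ := Submodule.mem_span_singleton.1 hu
    have := hw _ (Submodule.mem_span_singleton_self _)
    simp [eta] at this
    simp [this]

theorem k_ne_zero (h : IsIndecomposable P.B) (i : Fin 9) : P.k i ≠ 0 := by
  intro hk
  have := P.sEig_one_sq i
  rw [show P.sEig 1 i = 0 from hk] at this
  exact kap_ne_zero h i (by simpa using this.symm)

/-! ### The odd-odd bracket -/

theorem lo_c1 (ψ : SField) : lo (c1 ψ) = lo (ψ 0) := by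
  simp [c1, lo_kronecker, projMinus]

theorem hi_c1 (ψ : SField) : hi (c1 ψ) = 0 := by
  simp [c1, hi_kronecker, projMinus]

theorem lo_c2 (ψ : SField) : lo (c2 ψ) = 0 := by
  simp [c2, lo_kronecker, projPlus]

theorem hi_c2 (ψ : SField) : hi (c2 ψ) = hi (ψ 0) := by
  simp [c2, hi_kronecker, projPlus]

/-- The form `C` pairs the two components of `S(W)`. -/
theorem CW_eq (v w : SW → ℂ) :
    CW v w = Complex.I * (beta (hi v) (lo w) - beta (lo v) (hi w)) := by
  have h : ∀ u : SW → ℂ, v ⬝ᵥ u = lo v ⬝ᵥ lo u + hi v ⬝ᵥ hi u := by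
    intro u
    simp only [dotProduct, Fintype.sum_prod_type (α₁ := Fin 2), Fin.sum_univ_two]
    rfl
  rw [CW, h, lo_kronecker, hi_kronecker]
  simp [sigma2, beta]
  ring

theorem brPlus_eq (ψ φ : SField) : brPlus ψ φ
    = 2 * rt * Complex.I * beta (lo (ψ 0)) (lo (φ 0)) := by
  have e : hi ((gMinus ⊗ₖ (1 : Matrix SV SV ℂ)) *ᵥ c1 φ) = -(2 * rt) • lo (φ 0) := by
    rw [hi_kronecker, hi_c1, lo_c1, rt, mul_div_cancel₀ _ two_ne_zero]
    simp [gMinus]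
  rw [brPlus, CW_eq, Gam, Sum.elim_inl, cons_val_one, cons_val_zero, e, lo_c1, hi_c1,
    beta_zero_left, beta_smul_right]
  ring

theorem brMinus_eq (ψ φ : SField) : brMinus ψ φ
    = 2 * rt * Complex.I * beta (hi (ψ 0)) (hi (φ 0)) := by
  simp [brMinus, CW_eq, Gam, lo_c2, hi_c2, beta_smul_right, beta_zero_right]
  ring

theorem brDir_eq (i : Fin 9) (ψ φ : SField) : brDir i ψ φ =
    -Complex.I * (beta (lo (ψ 0)) (gam i *ᵥ hi (φ 0)) + beta (lo (φ 0)) (gam i *ᵥ hi (ψ 0))) := by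
  simp [brDir, CW_eq, Gam, lo_c1, hi_c1, lo_c2, hi_c2, lo_kronecker, hi_kronecker, sigmaVol,
    beta_zero_right]
  ring

theorem sBinv_eq (h : ∀ i, P.k i ≠ 0) (i : Fin 9) : P.sBinv i = (P.b i)⁻¹ • P.s i := by
  have e : P.B⁻¹ = -Matrix.diagonal (fun i => (P.kap i ^ 2)⁻¹) := by
    have hk : ∀ i, P.kap i ^ 2 ≠ 0 := fun i h0 => h i <| by
      have := P.sEig_one_sq i
      rw [← Complex.ofReal_pow, h0, Complex.ofReal_zero] at this
      exact pow_eq_zero_iff two_ne_zero |>.1 this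
    refine Matrix.inv_eq_right_inv ?_
    simp [B, hk]
  rw [sBinv, Finset.sum_eq_single i]
  · simp [e, b]
  · intro j _ h
    simp [e, Matrix.diagonal_apply_ne _ h]
  · simp

theorem brStar_eq (h : ∀ i, P.k i ≠ 0) (i : Fin 9) (ψ φ : SField) (hψ : gam1234 *ᵥ hi (ψ 0)
    = hi (ψ 0))
    (hφ : gam1234 *ᵥ hi (φ 0) = hi (φ 0)) : P.brStar i ψ φ = Complex.I * (P.k i)⁻¹ *
    (beta (lo (ψ 0)) (gam i *ᵥ gam125 *ᵥ hi (φ 0))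
      + beta (lo (φ 0)) (gam i *ᵥ gam125 *ᵥ hi (ψ 0))) := by
  have h1 : gam1234 *ᵥ hi (ψ 0) = (1 : ℂ) • hi (ψ 0) := by rw [hψ, one_smul]
  have h2 : gam1234 *ᵥ hi (φ 0) = (1 : ℂ) • hi (φ 0) := by rw [hφ, one_smul]
  have hk := h i
  simp only [brStar, CW_eq, lo_c1, hi_c1, lo_c2, hi_c2, lo_one_kronecker, hi_one_kronecker,
    sBinv_eq h,
    smul_mulVec, P.s_of_chi h1, P.s_of_chi h2, beta_smul_right, b_eq_k, mulVec_zero,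
    beta_zero_right, beta_comm _ (lo (φ 0))]
  rw [show P.sEig 1 i = P.k i from rfl]
  field_simp
  ring

/-- The coefficients of the rotations in the odd-odd bracket, on the `+1`-eigenspace of
`γ₁γ₂γ₃γ₄`. -/
theorem sd_gam_add (i j : Fin 9) (hb : block i = block j) {ξ : SV → ℂ} (h : gam1234 *ᵥ ξ = ξ) :
    (P.sd j * gam i + gam i * P.s j) *ᵥ ξ
      = P.k i • (gam i *ᵥ gam j *ᵥ gam125 *ᵥ ξ - gam j *ᵥ gam i *ᵥ gam125 *ᵥ ξ) := by
  have h1 : gam1234 *ᵥ ξ = (1 : ℂ) • ξ := by rw [h, one_smul]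
  have h2 : gam1234 *ᵥ gam j *ᵥ gam i *ᵥ ξ = (1 : ℂ) • gam j *ᵥ gam i *ᵥ ξ := by
    rw [chi_gam (chi_gam h1 i) j, hsgn_eq_of_block hb, mul_one, hsgn_mul_self]
  have h3 : gam125 *ᵥ gam j *ᵥ gam i *ᵥ ξ = gam j *ᵥ gam i *ᵥ gam125 *ᵥ ξ := by
    rw [gam125_gam, gam125_gam, mulVec_smul, smul_smul, eps_eq_of_block hb, eps_mul_self, one_smul]
  have hc : P.cEig 1 j = P.cEig 1 i := by
    rw [cEig, cEig, eps_eq_of_block hb, hsgn_eq_of_block hb]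
  rw [add_mulVec, ← mulVec_mulVec, ← mulVec_mulVec, sd_mulVec, s_mulVec, P.d_of_chi h2, h3,
    P.cbar_gam h1, P.cbar_gam h1, P.d_of_chi h1, hc, k, sEig]
  simp only [mulVec_sub, mulVec_smul]
  module

/-- The odd-odd bracket on `𝒦₁` is given by `obr`. Since `B` is invertible, `s(B⁻¹ e_i)` is
`b_i⁻¹ s_i`, which accounts for the factors `k_i⁻¹` in `obr`. -/
theorem oddBr_eq (h : ∀ i, P.k i ≠ 0) {ψ φ : SField} (hψ : gam1234 *ᵥ hi (ψ 0) = hi (ψ 0))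
    (hφ : gam1234 *ᵥ hi (φ 0) = hi (φ 0)) : P.oddBr ψ φ
      = P.field (P.obr (lo (ψ 0), hi (ψ 0)) (lo (φ 0), hi (φ 0))) := by
  have hR : ∀ i j, (if block i = block j then P.brRot i j ψ φ • KRot i j else 0)
      = (P.obr (lo (ψ 0), hi (ψ 0)) (lo (φ 0), hi (φ 0))).R i j • KRot i j := by
    intro i j
    split_ifs with hb
    · congr 1
      simp only [brRot, CW_eq, Gam, Sum.elim_inl, cons_val_zero, lo_gPlus, hi_gPlus,
        hi_one_kronecker, one_mulVec, lo_c2, hi_c2, sd_gam_add i j hb hφ, obr, rotBr,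
        Matrix.smul_apply, of_apply, if_pos hb, smul_eq_mul, beta_smul_right, beta_sub_right,
        beta_zero_left]
      rw [show P.sEig 1 i = P.k i from rfl]
      ring
    · rw [(isRot_obr _ _).eq_zero i j hb, zero_smul]
  rw [field_eq_sum P (isRot_obr _ _), oddBr]
  simp only [hR, brPlus_eq, brMinus_eq, brDir_eq, brStar_eq h _ ψ φ hψ hφ]
  rfl

end Params

/-! ### The superalgebra in the algebraic model -/

noncomputable instance : Zero Coef := ⟨⟨0, 0, 0, 0, 0⟩⟩

namespace Coef
@[simp] theorem zero_p : (0 : Coef).p = 0 := rfl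
@[simp] theorem zero_m : (0 : Coef).m = 0 := rfl
@[simp] theorem zero_u : (0 : Coef).u = 0 := rfl
@[simp] theorem zero_v : (0 : Coef).v = 0 := rfl
@[simp] theorem zero_R : (0 : Coef).R = 0 := rfl
end Coef

theorem isRot_zero : IsRot (0 : Coef).R := ⟨by simp, by simp⟩

namespace Params

section
variable (P : Params)

/-- The spinor fields of `𝒦₁` as a linear function of `(ξ₁, ξ₂)`. -/
noncomputable def spinorLin : (SV → ℂ) × (SV → ℂ) →ₗ[ℂ] SField where
  toFun ξ := P.spinor ξ.1 ξ.2
  map_add' ξ η := P.spinor_add ξ.1 ξ.2 η.1 η.2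
  map_smul' c ξ := P.spinor_smul c ξ.1 ξ.2

theorem field_zero : P.field 0 = 0 := by
  rw [field_eq_sum P isRot_zero]
  simp

end

variable {P : Params}

theorem br_zero_left (c : Coef) : P.br 0 c = 0 := by ext <;> simp [br]
theorem br_zero_right (c : Coef) : P.br c 0 = 0 := by ext <;> simp [br]

theorem act_zero_left (ξ : (SV → ℂ) × (SV → ℂ)) : P.act 0 ξ = 0 := by
  ext <;> simp [act, cl, rot]

theorem act_zero_right (c : Coef) : P.act c 0 = 0 := by
  simpa using act_smul_right (P := P) 0 c 0

theorem obr_zero_left (ξ : (SV → ℂ) × (SV → ℂ)) : P.obr 0 ξ = 0 := by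
  ext <;> simp [obr, beta_zero_left, beta_zero_right, rotBr]

theorem obr_zero_right (ξ : (SV → ℂ) × (SV → ℂ)) : P.obr ξ 0 = 0 := by
  rw [obr_comm, obr_zero_left]

theorem mem_K1' {ψ : SField} :
    ψ ∈ P.K1 ↔ ∃ ξ : (SV → ℂ) × (SV → ℂ), gam1234 *ᵥ ξ.2 = ξ.2 ∧ ψ = P.spinorLin ξ :=
  P.mem_K1

theorem spinLie_spinorLin {c : Coef} (hc : IsRot c.R) {ξ : (SV → ℂ) × (SV → ℂ)}
    (hξ : gam1234 *ᵥ ξ.2 = ξ.2) :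
    spinLie P.B (P.field c) (P.spinorLin ξ) = P.spinorLin (P.act c ξ) :=
  P.spinLie_spinor hc hξ

theorem spinorLin_injective : Function.Injective P.spinorLin := by
  refine (injective_iff_map_eq_zero _).2 fun ξ h => ?_
  have h0 : P.spinor ξ.1 ξ.2 0 = 0 := congrFun h 0
  rw [spinor_zero] at h0
  exact Prod.ext (by simpa using congrArg lo h0) (by simpa using congrArg hi h0)

theorem oddBr_spinorLin (h : ∀ i, P.k i ≠ 0) {ξ η : (SV → ℂ) × (SV → ℂ)}
    (hξ : gam1234 *ᵥ ξ.2 = ξ.2) (hη : gam1234 *ᵥ η.2 = η.2) :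
    P.oddBr (P.spinorLin ξ) (P.spinorLin η) = P.field (P.obr ξ η) := by
  have e : ∀ ξ, P.spinorLin ξ 0 = inMinus ξ.1 + inPlus ξ.2 := fun ξ => P.spinor_zero _ _
  rw [oddBr_eq h (by simpa [e] using hξ) (by simpa [e] using hη)]
  simp [e]

/-- The bracket of the superalgebra in the algebraic model. -/
theorem bracket_eq (h : ∀ i, P.k i ≠ 0) {c c' : Coef} {ξ ξ' : (SV → ℂ) × (SV → ℂ)}
    (hc : IsRot c.R) (hc' : IsRot c'.R) (hξ : gam1234 *ᵥ ξ.2 = ξ.2) (hξ' : gam1234 *ᵥ ξ'.2 = ξ'.2) :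
    P.bracket (P.field c, P.spinorLin ξ) (P.field c', P.spinorLin ξ')
      = (P.field (P.br c c') + P.field (P.obr ξ ξ'),
        P.spinorLin (P.act c ξ') - P.spinorLin (P.act c' ξ)) := by
  rw [bracket, lieBr_field P hc hc', oddBr_spinorLin h hξ hξ', spinLie_spinorLin hc hξ',
    spinLie_spinorLin hc' hξ]

theorem mem_part_zero {x : VField × SField} :
    x ∈ P.part 0 ↔ ∃ c : Coef, IsRot c.R ∧ x = (P.field c, P.spinorLin 0) := by
  rw [part, if_pos rfl, Submodule.mem_prod, Submodule.mem_bot, mem_K0, map_zero]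
  constructor
  · rintro ⟨⟨c, hc, h1⟩, h2⟩
    exact ⟨c, hc, Prod.ext h1 h2⟩
  · rintro ⟨c, hc, rfl⟩
    exact ⟨⟨c, hc, rfl⟩, rfl⟩

theorem mem_part_one {x : VField × SField} : x ∈ P.part 1 ↔
    ∃ ξ : (SV → ℂ) × (SV → ℂ), gam1234 *ᵥ ξ.2 = ξ.2 ∧ x = (P.field 0, P.spinorLin ξ) := by
  rw [part, if_neg (by decide), Submodule.mem_prod, Submodule.mem_bot, mem_K1', field_zero]
  constructor
  · rintro ⟨h1, ξ, hξ, h2⟩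
    exact ⟨ξ, hξ, Prod.ext h1 h2⟩
  · rintro ⟨ξ, hξ, rfl⟩
    exact ⟨rfl, ξ, hξ, rfl⟩

theorem mem_part_sup {x : VField × SField} : x ∈ P.part 0 ⊔ P.part 1 ↔
    ∃ (c : Coef) (ξ : (SV → ℂ) × (SV → ℂ)), IsRot c.R ∧ gam1234 *ᵥ ξ.2 = ξ.2 ∧
      x = (P.field c, P.spinorLin ξ) := by
  rw [Submodule.mem_sup]
  constructor
  · rintro ⟨y, hy, z, hz, rfl⟩
    obtain ⟨c, hc, rfl⟩ := mem_part_zero.1 hy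
    obtain ⟨ξ, hξ, rfl⟩ := mem_part_one.1 hz
    exact ⟨c, ξ, hc, hξ, by simp [field_zero]⟩
  · rintro ⟨c, ξ, hc, hξ, rfl⟩
    exact ⟨_, mem_part_zero.2 ⟨c, hc, rfl⟩, _, mem_part_one.2 ⟨ξ, hξ, rfl⟩, by simp [field_zero]⟩

theorem br_isRot {c c' : Coef} (hc : IsRot c.R) (hc' : IsRot c'.R) : IsRot (P.br c c').R :=
  hc.bracket hc'

theorem zmod_two (i : ZMod 2) : i = 0 ∨ i = 1 := by revert i; decide

theorem chi_zero : gam1234 *ᵥ (0 : (SV → ℂ) × (SV → ℂ)).2 = (0 : (SV → ℂ) × (SV → ℂ)).2 := by simp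

theorem br_skew (c c' : Coef) : P.field (P.br c c') = -P.field (P.br c' c) := by
  have : P.br c c' = (-1 : ℂ) • P.br c' c := by
    ext
    · simp only [br, Coef.smul_p, dotProduct, Pi.mul_apply, ← Finset.sum_sub_distrib,
        Finset.mul_sum]
      exact Finset.sum_congr rfl fun i _ => by ring
    all_goals simp [br]
    all_goals ring
  rw [this, field_smul, neg_one_smul]

theorem bracket_even_even (h : ∀ i, P.k i ≠ 0) {c c' : Coef} (hc : IsRot c.R) (hc' : IsRot c'.R) :
    P.bracket (P.field c, P.spinorLin 0) (P.field c', P.spinorLin 0)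
      = (P.field (P.br c c'), P.spinorLin 0) := by
  rw [bracket_eq h hc hc' chi_zero chi_zero]
  simp [act_zero_right, obr_zero_right, field_zero]

theorem bracket_even_odd (h : ∀ i, P.k i ≠ 0) {c : Coef} {ξ : (SV → ℂ) × (SV → ℂ)}
    (hc : IsRot c.R) (hξ : gam1234 *ᵥ ξ.2 = ξ.2) :
    P.bracket (P.field c, P.spinorLin 0) (P.field 0, P.spinorLin ξ)
      = (P.field 0, P.spinorLin (P.act c ξ)) := by
  rw [bracket_eq h hc isRot_zero chi_zero hξ]
  simp [act_zero_left, obr_zero_left, field_zero, br_zero_right]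

theorem bracket_odd_even (h : ∀ i, P.k i ≠ 0) {c : Coef} {ξ : (SV → ℂ) × (SV → ℂ)}
    (hc : IsRot c.R) (hξ : gam1234 *ᵥ ξ.2 = ξ.2) :
    P.bracket (P.field 0, P.spinorLin ξ) (P.field c, P.spinorLin 0)
      = (P.field 0, P.spinorLin (-P.act c ξ)) := by
  rw [bracket_eq h isRot_zero hc hξ chi_zero]
  simp [act_zero_left, obr_zero_right, field_zero, br_zero_left]

theorem bracket_odd_odd (h : ∀ i, P.k i ≠ 0) {ξ η : (SV → ℂ) × (SV → ℂ)}
    (hξ : gam1234 *ᵥ ξ.2 = ξ.2) (hη : gam1234 *ᵥ η.2 = η.2) :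
    P.bracket (P.field 0, P.spinorLin ξ) (P.field 0, P.spinorLin η)
      = (P.field (P.obr ξ η), P.spinorLin 0) := by
  rw [bracket_eq h isRot_zero isRot_zero hξ hη]
  simp [act_zero_left, br_zero_left, field_zero]

theorem chi_neg_act {c : Coef} (hc : IsRot c.R) {ξ : (SV → ℂ) × (SV → ℂ)}
    (hξ : gam1234 *ᵥ ξ.2 = ξ.2) : gam1234 *ᵥ (-P.act c ξ).2 = (-P.act c ξ).2 := by
  rw [Prod.snd_neg, mulVec_neg, chi_act hc hξ]

theorem isSuperalgebra (h : ∀ i, P.k i ≠ 0) : IsSuperalgebra P.bracket P.part where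
  direct := by
    rw [Submodule.disjoint_def]
    intro x hx hx'
    obtain ⟨c, hc, rfl⟩ := mem_part_zero.1 hx
    obtain ⟨ξ, hξ, e⟩ := mem_part_one.1 hx'
    refine Prod.ext ?_ (map_zero _)
    rw [congrArg Prod.fst e, field_zero]
    rfl
  closed i j x hx y hy := by
    rcases zmod_two i with rfl | rfl <;> rcases zmod_two j with rfl | rfl
    · obtain ⟨c, hc, rfl⟩ := mem_part_zero.1 hx
      obtain ⟨c', hc', rfl⟩ := mem_part_zero.1 hy
      exact mem_part_zero.2 ⟨_, br_isRot hc hc', bracket_even_even h hc hc'⟩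
    · obtain ⟨c, hc, rfl⟩ := mem_part_zero.1 hx
      obtain ⟨ξ, hξ, rfl⟩ := mem_part_one.1 hy
      exact mem_part_one.2 ⟨_, chi_act hc hξ, bracket_even_odd h hc hξ⟩
    · obtain ⟨c, hc, rfl⟩ := mem_part_zero.1 hy
      obtain ⟨ξ, hξ, rfl⟩ := mem_part_one.1 hx
      exact mem_part_one.2 ⟨_, chi_neg_act hc hξ, bracket_odd_even h hc hξ⟩
    · obtain ⟨ξ, hξ, rfl⟩ := mem_part_one.1 hx
      obtain ⟨η, hη, rfl⟩ := mem_part_one.1 hy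
      exact mem_part_zero.2 ⟨_, isRot_obr ξ η, bracket_odd_odd h hξ hη⟩
  add_left x hx y hy z hz := by
    obtain ⟨c, ξ, hc, hξ, rfl⟩ := mem_part_sup.1 hx
    obtain ⟨c', ξ', hc', hξ', rfl⟩ := mem_part_sup.1 hy
    obtain ⟨c'', ξ'', hc'', hξ'', rfl⟩ := mem_part_sup.1 hz
    have hs : gam1234 *ᵥ (ξ + ξ').2 = (ξ + ξ').2 := by rw [Prod.snd_add, mulVec_add, hξ, hξ']
    rw [Prod.mk_add_mk, ← field_add, ← map_add, bracket_eq h (hc.add hc') hc'' hs hξ'',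
      bracket_eq h hc hc'' hξ hξ'', bracket_eq h hc' hc'' hξ' hξ'', br_add_left, obr_add_left,
      act_add_left, act_add_right]
    simp only [field_add, map_add]
    ext1 <;> simp only [Prod.fst_add, Prod.snd_add] <;> abel
  add_right z hz x hx y hy := by
    obtain ⟨c, ξ, hc, hξ, rfl⟩ := mem_part_sup.1 hx
    obtain ⟨c', ξ', hc', hξ', rfl⟩ := mem_part_sup.1 hy
    obtain ⟨c'', ξ'', hc'', hξ'', rfl⟩ := mem_part_sup.1 hz
    have hs : gam1234 *ᵥ (ξ + ξ').2 = (ξ + ξ').2 := by rw [Prod.snd_add, mulVec_add, hξ, hξ']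
    rw [Prod.mk_add_mk, ← field_add, ← map_add, bracket_eq h hc'' (hc.add hc') hξ'' hs,
      bracket_eq h hc'' hc hξ'' hξ, bracket_eq h hc'' hc' hξ'' hξ', br_add_right, obr_add_right,
      act_add_left, act_add_right]
    simp only [field_add, map_add]
    ext1 <;> simp only [Prod.fst_add, Prod.snd_add] <;> abel
  smul_left t x hx y hy := by
    obtain ⟨c, ξ, hc, hξ, rfl⟩ := mem_part_sup.1 hx
    obtain ⟨c', ξ', hc', hξ', rfl⟩ := mem_part_sup.1 hy
    have hs : gam1234 *ᵥ (t • ξ).2 = (t • ξ).2 := by rw [Prod.smul_snd, mulVec_smul, hξ]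
    rw [Prod.smul_mk, ← field_smul, ← map_smul, bracket_eq h (hc.smul t) hc' hs hξ',
      bracket_eq h hc hc' hξ hξ', br_smul_left, obr_smul_left, act_smul_left, act_smul_right]
    simp only [field_smul, map_smul, Prod.smul_mk, smul_add, smul_sub]
  smul_right t y hy x hx := by
    obtain ⟨c, ξ, hc, hξ, rfl⟩ := mem_part_sup.1 hx
    obtain ⟨c', ξ', hc', hξ', rfl⟩ := mem_part_sup.1 hy
    have hs : gam1234 *ᵥ (t • ξ).2 = (t • ξ).2 := by rw [Prod.smul_snd, mulVec_smul, hξ]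
    rw [Prod.smul_mk, ← field_smul, ← map_smul, bracket_eq h hc' (hc.smul t) hξ' hs,
      bracket_eq h hc' hc hξ' hξ, br_smul_right, obr_smul_right, act_smul_left, act_smul_right]
    simp only [field_smul, map_smul, Prod.smul_mk, smul_add, smul_sub]
  skew i j x hx y hy := by
    rcases zmod_two i with rfl | rfl <;> rcases zmod_two j with rfl | rfl
    · obtain ⟨c, hc, rfl⟩ := mem_part_zero.1 hx
      obtain ⟨c', hc', rfl⟩ := mem_part_zero.1 hy
      rw [bracket_even_even h hc hc', bracket_even_even h hc' hc, br_skew]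
      simp
    · obtain ⟨c, hc, rfl⟩ := mem_part_zero.1 hx
      obtain ⟨ξ, hξ, rfl⟩ := mem_part_one.1 hy
      rw [bracket_even_odd h hc hξ, bracket_odd_even h hc hξ]
      simp [field_zero]
    · obtain ⟨c, hc, rfl⟩ := mem_part_zero.1 hy
      obtain ⟨ξ, hξ, rfl⟩ := mem_part_one.1 hx
      rw [bracket_even_odd h hc hξ, bracket_odd_even h hc hξ]
      simp [field_zero]
    · obtain ⟨ξ, hξ, rfl⟩ := mem_part_one.1 hx
      obtain ⟨η, hη, rfl⟩ := mem_part_one.1 hy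
      rw [bracket_odd_odd h hξ hη, bracket_odd_odd h hη hξ, obr_comm η ξ]
      simp [ZMod.val_one]

theorem isGeometricSuperalgebra (h : ∀ i, P.k i ≠ 0) : P.IsGeometricSuperalgebra where
  superalgebra := isSuperalgebra h
  killing X hX := by
    obtain ⟨c, hc, rfl⟩ := P.mem_K0.1 hX
    exact P.isKilling_field hc
  parallel ψ hψ := by
    obtain ⟨ξ, hξ, rfl⟩ := mem_K1'.1 hψ
    exact P.isParallel_spinor hξ
  even_jacobi X hX Y hY Z hZ := by
    obtain ⟨c, hc, rfl⟩ := P.mem_K0.1 hX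
    obtain ⟨c', hc', rfl⟩ := P.mem_K0.1 hY
    obtain ⟨c'', hc'', rfl⟩ := P.mem_K0.1 hZ
    rw [lieBr_field P hc' hc'', lieBr_field P hc hc', lieBr_field P hc'' hc,
      lieBr_field P hc (br_isRot hc' hc''), lieBr_field P hc'' (br_isRot hc hc'),
      lieBr_field P hc' (br_isRot hc'' hc), ← field_add, ← field_add, br_jacobi hc hc' hc'']
    exact P.field_zero
  action X hX Y hY ψ hψ := by
    obtain ⟨c, hc, rfl⟩ := P.mem_K0.1 hX
    obtain ⟨c', hc', rfl⟩ := P.mem_K0.1 hY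
    obtain ⟨ξ, hξ, rfl⟩ := mem_K1'.1 hψ
    rw [lieBr_field P hc hc', spinLie_spinorLin (br_isRot hc hc') hξ, spinLie_spinorLin hc hξ,
      spinLie_spinorLin hc' hξ, spinLie_spinorLin hc (chi_act hc' hξ),
      spinLie_spinorLin hc' (chi_act hc hξ), act_br hc hc' hξ, map_sub]
  equivariant X hX ψ hψ φ hφ := by
    obtain ⟨c, hc, rfl⟩ := P.mem_K0.1 hX
    obtain ⟨ξ, hξ, rfl⟩ := mem_K1'.1 hψ
    obtain ⟨η, hη, rfl⟩ := mem_K1'.1 hφ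
    rw [oddBr_spinorLin h hξ hη, lieBr_field P hc (isRot_obr _ _), spinLie_spinorLin hc hξ,
      spinLie_spinorLin hc hη, oddBr_spinorLin h (chi_act hc hξ) hη,
      oddBr_spinorLin h hξ (chi_act hc hη), ← field_add, obr_act h hc hξ hη]

end Params
namespace Params
variable {P : Params}

/-! ### The graded Jacobi identity -/

theorem field_br_jacobi {c c' c'' : Coef} (hc : IsRot c.R) (hc' : IsRot c'.R) (hc'' : IsRot c''.R) :
    P.field (P.br c (P.br c' c'')) + P.field (P.br c'' (P.br c c'))
      + P.field (P.br c' (P.br c'' c)) = 0 := by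
  rw [← field_add, ← field_add, br_jacobi hc hc' hc'']
  exact P.field_zero

theorem spinorLin_act_br {c c' : Coef} (hc : IsRot c.R) (hc' : IsRot c'.R)
    {ξ : (SV → ℂ) × (SV → ℂ)} (hξ : gam1234 *ᵥ ξ.2 = ξ.2) : P.spinorLin (P.act (P.br c c') ξ)
      = P.spinorLin (P.act c (P.act c' ξ)) - P.spinorLin (P.act c' (P.act c ξ)) := by
  rw [act_br hc hc' hξ, map_sub]

theorem act_neg_right (c : Coef) (ξ : (SV → ℂ) × (SV → ℂ)) : P.act c (-ξ) = -P.act c ξ := by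
  simpa using act_smul_right (P := P) (-1) c ξ

theorem field_obr_neg_left (ξ η : (SV → ℂ) × (SV → ℂ)) :
    P.field (P.obr (-ξ) η) = -P.field (P.obr ξ η) := by
  rw [← neg_one_smul ℂ ξ, obr_smul_left, field_smul, neg_one_smul]

theorem field_obr_neg_right (ξ η : (SV → ℂ) × (SV → ℂ)) :
    P.field (P.obr ξ (-η)) = -P.field (P.obr ξ η) := by
  rw [obr_comm, field_obr_neg_left, obr_comm]

theorem field_obr_act (h : ∀ i, P.k i ≠ 0) {c : Coef} (hc : IsRot c.R) {ξ η : (SV → ℂ) × (SV → ℂ)}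
    (hξ : gam1234 *ᵥ ξ.2 = ξ.2) (hη : gam1234 *ᵥ η.2 = η.2) :
    P.field (P.br c (P.obr ξ η))
      = P.field (P.obr (P.act c ξ) η) + P.field (P.obr ξ (P.act c η)) := by
  rw [← obr_act h hc hξ hη, field_add]

theorem isLieSuperalgebra (h : ∀ i, P.k i ≠ 0) (hP : P.ap = -3 * P.ap') :
    IsLieSuperalgebra P.bracket P.part where
  toIsSuperalgebra := isSuperalgebra h
  jacobi i j l x hx y hy z hz := by
    rcases zmod_two i with rfl | rfl <;> rcases zmod_two j with rfl | rfl <;>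
      rcases zmod_two l with rfl | rfl
    · obtain ⟨a, ha, rfl⟩ := mem_part_zero.1 hx
      obtain ⟨b, hb, rfl⟩ := mem_part_zero.1 hy
      obtain ⟨c, hc, rfl⟩ := mem_part_zero.1 hz
      rw [bracket_even_even h hb hc, bracket_even_even h ha hb, bracket_even_even h hc ha,
        bracket_even_even h ha (br_isRot hb hc), bracket_even_even h hc (br_isRot ha hb),
        bracket_even_even h hb (br_isRot hc ha)]
      simp [field_br_jacobi ha hb hc]
    · obtain ⟨a, ha, rfl⟩ := mem_part_zero.1 hx
      obtain ⟨b, hb, rfl⟩ := mem_part_zero.1 hy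
      obtain ⟨ζ, hζ, rfl⟩ := mem_part_one.1 hz
      rw [bracket_even_odd h hb hζ, bracket_even_even h ha hb, bracket_odd_even h ha hζ,
        bracket_even_odd h ha (chi_act hb hζ), bracket_odd_even h (br_isRot ha hb) hζ,
        bracket_even_odd h hb (chi_neg_act ha hζ)]
      simp [field_zero, act_neg_right, spinorLin_act_br ha hb hζ]
    · obtain ⟨a, ha, rfl⟩ := mem_part_zero.1 hx
      obtain ⟨η, hη, rfl⟩ := mem_part_one.1 hy
      obtain ⟨c, hc, rfl⟩ := mem_part_zero.1 hz
      rw [bracket_odd_even h hc hη, bracket_even_odd h ha hη, bracket_even_even h hc ha,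
        bracket_even_odd h ha (chi_neg_act hc hη), bracket_even_odd h hc (chi_act ha hη),
        bracket_odd_even h (br_isRot hc ha) hη]
      simp [field_zero, act_neg_right, spinorLin_act_br hc ha hη]
    · obtain ⟨a, ha, rfl⟩ := mem_part_zero.1 hx
      obtain ⟨η, hη, rfl⟩ := mem_part_one.1 hy
      obtain ⟨ζ, hζ, rfl⟩ := mem_part_one.1 hz
      rw [bracket_odd_odd h hη hζ, bracket_even_odd h ha hη, bracket_odd_even h ha hζ,
        bracket_even_even h ha (isRot_obr _ _), bracket_odd_odd h hζ (chi_act ha hη),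
        bracket_odd_odd h hη (chi_neg_act ha hζ)]
      simp [ZMod.val_one, field_obr_neg_right, field_obr_act h ha hη hζ, obr_comm ζ]
    · obtain ⟨ξ, hξ, rfl⟩ := mem_part_one.1 hx
      obtain ⟨b, hb, rfl⟩ := mem_part_zero.1 hy
      obtain ⟨c, hc, rfl⟩ := mem_part_zero.1 hz
      rw [bracket_even_even h hb hc, bracket_odd_even h hb hξ, bracket_even_odd h hc hξ,
        bracket_odd_even h (br_isRot hb hc) hξ, bracket_even_odd h hc (chi_neg_act hb hξ),
        bracket_even_odd h hb (chi_act hc hξ)]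
      simp [field_zero, act_neg_right, spinorLin_act_br hb hc hξ]
      abel
    · obtain ⟨ξ, hξ, rfl⟩ := mem_part_one.1 hx
      obtain ⟨b, hb, rfl⟩ := mem_part_zero.1 hy
      obtain ⟨ζ, hζ, rfl⟩ := mem_part_one.1 hz
      rw [bracket_even_odd h hb hζ, bracket_odd_even h hb hξ, bracket_odd_odd h hζ hξ,
        bracket_odd_odd h hξ (chi_act hb hζ), bracket_odd_odd h hζ (chi_neg_act hb hξ),
        bracket_even_even h hb (isRot_obr _ _)]
      simp [ZMod.val_one, field_obr_neg_right, field_obr_act h hb hζ hξ, obr_comm ξ]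
      abel
    · obtain ⟨ξ, hξ, rfl⟩ := mem_part_one.1 hx
      obtain ⟨η, hη, rfl⟩ := mem_part_one.1 hy
      obtain ⟨c, hc, rfl⟩ := mem_part_zero.1 hz
      rw [bracket_odd_even h hc hη, bracket_odd_odd h hξ hη, bracket_even_odd h hc hξ,
        bracket_odd_odd h hξ (chi_neg_act hc hη), bracket_even_even h hc (isRot_obr _ _),
        bracket_odd_odd h hη (chi_act hc hξ)]
      simp [ZMod.val_one, field_obr_neg_right, field_obr_act h hc hξ hη, obr_comm η]
    · obtain ⟨ξ, hξ, rfl⟩ := mem_part_one.1 hx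
      obtain ⟨η, hη, rfl⟩ := mem_part_one.1 hy
      obtain ⟨ζ, hζ, rfl⟩ := mem_part_one.1 hz
      rw [bracket_odd_odd h hη hζ, bracket_odd_odd h hξ hη, bracket_odd_odd h hζ hξ,
        bracket_odd_even h (isRot_obr _ _) hξ, bracket_odd_even h (isRot_obr _ _) hζ,
        bracket_odd_even h (isRot_obr _ _) hη]
      -- The Jacobi identity for three odd elements is the polarisation of the one for equal
      -- elements.
      let S : AddSubmonoid ((SV → ℂ) × (SV → ℂ)) :=
        { carrier := {ξ | gam1234 *ᵥ ξ.2 = ξ.2}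
          add_mem' := fun {ξ η} (hξ : gam1234 *ᵥ ξ.2 = ξ.2) (hη : gam1234 *ᵥ η.2 = η.2) => by
            change gam1234 *ᵥ (ξ.2 + η.2) = ξ.2 + η.2
            rw [mulVec_add, hξ, hη]
          zero_mem' := chi_zero }
      have key := cyclic_sum_eq_zero (fun x y z => P.act (P.obr x y) z)
        (fun x x' y z => by rw [obr_add_left, act_add_left])
        (fun x y y' z => by rw [obr_add_right, act_add_left])
        (fun x y z z' => by rw [act_add_right]) (fun x y z => by rw [obr_comm]) S
        (fun x hx => (act_obr_eq_zero_iff h).2 hP x hx) (x := ξ) (y := η) (z := ζ) hξ hη hζ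
      have key2 := congrArg P.spinorLin key
      simp only [map_add, map_zero] at key2
      simpa [ZMod.val_one, field_zero] using key2

/-- For three equal odd elements the graded Jacobi identity reads `3 [ξ, {ξ, ξ}] = 0`, which by
`act_obr_eq_zero_iff` forces `α₊ = -3 α₊'`. -/
theorem isGeometricSupersymmetry_iff (h : ∀ i, P.k i ≠ 0) :
    P.IsGeometricSupersymmetry ↔ P.ap = -3 * P.ap' := by
  refine ⟨fun hs => (act_obr_eq_zero_iff h).1 fun ξ hξ => ?_,
    fun hP => ⟨isGeometricSuperalgebra h, isLieSuperalgebra h hP⟩⟩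
  have hx : (P.field 0, P.spinorLin ξ) ∈ P.part 1 := mem_part_one.2 ⟨ξ, hξ, rfl⟩
  have hj := congrArg Prod.snd (hs.2.jacobi 1 1 1 _ hx _ hx _ hx)
  rw [bracket_odd_odd h hξ hξ, bracket_odd_even h (isRot_obr _ _) hξ] at hj
  have h3 : (3 : ℂ) • P.spinorLin (P.act (P.obr ξ ξ) ξ) = 0 := by
    simp only [ZMod.val_one, mul_one, pow_one, Prod.snd_add, Prod.smul_snd, map_neg,
      Prod.snd_zero] at hj
    linear_combination (norm := module) hj
  exact spinorLin_injective (((smul_eq_zero.1 h3).resolve_left (by norm_num)).trans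
    (map_zero _).symm)

/-! ### The dimension of `𝒦₁` -/

/-- Clifford multiplication by `γ₁` anticommutes with `γ₁γ₂γ₃γ₄` and hence exchanges the kernel
and the image of `X⁻`. -/
theorem finrank_ker_Xminus : Module.finrank ℂ (LinearMap.ker (Matrix.mulVecLin Xminus)) = 8 := by
  have hinj : Function.Injective (Matrix.mulVecLin (gam 0)) := by
    refine (injective_iff_map_eq_zero _).2 fun ξ (h : gam 0 *ᵥ ξ = 0) => ?_
    have := gam_gam_self 0 ξ
    rw [h, mulVec_zero] at this
    exact neg_eq_zero.1 this.symm
  have h0 : ∀ ξ, gam1234 *ᵥ gam 0 *ᵥ ξ = -(gam 0 *ᵥ gam1234 *ᵥ ξ) := by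
    intro ξ
    rw [gam1234_gam]
    simp [hsgn]
  have hr : LinearMap.range (Matrix.mulVecLin Xminus)
      = (LinearMap.ker (Matrix.mulVecLin Xminus)).map (Matrix.mulVecLin (gam 0)) := by
    ext ξ
    simp only [LinearMap.mem_range, Submodule.mem_map, LinearMap.mem_ker, mulVecLin_apply,
      Xminus_eq_zero_iff]
    constructor
    · rintro ⟨η, rfl⟩
      refine ⟨-(gam 0 *ᵥ Xminus *ᵥ η), ?_, ?_⟩
      · rw [mulVec_neg, h0, Xminus_mulVec]
        simp only [mulVec_sub, mulVec_smul, gam1234_gam1234]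
        module
      · rw [mulVec_neg, gam_gam_self, neg_neg]
    · rintro ⟨η, hη, rfl⟩
      refine ⟨gam 0 *ᵥ η, ?_⟩
      rw [Xminus_mulVec, h0, hη]
      module
  have h1 := LinearMap.finrank_range_add_finrank_ker (Matrix.mulVecLin Xminus)
  rw [hr, ← (Submodule.equivMapOfInjective _ hinj _).finrank_eq] at h1
  simp at h1
  omega

theorem finrank_K1 : Module.finrank ℂ P.K1 = 24 := by
  let N := LinearMap.ker (Matrix.mulVecLin Xminus)
  let F : ((SV → ℂ) × N) →ₗ[ℂ] SField := P.spinorLin ∘ₗ LinearMap.prodMap LinearMap.id N.subtype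
  have hF : Function.Injective F := spinorLin_injective.comp fun a b hab => by
    have h1 := congrArg Prod.fst hab
    have h2 := congrArg Prod.snd hab
    exact Prod.ext h1 (Subtype.ext h2)
  have hr : LinearMap.range F = P.K1 := by
    ext ψ
    rw [mem_K1', LinearMap.mem_range]
    constructor
    · rintro ⟨ξ, rfl⟩
      exact ⟨(ξ.1, ξ.2), Xminus_eq_zero_iff.1 ξ.2.2, rfl⟩
    · rintro ⟨ξ, hξ, rfl⟩
      exact ⟨(ξ.1, ⟨ξ.2, Xminus_eq_zero_iff.2 hξ⟩), rfl⟩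
  rw [← hr, LinearMap.finrank_range_of_inj hF, Module.finrank_prod, finrank_ker_Xminus]
  simp

/-! ### The explicit form -/

/-- The formula for `c̄` determines `α₊`; the one for `d` is its definition, and the one for `B`
follows from `α₊ = -3 α₊'`. -/
theorem explicit_iff : P.ap = -3 * P.ap' ↔
      P.B = -Matrix.diagonal
        ![(P.am - P.ap') ^ 2, (P.am - P.ap') ^ 2, (P.am + P.ap') ^ 2, (P.am + P.ap') ^ 2,
          16 * P.ap' ^ 2, 4 * P.ap' ^ 2, 4 * P.ap' ^ 2, 4 * P.ap' ^ 2, 4 * P.ap' ^ 2] ∧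
      P.cbar = (((-3 * P.ap' : ℝ) : ℂ) • CahenWallach.Xplus
        + (P.am : ℂ) • CahenWallach.Xminus) * CahenWallach.gam125 ∧
      P.d = ((P.ap' : ℂ) • CahenWallach.Xplus
        + (P.am' : ℂ) • CahenWallach.Xminus) * CahenWallach.gam125 := by
  constructor
  · intro h
    refine ⟨?_, ?_, rfl⟩
    · rw [B]
      congr 2
      funext i
      have h' : i = 0 ∨ i = 1 ∨ i = 2 ∨ i = 3 ∨ i = 4 ∨ i = 5 ∨ i = 6 ∨ i = 7 ∨ i = 8 := by
        revert i; decide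
      rcases h' with rfl | rfl | rfl | rfl | rfl | rfl | rfl | rfl | rfl <;>
        simp [kap, h] <;> ring
    · rw [cbar, h]
  · rintro ⟨-, h, -⟩
    -- On a spinor with `X⁻ ξ = 0`, `c̄` acts as `α₊ γ₁₂₅`, so that `c̄` determines `α₊`.
    obtain ⟨ξ, hξ, hne⟩ : ∃ ξ : SV → ℂ, gam1234 *ᵥ ξ = ξ ∧ ξ ≠ 0 := by
      have := finrank_ker_Xminus
      obtain ⟨⟨ξ, hξ⟩, hne⟩ := Module.finrank_pos_iff_exists_ne_zero.1 (show
        0 < Module.finrank ℂ (LinearMap.ker (Matrix.mulVecLin Xminus)) by omega)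
      exact ⟨ξ, Xminus_eq_zero_iff.1 hξ, fun h => hne (Subtype.ext h)⟩
    have e1 : P.cbar *ᵥ ξ = (P.ap : ℂ) • gam125 *ᵥ ξ := by
      rw [cbar_mulVec, gam1234_gam125, hξ]
      module
    have e2 : P.cbar *ᵥ ξ = ((-3 * P.ap' : ℝ) : ℂ) • gam125 *ᵥ ξ := by
      have : P.cbar = cbar ⟨-3 * P.ap', P.am, 0, 0⟩ := h
      rw [this, cbar_mulVec, gam1234_gam125, hξ]
      module
    rw [e1] at e2
    have h3 : ((P.ap : ℂ) - ((-3 * P.ap' : ℝ) : ℂ)) • gam125 *ᵥ ξ = 0 := by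
      rw [sub_smul, e2, sub_self]
    rcases smul_eq_zero.1 h3 with h4 | h4
    · exact_mod_cast sub_eq_zero.1 h4
    · refine absurd ?_ hne
      rw [← gam125_gam125 ξ, h4, mulVec_zero]

end Params
end CahenWallach

theorem mainTheorem1 (P : CahenWallach.Params)
    (hind : CahenWallach.IsIndecomposable P.B) :
    P.IsGeometricSuperalgebra ∧
    Module.finrank ℂ P.K1 = 24 ∧
    (¬ P.IsFlat → P.IsNonRestricted) ∧
    (P.IsGeometricSupersymmetry ↔ P.ap = -3 * P.ap') ∧
    (P.IsGeometricSupersymmetry ↔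
      P.B = -Matrix.diagonal
        ![(P.am - P.ap') ^ 2, (P.am - P.ap') ^ 2, (P.am + P.ap') ^ 2, (P.am + P.ap') ^ 2,
          16 * P.ap' ^ 2, 4 * P.ap' ^ 2, 4 * P.ap' ^ 2, 4 * P.ap' ^ 2, 4 * P.ap' ^ 2] ∧
      P.cbar = (((-3 * P.ap' : ℝ) : ℂ) • CahenWallach.Xplus
        + (P.am : ℂ) • CahenWallach.Xminus) * CahenWallach.gam125 ∧
      P.d = ((P.ap' : ℂ) • CahenWallach.Xplus
        + (P.am' : ℂ) • CahenWallach.Xminus) * CahenWallach.gam125) := by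
  have hk : ∀ i, P.k i ≠ 0 := CahenWallach.Params.k_ne_zero hind
  refine ⟨CahenWallach.Params.isGeometricSuperalgebra hk, CahenWallach.Params.finrank_K1,
    CahenWallach.Params.isNonRestricted_of_not_isFlat,
    CahenWallach.Params.isGeometricSupersymmetry_iff hk, ?_⟩
  rw [CahenWallach.Params.isGeometricSupersymmetry_iff hk, CahenWallach.Params.explicit_iff]
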